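/- **Setting.** Let $\iota,\mathcal A,\mathcal I$ be finite index sets and let $U\subseteq\mathbb R^{\iota}\times\mathbb R^{\iota}$ be an open set (a Darboux chart) with coordinates $(q_i,p^i)$ and canonical Poisson bracket $\{q_i,p^j\}=\delta_i^j$. A finite family $c=(c_a)$ of smooth functions on $U$ is a *regular irreducible first-class set* if, at every point of $U$ where all $c_a$ vanish, the differentials $dc_a$ are linearly independent and all brackets $\{c_a,c_b\}$ vanish. Two sets of constraints are *equivalent* if they have the same zero set. The systems are generally covariant: the Hamiltonian is one of the constraints (or a combination of them), so there is no on-shell Hamiltonian. Let $\chi=(\chi_\alpha)_{\alpha\in\mathcal A}$, $\sigma=(\sigma^\alpha)_{\alpha\in\mathcal A}$ and $\eta=(\eta^i)_{i\in\mathcal I}$ be smooth functions on $U$ such that each of the sets $\chi$, $\sigma$, $\chi\cup\eta$, $\sigma\cup\eta$ is a regular irreducible first-class set, and such that the intersection of the surfaces $\chi=0$ and $\sigma=0$ is maximally symplectic, i.e. the matrix $\{\chi_\alpha,\sigma^\beta\}$ is invertible in a neighbourhood of $\{\chi=0=\sigma\}$. **Theorem.** Both symmetry trading and BRST symmetry doubling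 can be constructed, that is: **(1) Symmetry trading.** Every point of $\{\chi=0=\sigma\}$ has an open neighbourhood $V\subseteq U$ on which there are smooth invertible matrix-valued functions $M,N$ and functions $\eta'=(\eta'^i)_{i\in\mathcal I}$ such that the following holds. - The sets $\tilde\chi=M\chi$ and $\tilde\sigma=N\sigma$ satisfy $\{\tilde\chi_\alpha,\tilde\chi_\beta\}=0=\{\tilde\sigma^\alpha,\tilde\sigma^\beta\}$ and $\{\tilde\chi_\alpha,\tilde\sigma^\beta\}=\delta_\alpha^\beta$ on $V$. - On the extended phase space $V\times\mathbb R^{\mathcal A}\times\mathbb R^{\mathcal A}$ with additional canonical pairs $(\phi_\alpha,\pi^\alpha)$, the functions $\bar\chi=M^{-1}\phi-\chi$, $\bar\sigma=N^{-1}\pi+\sigma$ and $\eta'$ form a regular irreducible first-class set (the linking theory). - The condition $\phi=0$ gauge-fixes the constraints $\bar\sigma$ (the matrix $\{\phi_\alpha,\bar\sigma^\beta\}$ is invertible on $\{\phi=0=\bar\sigma\}$). The phase space reduction identifies $V$ with $\{\phi=0=\bar\sigma\}$ via $\phi=0$, $\pi=-N\sigma$, and carries the Dirac bracket to the Poisson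 bracket of $V$. The remaining constraints $\bar\chi,\eta'$ become a regular irreducible first-class set on $V$ equivalent to $\chi,\eta$. - Likewise, $\pi=0$ gauge-fixes the constraints $\bar\chi$; the reduction identifies $V$ with $\{\pi=0=\bar\chi\}$ via $\phi=M\chi$, $\pi=0$, carries the Dirac bracket to the Poisson bracket of $V$, and turns $\bar\sigma,\eta'$ into a regular irreducible first-class set on $V$ equivalent to $\sigma,\eta$. Moreover, on $U$, the gauge theory with constraints $\chi,\eta$ in which $\sigma=0$ gauge-fixes $\chi$, and the gauge theory with constraints $\sigma,\eta$ in which $\chi=0$ gauge-fixes $\sigma$, are both admissibly gauge-fixed (the matrix of brackets between the gauge-fixed constraints and the gauge conditions, and the matrix of all mutual brackets of $\chi$ and $\sigma$, are invertible on the gauge-fixed surface), and they have the same gauge-fixed surface $\{\chi=\sigma=\eta=0\}$ and the same Dirac bracket on it. **(2) Symmetry doubling.** The following holds for the pair of constraint sets $(c,d)=(\chi,\sigma)$, and also for the pair $(c,d)=(\chi\cup\eta,\ \sigma\cup\eta)$. Adjoin one anticommuting ghost $\mathsf c^a$ and one ghost momentum (antighost) $P_a$ for each constraint, and let $\{\cdot,\cdot\}$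 be the graded Poisson bracket on $C^\infty(U)\otimes\Lambda[\mathsf c^a,P_a]$ that extends the Poisson bracket of $U$ and satisfies $\{\mathsf c^a,P_b\}=\delta^a_b$. A *BRST charge* of $c$ is an element $$\Omega=\sum_{n\ge0}\mathsf c^{a_1}\cdots\mathsf c^{a_{n+1}}\,U^{(n)\,b_1\cdots b_n}_{a_1\cdots a_{n+1}}\,P_{b_1}\cdots P_{b_n},\qquad U^{(0)}_a=c_a,\qquad\{\Omega,\Omega\}=0,$$ with coefficients $U^{(n)}$ in $C^\infty(U)$. Then: - $c$ and $d$ each have a BRST charge. - If $\Omega'$ is any BRST charge of $d$ and $\Psi$ is obtained from $\Omega'$ by exchanging ghosts and ghost momenta ($\mathsf c^a\leftrightarrow P_a$), then $\Psi$ is a nilpotent gauge-fixing fermion: $\{\Psi,\Psi\}=0$ and $\Psi=\sum_{n\ge0}P_{a_1}\cdots P_{a_{n+1}}V_{(n)\,b_1\cdots b_n}^{a_1\cdots a_{n+1}}\mathsf c^{b_1}\cdots\mathsf c^{b_n}$ with smooth coefficients and $V_{(0)}^a=d^a$. - For any BRST charge $\Omega$ of $c$ and any such $\Psi$, the transformations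 $s_1=\{\Omega,\cdot\}$ and $s_2=\{\cdot,\Psi\}$ satisfy $s_1^2=0=s_2^2$, and the gauge-fixed Hamiltonian $H_\Psi=\{\Omega,\Psi\}$ satisfies $s_1H_\Psi=0=s_2H_\Psi$ on the whole extended phase space. -/

import Mathlib

open Filter Topology TopologicalSpace
open scoped ContDiff TensorProduct

/-! ## Phase space in a Darboux chart -/

/-- Darboux coordinate space with degrees of freedom indexed by `ι`: points are pairs `(q, p)`. -/
abbrev PhaseSpace (ι : Type*) : Type _ := (ι → ℝ) × (ι → ℝ)

/-- The coordinate direction of `q_i`. -/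
def dirQ {ι : Type*} [DecidableEq ι] (i : ι) : PhaseSpace ι := (Pi.single i 1, 0)

/-- The coordinate direction of `p^i`. -/
def dirP {ι : Type*} [DecidableEq ι] (i : ι) : PhaseSpace ι := (0, Pi.single i 1)

/-- The canonical Poisson bracket, with `{q_i, p^j} = δ_i^j`. -/
noncomputable def poissonBracket {ι : Type*} [Fintype ι] [DecidableEq ι]
    (f g : PhaseSpace ι → ℝ) (x : PhaseSpace ι) : ℝ :=
  ∑ i, (fderiv ℝ f x (dirQ i) * fderiv ℝ g x (dirP i)
    - fderiv ℝ f x (dirP i) * fderiv ℝ g x (dirQ i))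

/-- The matrix of brackets `{c_a, d_b}` at a point. -/
noncomputable def bracketMatrix {ι κ κ' : Type*} [Fintype ι] [DecidableEq ι]
    (c : κ → PhaseSpace ι → ℝ) (d : κ' → PhaseSpace ι → ℝ) (x : PhaseSpace ι) :
    Matrix κ κ' ℝ :=
  Matrix.of fun a b => poissonBracket (c a) (d b) x

/-- The Dirac bracket of the (second class) family `ψ`. -/
noncomputable def diracBracket {ι κ : Type*} [Fintype ι] [DecidableEq ι] [Fintype κ]
    [DecidableEq κ] (ψ : κ → PhaseSpace ι → ℝ) (f g : PhaseSpace ι → ℝ) (x : PhaseSpace ι) : ℝ :=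
  poissonBracket f g x
    - ∑ a, ∑ b, poissonBracket f (ψ a) x * (bracketMatrix ψ ψ x)⁻¹ a b * poissonBracket (ψ b) g x

/-- The surface in `U` on which all the functions `c a` vanish. -/
def constraintSurface {ι κ : Type*} (U : Set (PhaseSpace ι)) (c : κ → PhaseSpace ι → ℝ) :
    Set (PhaseSpace ι) :=
  {x | x ∈ U ∧ ∀ a, c a x = 0}

/-- A regular and irreducible set of first class constraints on `U`: smooth functions whose
differentials are linearly independent on the constraint surface and whose mutual Poisson brackets
vanish there. -/
structure IsFirstClassSystem {ι κ : Type*} [Fintype ι] [DecidableEq ι]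
    (U : Set (PhaseSpace ι)) (c : κ → PhaseSpace ι → ℝ) : Prop where
  smooth : ∀ a, ContDiffOn ℝ ∞ (c a) U
  regular_irreducible : ∀ x ∈ constraintSurface U c,
    LinearIndependent ℝ (fun a => fderiv ℝ (c a) x)
  first_class : ∀ x ∈ constraintSurface U c, ∀ a b, poissonBracket (c a) (c b) x = 0

/-- The intersection of the surfaces `χ = 0` and `σ = 0` is maximally symplectic: `{χ_α, σ^β}` is
invertible in a neighbourhood of that intersection. -/
def IsMaximallySymplectic {ι A : Type*} [Fintype ι] [DecidableEq ι] [Fintype A] [DecidableEq A]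
    (U : Set (PhaseSpace ι)) (χ σ : A → PhaseSpace ι → ℝ) : Prop :=
  ∀ x ∈ constraintSurface U χ ∩ constraintSurface U σ,
    ∀ᶠ y in 𝓝 x, IsUnit (bracketMatrix χ σ y).det

/-! ## Symmetry trading -/

/-- The gauge theory with constraints `c₁, η`, where `c₁` is gauge-fixed by `ψ₁`, agrees with the
gauge theory with constraints `c₂, η`, where `c₂` is gauge-fixed by `ψ₂`: both gauge fixings are
admissible, the two gauge-fixed surfaces (initial value problems) are identical, and so are the two
Dirac brackets on them (equations of motion; the Hamiltonian is one of the constraints). -/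
structure GaugeFixedTheoriesAgree {ι A I : Type*} [Fintype ι] [DecidableEq ι] [Fintype A]
    [DecidableEq A] (U : Set (PhaseSpace ι)) (c₁ ψ₁ c₂ ψ₂ : A → PhaseSpace ι → ℝ)
    (η : I → PhaseSpace ι → ℝ) : Prop where
  surface_eq : constraintSurface U (Sum.elim (Sum.elim c₁ ψ₁) η)
    = constraintSurface U (Sum.elim (Sum.elim c₂ ψ₂) η)
  admissible₁ : ∀ x ∈ constraintSurface U (Sum.elim (Sum.elim c₁ ψ₁) η),
    IsUnit (bracketMatrix c₁ ψ₁ x).det ∧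
      IsUnit (bracketMatrix (Sum.elim c₁ ψ₁) (Sum.elim c₁ ψ₁) x).det
  admissible₂ : ∀ x ∈ constraintSurface U (Sum.elim (Sum.elim c₂ ψ₂) η),
    IsUnit (bracketMatrix c₂ ψ₂ x).det ∧
      IsUnit (bracketMatrix (Sum.elim c₂ ψ₂) (Sum.elim c₂ ψ₂) x).det
  dirac_eq : ∀ f g : PhaseSpace ι → ℝ, ContDiffOn ℝ ∞ f U → ContDiffOn ℝ ∞ g U →
    ∀ x ∈ constraintSurface U (Sum.elim (Sum.elim c₁ ψ₁) η),
      diracBracket (Sum.elim c₁ ψ₁) f g x = diracBracket (Sum.elim c₂ ψ₂) f g x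

/-- Projection of the extended phase space (coordinates `(q, φ; p, π)`) to the original one. -/
def extProj {ι A : Type*} (z : PhaseSpace (ι ⊕ A)) : PhaseSpace ι :=
  (fun i => z.1 (Sum.inl i), fun i => z.2 (Sum.inl i))

/-- The adjoined coordinate `φ_α`. -/
def extPhi {ι A : Type*} (α : A) (z : PhaseSpace (ι ⊕ A)) : ℝ := z.1 (Sum.inr α)

/-- The momentum `π^α` conjugate to `φ_α`. -/
def extPi {ι A : Type*} (α : A) (z : PhaseSpace (ι ⊕ A)) : ℝ := z.2 (Sum.inr α)

/-- The constraint set `M c`, i.e. `(M c)_α = ∑ β, M_α^β c_β`. -/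
def dressed {ι A : Type*} [Fintype A] (M : PhaseSpace ι → Matrix A A ℝ)
    (c : A → PhaseSpace ι → ℝ) (α : A) (x : PhaseSpace ι) : ℝ :=
  ∑ β, M x α β * c β x

/-- The linking constraint `M⁻¹ φ - χ`. -/
noncomputable def linkingChi {ι A : Type*} [Fintype A] [DecidableEq A]
    (M : PhaseSpace ι → Matrix A A ℝ) (χ : A → PhaseSpace ι → ℝ) (α : A)
    (z : PhaseSpace (ι ⊕ A)) : ℝ :=
  ∑ β, (M (extProj z))⁻¹ α β * extPhi β z - χ α (extProj z)

/-- The linking constraint `N⁻¹ π + σ`. -/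
noncomputable def linkingSigma {ι A : Type*} [Fintype A] [DecidableEq A]
    (N : PhaseSpace ι → Matrix A A ℝ) (σ : A → PhaseSpace ι → ℝ) (α : A)
    (z : PhaseSpace (ι ⊕ A)) : ℝ :=
  ∑ β, (N (extProj z))⁻¹ α β * extPi β z + σ α (extProj z)

/-- The surface `φ = 0`, `π = - N σ`, parametrised by the original phase space. -/
def embedPhiZero {ι A : Type*} [Fintype A] (N : PhaseSpace ι → Matrix A A ℝ)
    (σ : A → PhaseSpace ι → ℝ) (x : PhaseSpace ι) : PhaseSpace (ι ⊕ A) :=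
  (Sum.elim x.1 0, Sum.elim x.2 fun α => - dressed N σ α x)

/-- The surface `φ = M χ`, `π = 0`, parametrised by the original phase space. -/
def embedPiZero {ι A : Type*} [Fintype A] (M : PhaseSpace ι → Matrix A A ℝ)
    (χ : A → PhaseSpace ι → ℝ) (x : PhaseSpace ι) : PhaseSpace (ι ⊕ A) :=
  (Sum.elim x.1 fun α => dressed M χ α x, Sum.elim x.2 0)

/-- The gauge theory on `W` with constraints `L, K`, after the partial gauge fixing `ψ = 0` of the
constraints `L`, reduces to the gauge theory on `V` with a constraint set equivalent to `c`. The
phase space reduction is the embedding `e` of `V` onto `{ψ = 0 = L}`; it takes the Dirac bracket to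
the Poisson bracket of `V`. Constraint sets are equivalent when they define the same surface. -/
structure IsReduction {ι ι' A κ : Type*} [Fintype ι] [DecidableEq ι] [Fintype ι'] [DecidableEq ι']
    [Fintype A] [DecidableEq A] (W : Set (PhaseSpace ι')) (ψ L : A → PhaseSpace ι' → ℝ)
    (K : κ → PhaseSpace ι' → ℝ) (V : Set (PhaseSpace ι)) (c : κ → PhaseSpace ι → ℝ)
    (e : PhaseSpace ι → PhaseSpace ι') : Prop where
  injOn : Set.InjOn e V
  image_eq : e '' V = constraintSurface W (Sum.elim ψ L)
  fixes : ∀ x ∈ V, IsUnit (bracketMatrix ψ L (e x)).det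
  dirac_eq : ∀ F G : PhaseSpace ι' → ℝ, ContDiffOn ℝ ∞ F W → ContDiffOn ℝ ∞ G W →
    ∀ x ∈ V, diracBracket (Sum.elim ψ L) F G (e x) = poissonBracket (F ∘ e) (G ∘ e) x
  firstClass : IsFirstClassSystem V (fun a => K a ∘ e)
  surface_eq : constraintSurface V (fun a => K a ∘ e) = constraintSurface V c

/-- The linking theory over `V` for the traded constraints `χ`, `σ` and the untraded constraints
`η`. The matrices `M`, `N` make `χ` and `σ` Abelian and canonically conjugate; the first class
constraints on extended phase space are `M⁻¹ φ - χ`, `N⁻¹ π + σ` and `η'`; the partial gauge fixing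
`φ = 0` gives the gauge theory of `χ, η` and the partial gauge fixing `π = 0` that of `σ, η`, up to
equivalence of constraint sets. -/
structure IsLinkingTheory {ι A I : Type*} [Fintype ι] [DecidableEq ι] [Fintype A] [DecidableEq A]
    (V : Set (PhaseSpace ι)) (χ σ : A → PhaseSpace ι → ℝ) (η η' : I → PhaseSpace ι → ℝ)
    (M N : PhaseSpace ι → Matrix A A ℝ) : Prop where
  smooth_M : ∀ α β, ContDiffOn ℝ ∞ (fun x => M x α β) V
  smooth_N : ∀ α β, ContDiffOn ℝ ∞ (fun x => N x α β) V
  invertible_M : ∀ x ∈ V, IsUnit (M x).det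
  invertible_N : ∀ x ∈ V, IsUnit (N x).det
  abelian_χ : ∀ x ∈ V, bracketMatrix (dressed M χ) (dressed M χ) x = 0
  abelian_σ : ∀ x ∈ V, bracketMatrix (dressed N σ) (dressed N σ) x = 0
  conjugate : ∀ x ∈ V, bracketMatrix (dressed M χ) (dressed N σ) x = 1
  firstClass : IsFirstClassSystem (extProj ⁻¹' V : Set (PhaseSpace (ι ⊕ A)))
    (Sum.elim (Sum.elim (linkingChi M χ) (linkingSigma N σ)) fun i z => η' i (extProj z))
  reduction_φ : IsReduction (extProj ⁻¹' V : Set (PhaseSpace (ι ⊕ A))) extPhi (linkingSigma N σ)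
    (Sum.elim (linkingChi M χ) fun i z => η' i (extProj z)) V (Sum.elim χ η) (embedPhiZero N σ)
  reduction_π : IsReduction (extProj ⁻¹' V : Set (PhaseSpace (ι ⊕ A))) extPi (linkingChi M χ)
    (Sum.elim (linkingSigma N σ) fun i z => η' i (extProj z)) V (Sum.elim σ η) (embedPiZero M χ)

/-- Symmetry trading: around each point where `χ = 0 = σ` there is a linking theory for the gauge
theories with constraints `χ, η` and `σ, η`; and these two theories, gauge-fixed by `σ` and by `χ`
respectively, agree. -/
def SymmetryTrading {ι A I : Type*} [Fintype ι] [DecidableEq ι] [Fintype A] [DecidableEq A]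
    (U : Set (PhaseSpace ι)) (χ σ : A → PhaseSpace ι → ℝ) (η : I → PhaseSpace ι → ℝ) : Prop :=
  (∀ x ∈ constraintSurface U χ ∩ constraintSurface U σ,
    ∃ V : Set (PhaseSpace ι), IsOpen V ∧ x ∈ V ∧ V ⊆ U ∧
      ∃ (M N : PhaseSpace ι → Matrix A A ℝ) (η' : I → PhaseSpace ι → ℝ),
        IsLinkingTheory V χ σ η η' M N) ∧
  GaugeFixedTheoriesAgree U χ σ σ χ η

/-! ## Superfunctions on the ghost-extended phase space -/

/-- Extension by zero of a function on the open set `U`. -/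
noncomputable def zeroExt {ι : Type*} (U : Opens (PhaseSpace ι)) (f : U → ℝ) :
    PhaseSpace ι → ℝ :=
  open Classical in fun x => if h : x ∈ U then f ⟨x, h⟩ else 0

theorem zeroExt_apply {ι : Type*} {U : Opens (PhaseSpace ι)} (f : U → ℝ) {x : PhaseSpace ι}
    (h : x ∈ U) : zeroExt U f x = f ⟨x, h⟩ := by
  simp [zeroExt, h]

/-- The algebra `C^∞(U)`. -/
noncomputable def SmoothFn {ι : Type*} [Fintype ι] (U : Opens (PhaseSpace ι)) :
    Subalgebra ℝ (U → ℝ) where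
  carrier := {f | ContDiffOn ℝ ∞ (zeroExt U f) U}
  mul_mem' {f g} hf hg := by
    refine (ContDiffOn.mul hf hg).congr fun x hx => ?_
    simp [zeroExt_apply _ hx]
  add_mem' {f g} hf hg := by
    refine (ContDiffOn.add hf hg).congr fun x hx => ?_
    simp [zeroExt_apply _ hx]
  algebraMap_mem' r := by
    refine (contDiffOn_const (c := r)).congr fun x hx => ?_
    simp [zeroExt_apply _ hx]

theorem smoothFn_differentiableAt {ι : Type*} [Fintype ι] {U : Opens (PhaseSpace ι)}
    (f : SmoothFn U) (x : U) : DifferentiableAt ℝ (zeroExt U f.1) x.1 :=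
  (f.2.contDiffAt (U.2.mem_nhds x.2)).differentiableAt (by simp)

/-- The derivative of a smooth function on `U` in the constant direction `v`. -/
noncomputable def smoothFnDeriv {ι : Type*} [Fintype ι] {U : Opens (PhaseSpace ι)}
    (v : PhaseSpace ι) : SmoothFn U →ₗ[ℝ] SmoothFn U where
  toFun f := ⟨fun x => fderiv ℝ (zeroExt U f.1) x.1 v, by
    have h : ContDiffOn ℝ ∞ (fun x => fderiv ℝ (zeroExt U f.1) x v) U :=
      (f.2.fderiv_of_isOpen U.2 (by simp)).clm_apply contDiffOn_const
    exact h.congr fun x hx => zeroExt_apply _ hx⟩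
  map_add' f g := by
    ext x
    have h : zeroExt U (f + g).1 = zeroExt U f.1 + zeroExt U g.1 := by
      ext y; by_cases hy : y ∈ U <;> simp [zeroExt, hy]
    change fderiv ℝ (zeroExt U (f + g).1) x.1 v
      = fderiv ℝ (zeroExt U f.1) x.1 v + fderiv ℝ (zeroExt U g.1) x.1 v
    rw [h, fderiv_add (smoothFn_differentiableAt f x) (smoothFn_differentiableAt g x)]
    rfl
  map_smul' r f := by
    ext x
    have h : zeroExt U (r • f).1 = r • zeroExt U f.1 := by
      ext y; by_cases hy : y ∈ U <;> simp [zeroExt, hy]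
    change fderiv ℝ (zeroExt U (r • f).1) x.1 v = r * fderiv ℝ (zeroExt U f.1) x.1 v
    rw [h, fderiv_const_smul (smoothFn_differentiableAt f x)]
    rfl

/-- The algebra generated by anticommuting ghosts `η^α` and ghost momenta `P_α`, `α : A`. -/
abbrev GhostAlgebra (A : Type*) : Type _ := ExteriorAlgebra ℝ ((A → ℝ) × (A → ℝ))

/-- The ghost `η^α`. -/
noncomputable def ghost {A : Type*} [DecidableEq A] (α : A) : GhostAlgebra A :=
  ExteriorAlgebra.ι ℝ (Pi.single α 1, 0)

/-- The ghost momentum (antighost) `P_α`. -/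
noncomputable def ghostMomentum {A : Type*} [DecidableEq A] (α : A) : GhostAlgebra A :=
  ExteriorAlgebra.ι ℝ (0, Pi.single α 1)

/-- The coordinate form dual to the generator `η^α`. -/
def ghostCoord {A : Type*} (α : A) : Module.Dual ℝ ((A → ℝ) × (A → ℝ)) :=
  LinearMap.proj α ∘ₗ LinearMap.fst ℝ (A → ℝ) (A → ℝ)

/-- The coordinate form dual to the generator `P_α`. -/
def ghostMomentumCoord {A : Type*} (α : A) : Module.Dual ℝ ((A → ℝ) × (A → ℝ)) :=
  LinearMap.proj α ∘ₗ LinearMap.snd ℝ (A → ℝ) (A → ℝ)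

/-- Superfunctions on the fermionic extension of `U`, i.e. polynomials in ghosts and ghost momenta
with coefficients in `C^∞(U)`. -/
abbrev SuperFn {ι : Type*} [Fintype ι] (U : Opens (PhaseSpace ι)) (A : Type*) : Type _ :=
  SmoothFn U ⊗[ℝ] GhostAlgebra A

/-- The derivative of a superfunction in a bosonic direction. -/
noncomputable def bosonicDeriv {ι A : Type*} [Fintype ι] {U : Opens (PhaseSpace ι)}
    (v : PhaseSpace ι) : SuperFn U A →ₗ[ℝ] SuperFn U A :=
  LinearMap.rTensor (GhostAlgebra A) (smoothFnDeriv v)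

/-- The left derivative with respect to the generator dual to `d`. -/
noncomputable def leftDeriv {ι A : Type*} [Fintype ι] {U : Opens (PhaseSpace ι)}
    (d : Module.Dual ℝ ((A → ℝ) × (A → ℝ))) : SuperFn U A →ₗ[ℝ] SuperFn U A :=
  LinearMap.lTensor (SmoothFn U) (CliffordAlgebra.contractLeft d)

/-- The right derivative with respect to the generator dual to `d`. -/
noncomputable def rightDeriv {ι A : Type*} [Fintype ι] {U : Opens (PhaseSpace ι)}
    (d : Module.Dual ℝ ((A → ℝ) × (A → ℝ))) : SuperFn U A →ₗ[ℝ] SuperFn U A :=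
  LinearMap.lTensor (SmoothFn U) (CliffordAlgebra.contractRight.flip d)

/-- The graded Poisson bracket of the extended phase space: it extends the Poisson bracket of `U`
and satisfies `{η^α, P_β} = δ^α_β = {P_β, η^α}`. -/
noncomputable def superBracket {ι A : Type*} [Fintype ι] [DecidableEq ι] [Fintype A]
    {U : Opens (PhaseSpace ι)} (F G : SuperFn U A) : SuperFn U A :=
  ∑ i, (bosonicDeriv (dirQ i) F * bosonicDeriv (dirP i) G
      - bosonicDeriv (dirP i) F * bosonicDeriv (dirQ i) G)
    + ∑ α, (rightDeriv (ghostCoord α) F * leftDeriv (ghostMomentumCoord α) G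
      + rightDeriv (ghostMomentumCoord α) F * leftDeriv (ghostCoord α) G)

/-! ## BRST charges and symmetry doubling -/

/-- The monomial `η^{α_1} ⋯ η^{α_n}`. -/
noncomputable def ghostMonomial {A : Type*} [DecidableEq A] {n : ℕ} (α : Fin n → A) :
    GhostAlgebra A :=
  (List.ofFn fun k => ghost (α k)).prod

/-- The monomial `P_{β_1} ⋯ P_{β_n}`. -/
noncomputable def ghostMomentumMonomial {A : Type*} [DecidableEq A] {n : ℕ} (β : Fin n → A) :
    GhostAlgebra A :=
  (List.ofFn fun k => ghostMomentum (β k)).prod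

/-- `Ω` is a BRST charge of the constraints `c`: a nilpotent superfunction
`∑ n, η^{α_1} ⋯ η^{α_{n+1}} U^{(n)} P_{β_1} ⋯ P_{β_n}` with `U^{(0)}_α = c_α`. The terms with
`n ≥ card A` vanish. -/
def IsBRSTCharge {ι A : Type*} [Fintype ι] [DecidableEq ι] [Fintype A] [DecidableEq A]
    (U : Opens (PhaseSpace ι)) (c : A → PhaseSpace ι → ℝ) (Ω : SuperFn U A) : Prop :=
  (∃ u : (n : ℕ) → (Fin (n + 1) → A) → (Fin n → A) → SmoothFn U,
    (∀ α β, ∀ x : U, (u 0 α β).1 x = c (α 0) x.1) ∧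
    Ω = ∑ n ∈ Finset.range (Fintype.card A + 1), ∑ α : Fin (n + 1) → A, ∑ β : Fin n → A,
      u n α β ⊗ₜ[ℝ] (ghostMonomial α * ghostMomentumMonomial β)) ∧
  superBracket Ω Ω = 0

/-- `Ψ` is a nilpotent gauge-fixing fermion for the gauge-fixing functions `σ`: a nilpotent
superfunction `∑ n, P_{α_1} ⋯ P_{α_{n+1}} V_{(n)} η^{β_1} ⋯ η^{β_n}` with `V_{(0)}^α = σ^α`. -/
def IsNilpotentGaugeFixingFermion {ι A : Type*} [Fintype ι] [DecidableEq ι] [Fintype A]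
    [DecidableEq A] (U : Opens (PhaseSpace ι)) (σ : A → PhaseSpace ι → ℝ) (Ψ : SuperFn U A) :
    Prop :=
  (∃ w : (n : ℕ) → (Fin (n + 1) → A) → (Fin n → A) → SmoothFn U,
    (∀ α β, ∀ x : U, (w 0 α β).1 x = σ (α 0) x.1) ∧
    Ψ = ∑ n ∈ Finset.range (Fintype.card A + 1), ∑ α : Fin (n + 1) → A, ∑ β : Fin n → A,
      w n α β ⊗ₜ[ℝ] (ghostMomentumMonomial α * ghostMonomial β)) ∧
  superBracket Ψ Ψ = 0

/-- The algebra automorphism exchanging `η^α` and `P_α` for all `α`. -/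
noncomputable def ghostSwap {ι A : Type*} [Fintype ι] {U : Opens (PhaseSpace ι)} :
    SuperFn U A →ₐ[ℝ] SuperFn U A :=
  Algebra.TensorProduct.map (AlgHom.id ℝ (SmoothFn U))
    (ExteriorAlgebra.map (LinearEquiv.prodComm ℝ (A → ℝ) (A → ℝ)).toLinearMap)

/-- The gauge-fixed BRST Hamiltonian `{Ω, Ψ}` of a generally covariant system, i.e. one whose
on-shell Hamiltonian is zero. -/
noncomputable def gaugeFixedHamiltonian {ι A : Type*} [Fintype ι] [DecidableEq ι] [Fintype A]
    {U : Opens (PhaseSpace ι)} (Ω Ψ : SuperFn U A) : SuperFn U A :=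
  superBracket Ω Ψ

/-- The transformation `s₁ = {Ω, ·}`. -/
noncomputable def brstLeft {ι A : Type*} [Fintype ι] [DecidableEq ι] [Fintype A]
    {U : Opens (PhaseSpace ι)} (Ω : SuperFn U A) (F : SuperFn U A) : SuperFn U A :=
  superBracket Ω F

/-- The transformation `s₂ = {·, Ψ}`. -/
noncomputable def brstRight {ι A : Type*} [Fintype ι] [DecidableEq ι] [Fintype A]
    {U : Opens (PhaseSpace ι)} (Ψ : SuperFn U A) (F : SuperFn U A) : SuperFn U A :=
  superBracket F Ψ

/-- BRST symmetry doubling on `U` for constraints `χ` and gauge-fixing functions `σ`. Both sets have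
a BRST charge. For any BRST charges `Ω` of `χ` and `Ω'` of `σ`, swapping ghosts and ghost momenta in
`Ω'` gives a nilpotent gauge-fixing fermion `Ψ`, the transformations `s₁ = {Ω, ·}` and
`s₂ = {·, Ψ}` square to zero, and both leave the gauge-fixed Hamiltonian `{Ω, Ψ}` invariant. -/
structure SymmetryDoubling {ι A : Type*} [Fintype ι] [DecidableEq ι] [Fintype A] [DecidableEq A]
    (U : Opens (PhaseSpace ι)) (χ σ : A → PhaseSpace ι → ℝ) : Prop where
  exists_charge : ∃ Ω, IsBRSTCharge U χ Ω
  exists_dual_charge : ∃ Ω', IsBRSTCharge U σ Ω'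
  fermion : ∀ Ω', IsBRSTCharge U σ Ω' → IsNilpotentGaugeFixingFermion U σ (ghostSwap Ω')
  nilpotent_s₁ : ∀ Ω, IsBRSTCharge U χ Ω → ∀ F, brstLeft Ω (brstLeft Ω F) = 0
  nilpotent_s₂ : ∀ Ω', IsBRSTCharge U σ Ω' →
    ∀ F, brstRight (ghostSwap Ω') (brstRight (ghostSwap Ω') F) = 0
  invariant_s₁ : ∀ Ω Ω', IsBRSTCharge U χ Ω → IsBRSTCharge U σ Ω' →
    brstLeft Ω (gaugeFixedHamiltonian Ω (ghostSwap Ω')) = 0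
  invariant_s₂ : ∀ Ω Ω', IsBRSTCharge U χ Ω → IsBRSTCharge U σ Ω' →
    brstRight (ghostSwap Ω') (gaugeFixedHamiltonian Ω (ghostSwap Ω')) = 0

/-!
**Symmetry trading.** Let `χ`, `σ` be first class with `{χ, σ}` invertible where both vanish.
Functions `Q` with constant mutual brackets have commuting Hamiltonian fields, whose joint flow can
be straightened relative to a transversal surface `f = 0` (`exists_hamiltonian_straightening`). The
times `τ` at which the flow lines reach the surface are conjugate to `Q`; by the Jacobi identity
their mutual brackets are constant along the flow, and they vanish on the surface when `f` is first
class, so `-τ = M f` is Abelian. Taking for `Q` the linearizations of `σ` at a point gives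
`P = M χ`, and then `Q = P` gives `S = N σ` conjugate to `P`
(`exists_conjugate_abelianization`). Smoothness of the flows in time and initial point comes from
the implicit function theorem in the Banach space of paths (`exists_smooth_local_flow`).

The untraded `η` are first class together with `χ` and together with `σ`, but they need not commute
with `P` and `S` off the respective surfaces. They are replaced by `η' = η ∘ r`, where `r` is the
retraction along the flows of all `P`, `S` onto the surface `P = S = 0`
(`exists_commuting_constraints`). Then `η'` commutes with `P` and `S` identically. On `χ = 0` the
functions `η` and `η'` have the same zeros, since the surface `χ = η = 0` is invariant under the
flow of `P` by a Grönwall estimate (`exists_nhds_path_eq_zero_iff`); similarly on `σ = 0`. With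
canonical pairs `P`, `S` and commuting `η'`, the linking constraints are `M⁻¹ (φ - P)` and
`N⁻¹ (π + S)`, and both reductions are linear algebra on covectors (`isLinkingTheory_of_commuting`).

**Symmetry doubling.** A BRST charge is odd, and exchanging ghosts with ghost momenta preserves the
graded Poisson bracket (`superBracket_ghostSwap`). All statements about given charges are therefore
instances of the graded Jacobi identity `{Ω, {Ω, F}} = ½ {{Ω, Ω}, F}` for odd `Ω`
(`superBracket_superBracket`).

The existence of a charge is homological perturbation theory in the number of ghost momenta, which
may be carried out globally on `U`. If the terms of `{Ω, Ω}` with fewer than `n` ghost momenta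
vanish, then `{Ω, {Ω, Ω}} = 0` says that its term with `n` ghost momenta is closed for the Koszul
differential `∑ a, c_a ∂/∂P_a`. It is exact, and subtracting half of a primitive from `Ω` removes it
(`exists_correction`). For `n = 0` closedness is replaced by the vanishing of `{c_a, c_b}` on the
surface. The Koszul complex with smooth coefficients is exact because near the surface the `c_a` are
part of a coordinate system, where the contraction `y ↦ y - (1 - t) ∑ a, c_a e_a` and Hadamard's
formula give a homotopy; away from the surface one divides by some `c_a ≠ 0`; and primitives form a convex set, so
that a partition of unity glues local ones (`exists_koszul_primitive`). The process ends because at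
most `card A` ghosts can be multiplied.
-/

set_option linter.unusedSectionVars false

/-! ### Smoothness of composition operators -/

section Nemytskii

variable {K : Type*} [TopologicalSpace K] [CompactSpace K]

/-- Pointwise application of a bounded bilinear map to two continuous functions, as a bounded
bilinear map. -/
noncomputable def ContinuousMap.pointwiseCLM₂ (K : Type*) [TopologicalSpace K] [CompactSpace K]
    {G E F : Type*} [NormedAddCommGroup G] [NormedSpace ℝ G] [NormedAddCommGroup E]
    [NormedSpace ℝ E] [NormedAddCommGroup F] [NormedSpace ℝ F] (B : G →L[ℝ] E →L[ℝ] F) :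
    C(K, G) →L[ℝ] C(K, E) →L[ℝ] C(K, F) :=
  LinearMap.mkContinuous₂
    (LinearMap.mk₂ ℝ (fun (A : C(K, G)) (v : C(K, E)) =>
        (⟨fun s => B (A s) (v s), by fun_prop⟩ : C(K, F)))
      (fun A B v => by ext s; simp) (fun r A v => by ext s; simp)
      (fun A v w => by ext s; simp) (fun r A v => by ext s; simp)) ‖B‖ fun A v => by
    rw [ContinuousMap.norm_le _ (by positivity)]
    intro s
    refine (B.le_opNorm₂ _ _).trans ?_
    gcongr
    exacts [A.norm_coe_le_norm s, v.norm_coe_le_norm s]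

@[simp]
theorem ContinuousMap.pointwiseCLM₂_apply {G E F : Type*} [NormedAddCommGroup G] [NormedSpace ℝ G]
    [NormedAddCommGroup E] [NormedSpace ℝ E] [NormedAddCommGroup F] [NormedSpace ℝ F]
    (B : G →L[ℝ] E →L[ℝ] F) (A : C(K, G)) (v : C(K, E)) (s : K) :
    ContinuousMap.pointwiseCLM₂ K B A v s = B (A s) (v s) := rfl

/-- The composition operator `u ↦ f ∘ u` on continuous functions is differentiable when `f` is of
class `C¹`: by the mean value inequality the error is controlled by the continuity of
`u ↦ f' ∘ u` in the uniform norm. The derivative is presented through a space `G` acting on `E` by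
`B`, so that no topology on spaces of linear maps enters. -/
theorem ContinuousMap.hasFDerivAt_postcomp {G E F : Type*} [NormedAddCommGroup G]
    [NormedSpace ℝ G] [NormedAddCommGroup E] [NormedSpace ℝ E]
    [NormedAddCommGroup F] [NormedSpace ℝ F] (B : G →L[ℝ] E →L[ℝ] F) {f : C(E, F)} {f' : C(E, G)}
    (hf : ∀ x, HasFDerivAt f (B (f' x)) x) (u : C(K, E)) :
    HasFDerivAt (fun v : C(K, E) => f.comp v)
      (ContinuousMap.pointwiseCLM₂ K B (f'.comp u)) u := by
  rw [hasFDerivAt_iff_isLittleO_nhds_zero, Asymptotics.isLittleO_iff]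
  intro ε hε
  have hc : Continuous fun v : C(K, E) => f'.comp v := ContinuousMap.continuous_postcomp f'
  have hε' : 0 < ε / (‖B‖ + 1) := by positivity
  obtain ⟨δ, hδ, h⟩ := Metric.tendsto_nhds_nhds.1 (hc.tendsto u) _ hε'
  filter_upwards [Metric.ball_mem_nhds (0 : C(K, E)) hδ] with v hv
  rw [mem_ball_zero_iff] at hv
  rw [ContinuousMap.norm_le _ (by positivity)]
  intro s
  have key : ∀ z ∈ segment ℝ (u s) (u s + v s), ‖B (f' z) - B (f' (u s))‖ ≤ ε := by
    intro z hz
    rw [segment_eq_image'] at hz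
    obtain ⟨θ, hθ, rfl⟩ := hz
    have h1 : dist (u + θ • v) u < δ := by
      rw [dist_eq_norm, add_sub_cancel_left, norm_smul, Real.norm_eq_abs, abs_of_nonneg hθ.1]
      exact lt_of_le_of_lt (mul_le_of_le_one_left (norm_nonneg _) hθ.2) hv
    have h2 := h h1
    rw [dist_eq_norm] at h2
    have h3 := (ContinuousMap.norm_coe_le_norm (f'.comp (u + θ • v) - f'.comp u) s).trans h2.le
    rw [← map_sub]
    refine (B.le_opNorm _).trans ?_
    have h4 : ‖f' (u s + θ • (u s + v s - u s)) - f' (u s)‖ ≤ ε / (‖B‖ + 1) := by simpa using h3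
    calc _ ≤ ‖B‖ * (ε / (‖B‖ + 1)) := by gcongr
      _ ≤ (‖B‖ + 1) * (ε / (‖B‖ + 1)) := by gcongr; simp
      _ = ε := by field_simp
  have := (convex_segment (u s) (u s + v s)).norm_image_sub_le_of_norm_hasFDerivWithin_le'
    (f := f) (f' := fun x => B (f' x)) (φ := B (f' (u s)))
    (fun z _ => (hf z).hasFDerivWithinAt) key
    (left_mem_segment ℝ _ _) (right_mem_segment ℝ _ _)
  simp only [add_sub_cancel_left] at this
  refine le_trans ?_ (this.trans (mul_le_mul_of_nonneg_left (v.norm_coe_le_norm s) hε.le))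
  simp

theorem ContinuousMap.contDiff_succ_postcomp {n : ℕ} {G E F : Type*} [NormedAddCommGroup G]
    [NormedSpace ℝ G] [NormedAddCommGroup E] [NormedSpace ℝ E]
    [NormedAddCommGroup F] [NormedSpace ℝ F] (B : G →L[ℝ] E →L[ℝ] F) {f : C(E, F)} {f' : C(E, G)}
    (hf : ∀ x, HasFDerivAt f (B (f' x)) x)
    (h : ContDiff ℝ n (fun v : C(K, E) => f'.comp v)) :
    ContDiff ℝ (n + 1) (fun v : C(K, E) => f.comp v) := by
  rw [contDiff_succ_iff_hasFDerivAt]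
  exact ⟨fun u => ContinuousMap.pointwiseCLM₂ K B (f'.comp u),
    (ContinuousMap.pointwiseCLM₂ K B).contDiff.comp h, ContinuousMap.hasFDerivAt_postcomp B hf⟩

universe u v

theorem ContinuousMap.contDiff_postcomp_nat (n : ℕ) {E : Type u} {F : Type (max u v)}
    [NormedAddCommGroup E] [NormedSpace ℝ E] [NormedAddCommGroup F] [NormedSpace ℝ F]
    (f : C(E, F)) (hf : ContDiff ℝ ∞ f) :
    ContDiff ℝ n (fun v : C(K, E) => f.comp v) := by
  induction n generalizing F with
  | zero => exact contDiff_zero.2 (ContinuousMap.continuous_postcomp f)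
  | succ n ih =>
    have h1 : ContDiff ℝ ∞ (fderiv ℝ f) := hf.fderiv_right (by simp)
    exact ContinuousMap.contDiff_succ_postcomp (.id ℝ (E →L[ℝ] F))
      (fun x => (hf.differentiable (by simp)).differentiableAt.hasFDerivAt)
      (ih ⟨fderiv ℝ f, h1.continuous⟩ h1)

/-- The composition operator `u ↦ f ∘ u` on the space of continuous functions on a compact space is
smooth when `f` is smooth. -/
theorem ContinuousMap.contDiff_postcomp {E : Type u} {F : Type v}
    [NormedAddCommGroup E] [NormedSpace ℝ E] [NormedAddCommGroup F] [NormedSpace ℝ F]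
    (f : C(E, F)) (hf : ContDiff ℝ ∞ f) :
    ContDiff ℝ ∞ (fun v : C(K, E) => f.comp v) := by
  let e : ULift.{u} F ≃L[ℝ] F := ContinuousLinearEquiv.ulift
  let g : C(E, ULift.{u} F) := ⟨fun x => e.symm (f x), e.symm.continuous.comp f.continuous⟩
  have hg : ContDiff ℝ ∞ g := e.symm.contDiff.comp hf
  have h : ContDiff ℝ ∞ (fun v : C(K, E) => g.comp v) :=
    contDiff_infty.2 fun n => ContinuousMap.contDiff_postcomp_nat.{u, max u v} n g hg
  exact (e.toContinuousLinearMap.compLeftContinuous ℝ K).contDiff.comp h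

end Nemytskii

/-! ### The implicit function near the base point -/

/-- Smoothness of the implicit function holds on a whole neighbourhood: near the base point it
coincides with the implicit functions based at nearby solutions. -/
theorem ContDiffAt.eventually_contDiffAt_implicitFunction {E₁ E₂ F : Type*}
    [NormedAddCommGroup E₁] [NormedSpace ℝ E₁] [CompleteSpace E₁]
    [NormedAddCommGroup E₂] [NormedSpace ℝ E₂] [CompleteSpace E₂]
    [NormedAddCommGroup F] [NormedSpace ℝ F] [CompleteSpace F] {f : E₁ × E₂ → F} {u : E₁ × E₂}
    (hf : ∀ᶠ v in 𝓝 u, ContDiffAt ℝ ∞ f v)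
    (hinv : (fderiv ℝ f u ∘L .inr ℝ E₁ E₂).IsInvertible) :
    ∀ᶠ x in 𝓝 u.1, ContDiffAt ℝ ∞ (hf.self_of_nhds.implicitFunction (by simp) hinv) x := by
  have cdf := hf.self_of_nhds
  set ψ := hf.self_of_nhds.implicitFunction (by simp) hinv with hψ
  have hψd : ContDiffAt ℝ ∞ ψ u.1 := cdf.contDiffAt_implicitFunction (by simp) hinv
  have hψ0 : ψ u.1 = u.2 := cdf.implicitFunction_apply_self (by simp) hinv
  have ht : Tendsto (fun x => (x, ψ x)) (𝓝 u.1) (𝓝 u) := by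
    have h := continuousAt_id.tendsto.prodMk_nhds hψd.continuousAt.tendsto
    rw [hψ0] at h
    exact h
  have hcont : ∀ᶠ x in 𝓝 u.1, ContinuousAt ψ x :=
    ((hψd.of_le (m := 1) (by simp)).eventually (by simp)).mono fun x hx => hx.continuousAt
  have hinv' : ∀ᶠ v in 𝓝 u, (fderiv ℝ f v ∘L .inr ℝ E₁ E₂).IsInvertible := by
    have h1 : ContinuousAt (fun v => fderiv ℝ f v ∘L .inr ℝ E₁ E₂) u :=
      (cdf.fderiv_right (m := ∞) (by simp)).continuousAt.clm_comp continuousAt_const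
    obtain ⟨e, he⟩ := hinv
    have := h1.eventually (he ▸ ContinuousLinearEquiv.nhds e)
    filter_upwards [this] with v hv
    obtain ⟨e', he'⟩ := hv
    exact ⟨e', he'⟩
  filter_upwards [ht.eventually hf, ht.eventually hinv', hcont,
    (cdf.eventually_apply_implicitFunction (by simp) hinv).eventually_nhds] with x h1 h2 h3 h4
  refine (h1.contDiffAt_implicitFunction (by simp) h2).congr_of_eventuallyEq ?_
  have ht' : Tendsto (fun y => (y, ψ y)) (𝓝 x) (𝓝 (x, ψ x)) :=
    continuousAt_id.tendsto.prodMk_nhds h3.tendsto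
  filter_upwards [ht'.eventually (h1.eventually_apply_eq_iff_implicitFunction (by simp) h2), h4]
    with y h5 h6
  exact (h5.1 (h6.trans h4.self_of_nhds.symm)).symm

/-! ### Local flows of commuting families of vector fields -/

section Flow

variable {E : Type*} [NormedAddCommGroup E]

/-- The constant extension to `ℝ` of a path parametrised by the unit interval. -/
noncomputable def pathExt (w : C(unitInterval, E)) : ℝ → E :=
  Set.IccExtend (zero_le_one' ℝ) w

theorem continuous_pathExt (w : C(unitInterval, E)) : Continuous (pathExt w) :=
  w.continuous.Icc_extend'

theorem pathExt_coe (w : C(unitInterval, E)) (s : unitInterval) : pathExt w s = w s := by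
  simp [pathExt, Set.IccExtend_val]

theorem pathExt_of_mem (w : C(unitInterval, E)) {s : ℝ} (hs : s ∈ Set.Icc (0 : ℝ) 1) :
    pathExt w s = w ⟨s, hs⟩ := pathExt_coe w ⟨s, hs⟩

theorem norm_pathExt_le (w : C(unitInterval, E)) (s : ℝ) : ‖pathExt w s‖ ≤ ‖w‖ :=
  w.norm_coe_le_norm _

variable [NormedSpace ℝ E]

/-- The primitive of a path that vanishes at `0`, as a bounded operator on paths. -/
noncomputable def primitiveCLM (E : Type*) [NormedAddCommGroup E] [NormedSpace ℝ E] :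
    C(unitInterval, E) →L[ℝ] C(unitInterval, E) :=
  LinearMap.mkContinuous
    { toFun := fun w => ⟨fun s => ∫ t in (0 : ℝ)..s, pathExt w t,
        (intervalIntegral.continuous_primitive
          (fun _ _ => (continuous_pathExt w).intervalIntegrable _ _) 0).comp continuous_subtype_val⟩
      map_add' := fun v w => by
        ext s
        simp only [ContinuousMap.coe_mk, ContinuousMap.add_apply]
        rw [← intervalIntegral.integral_add ((continuous_pathExt v).intervalIntegrable _ _)
          ((continuous_pathExt w).intervalIntegrable _ _)]
        rfl
      map_smul' := fun r w => by
        ext s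
        simp only [ContinuousMap.coe_mk, ContinuousMap.smul_apply, RingHom.id_apply]
        rw [← intervalIntegral.integral_smul]
        rfl } 1 fun w => by
    rw [one_mul, ContinuousMap.norm_le _ (norm_nonneg _)]
    intro s
    refine (intervalIntegral.norm_integral_le_of_norm_le_const
      (fun t _ => norm_pathExt_le w t)).trans ?_
    refine mul_le_of_le_one_right (norm_nonneg _) ?_
    rw [sub_zero, abs_of_nonneg s.2.1]
    exact s.2.2

theorem primitiveCLM_apply (w : C(unitInterval, E)) (s : unitInterval) :
    primitiveCLM E w s = ∫ t in (0 : ℝ)..s, pathExt w t := rfl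

theorem hasDerivWithinAt_pathExt_of_eq_primitive [CompleteSpace E] {w g : C(unitInterval, E)}
    {c : E} (h : w = ContinuousMap.const _ c + primitiveCLM E g) {s : ℝ}
    (hs : s ∈ Set.Icc (0 : ℝ) 1) :
    HasDerivWithinAt (pathExt w) (pathExt g s) (Set.Icc 0 1) s := by
  have h1 : HasDerivAt (fun s => c + ∫ t in (0 : ℝ)..s, pathExt g t) (pathExt g s) s :=
    ((continuous_pathExt g).integral_hasStrictDerivAt 0 s).hasDerivAt.const_add c
  refine h1.hasDerivWithinAt.congr_of_mem (fun t ht => ?_) hs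
  rw [pathExt_of_mem w ht, h]
  rfl

theorem pathExt_zero_of_eq_primitive {w g : C(unitInterval, E)} {c : E}
    (h : w = ContinuousMap.const _ c + primitiveCLM E g) : pathExt w 0 = c := by
  rw [pathExt_of_mem w ⟨le_rfl, zero_le_one⟩, h]
  simp [primitiveCLM_apply]

/-- Uniqueness for linear ordinary differential equations on the unit interval. -/
theorem eqOn_of_linear_ode {A : C(unitInterval, E →L[ℝ] E)} {b p q : ℝ → E}
    (hp : ∀ s ∈ Set.Icc (0 : ℝ) 1,
      HasDerivWithinAt p (b s + pathExt A s (p s)) (Set.Icc 0 1) s)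
    (hq : ∀ s ∈ Set.Icc (0 : ℝ) 1,
      HasDerivWithinAt q (b s + pathExt A s (q s)) (Set.Icc 0 1) s)
    (h0 : p 0 = q 0) : Set.EqOn p q (Set.Icc 0 1) := by
  have hd : ∀ s ∈ Set.Icc (0 : ℝ) 1,
      HasDerivWithinAt (fun s => p s - q s) (pathExt A s (p s - q s)) (Set.Icc 0 1) s := by
    intro s hs
    have := (hp s hs).sub (hq s hs)
    rwa [add_sub_add_left_eq_sub, ← map_sub] at this
  intro s hs
  refine sub_eq_zero.1 (eq_zero_of_abs_deriv_le_mul_abs_self_of_eq_zero_right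
    (f := fun s => p s - q s) (f' := fun t => pathExt A t (p t - q t)) (K := ‖A‖)
    (fun t ht => (hd t ht).continuousWithinAt) (fun t ht => ?_) (by simp [h0])
    (fun t ht => ?_) s hs)
  · exact ((hd t (Set.Ico_subset_Icc_self ht)).mono_of_mem_nhdsWithin
      (Icc_mem_nhdsGE_of_mem ht))
  · exact ((pathExt A t).le_opNorm _).trans
      (mul_le_mul_of_nonneg_right (norm_pathExt_le A t) (norm_nonneg _))

variable {κ : Type*} [Fintype κ]

/-- The right-hand side `X_t ∘ w = ∑ a, t_a X_a ∘ w` of the flow equation along a path `w`. -/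
noncomputable def flowField (X : κ → C(E, E)) (t : κ → ℝ) (w : C(unitInterval, E)) :
    C(unitInterval, E) :=
  ∑ a, t a • (X a).comp w

theorem pathExt_flowField (X : κ → C(E, E)) (t : κ → ℝ) (w : C(unitInterval, E)) (s : ℝ) :
    pathExt (flowField X t w) s = ∑ a, t a • X a (pathExt w s) := by
  simp [pathExt, flowField, Set.IccExtend]

/-- The flow equation in integral form, for the path `u.2` with data `u.1 = (t, x)`. -/
noncomputable def flowEq (X : κ → C(E, E)) (u : ((κ → ℝ) × E) × C(unitInterval, E)) :
    C(unitInterval, E) :=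
  u.2 - ContinuousMap.const _ u.1.2 - primitiveCLM E (flowField X u.1.1 u.2)

/-- The embedding of vectors as constant paths. -/
noncomputable def constCLM (E : Type*) [NormedAddCommGroup E] [NormedSpace ℝ E] :
    E →L[ℝ] C(unitInterval, E) :=
  ContinuousLinearMap.const ℝ unitInterval

@[simp]
theorem constCLM_apply (x : E) : constCLM E x = ContinuousMap.const _ x := rfl

theorem contDiff_flowField (X : κ → C(E, E)) (hX : ∀ a, ContDiff ℝ ∞ (X a)) :
    ContDiff ℝ ∞ fun u : (κ → ℝ) × C(unitInterval, E) => flowField X u.1 u.2 := by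
  unfold flowField
  refine ContDiff.sum fun a _ => ContDiff.fun_smul ?_ ?_
  · exact (contDiff_apply ℝ ℝ a).comp contDiff_fst
  · exact (ContinuousMap.contDiff_postcomp (X a) (hX a)).comp contDiff_snd

theorem contDiff_flowEq (X : κ → C(E, E)) (hX : ∀ a, ContDiff ℝ ∞ (X a)) :
    ContDiff ℝ ∞ (flowEq X) := by
  unfold flowEq
  refine (contDiff_snd.sub ((constCLM E).contDiff.comp (contDiff_snd.comp contDiff_fst))).sub
    ((primitiveCLM E).contDiff.comp ?_)
  exact (contDiff_flowField X hX).comp ((contDiff_fst.comp contDiff_fst).prodMk contDiff_snd)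

/-- The time-one paths of the fields `∑ a, t_a X_a` exist for small `t` and depend smoothly on `t`
and on the initial point: at `t = 0` the flow equation is `u = x`, so the implicit function theorem
applies in the space of paths. -/
theorem exists_smooth_local_flow [CompleteSpace E] (X : κ → C(E, E))
    (hX : ∀ a, ContDiff ℝ ∞ (X a)) (x₀ : E) :
    ∃ u : (κ → ℝ) × E → C(unitInterval, E), (∀ᶠ z in 𝓝 (0, x₀), ContDiffAt ℝ ∞ u z) ∧
      u (0, x₀) = ContinuousMap.const _ x₀ ∧
      ∀ᶠ z in 𝓝 ((0 : κ → ℝ), x₀),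
        u z = ContinuousMap.const _ z.2 + primitiveCLM E (flowField X z.1 (u z)) := by
  let u₀ : ((κ → ℝ) × E) × C(unitInterval, E) := ((0, x₀), ContinuousMap.const _ x₀)
  have cdf : ContDiffAt ℝ ∞ (flowEq X) u₀ := (contDiff_flowEq X hX).contDiffAt
  have h0 : flowEq X u₀ = 0 := by simp [flowEq, flowField, u₀]
  have hpart : (fderiv ℝ (flowEq X) u₀ ∘L .inr ℝ ((κ → ℝ) × E) C(unitInterval, E))
      = ContinuousLinearMap.id ℝ _ := by
    have h1 : HasFDerivAt (fun w : C(unitInterval, E) => flowEq X ((0, x₀), w))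
        (fderiv ℝ (flowEq X) u₀ ∘L .inr ℝ ((κ → ℝ) × E) C(unitInterval, E)) u₀.2 :=
      (cdf.differentiableAt (by simp)).hasFDerivAt.comp u₀.2
        (hasFDerivAt_prodMk_right (0, x₀) u₀.2)
    have h2 : (fun w : C(unitInterval, E) => flowEq X ((0, x₀), w))
        = fun w => w - ContinuousMap.const _ x₀ := by
      ext w s; simp [flowEq, flowField]
    rw [h2] at h1
    exact h1.unique ((hasFDerivAt_id _).sub_const _)
  have hinv : (fderiv ℝ (flowEq X) u₀ ∘L .inr ℝ ((κ → ℝ) × E) C(unitInterval, E)).IsInvertible := by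
    rw [hpart]; exact ContinuousLinearMap.isInvertible_equiv (f := .refl ℝ _)
  refine ⟨cdf.implicitFunction (by simp) hinv,
    ContDiffAt.eventually_contDiffAt_implicitFunction
      (Eventually.of_forall fun _ => (contDiff_flowEq X hX).contDiffAt) hinv,
    cdf.implicitFunction_apply_self _ _, ?_⟩
  filter_upwards [cdf.eventually_apply_implicitFunction (by simp) hinv] with z hz
  rw [h0, flowEq, sub_sub, sub_eq_zero] at hz
  exact hz

theorem hasFDerivAt_flowField_apply (X : κ → C(E, E)) (hX : ∀ a, ContDiff ℝ ∞ (X a))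
    (z : (κ → ℝ) × C(unitInterval, E)) (δ : (κ → ℝ) × C(unitInterval, E)) (s : unitInterval) :
    fderiv ℝ (fun u : (κ → ℝ) × C(unitInterval, E) => flowField X u.1 u.2) z δ s
      = ∑ a, δ.1 a • X a (z.2 s) + ∑ a, z.1 a • fderiv ℝ (X a) (z.2 s) (δ.2 s) := by
  have h1 := ((contDiff_flowField X hX).differentiable (by simp) z).hasFDerivAt
  have h2 := (ContinuousMap.evalCLM ℝ s : C(unitInterval, E) →L[ℝ] E).hasFDerivAt.comp z h1
  have hX' : ∀ a, HasFDerivAt (X a) (fderiv ℝ (X a) (z.2 s)) (z.2 s) := fun a =>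
    ((hX a).differentiable (by simp) _).hasFDerivAt
  have h3 : HasFDerivAt (fun u : (κ → ℝ) × C(unitInterval, E) => ∑ a, u.1 a • X a (u.2 s)) _ z :=
    HasFDerivAt.fun_sum fun a _ =>
      (((ContinuousLinearMap.proj (R := ℝ) (φ := fun _ : κ => ℝ) a).comp
        (ContinuousLinearMap.fst ℝ _ _)).hasFDerivAt (x := z)).fun_smul
      ((hX' a).comp z (((ContinuousMap.evalCLM ℝ s).comp
        (ContinuousLinearMap.snd ℝ _ _)).hasFDerivAt (x := z)))
  have h4 : ((ContinuousMap.evalCLM ℝ s : C(unitInterval, E) →L[ℝ] E) ∘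
      fun u : (κ → ℝ) × C(unitInterval, E) => flowField X u.1 u.2)
      = fun u => ∑ a, u.1 a • X a (u.2 s) := by
    ext u; simp [flowField]
  rw [h4] at h2
  have h5 := congrArg (fun L => L δ) (h2.unique h3)
  simp only [ContinuousLinearMap.comp_apply] at h5
  refine h5.trans ?_
  simp [Finset.sum_add_distrib, add_comm]

/-- Variational equations: for commuting fields, differentiating the time-one map in the parameter
`t_b`, or in the initial point along `X_b`, yields `X_b` at the end point. Both sides solve the same
linear differential equation along the path. -/
theorem eventually_fderiv_flow [CompleteSpace E] [DecidableEq κ] (X : κ → C(E, E))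
    (hX : ∀ a, ContDiff ℝ ∞ (X a)) (x₀ : E)
    (hcomm : ∀ᶠ x in 𝓝 x₀, ∀ a b, fderiv ℝ (X a) x (X b x) = fderiv ℝ (X b) x (X a x))
    {u : (κ → ℝ) × E → C(unitInterval, E)} (hu : ContDiffAt ℝ ∞ u (0, x₀))
    (hu₀ : u (0, x₀) = ContinuousMap.const _ x₀)
    (heq : ∀ᶠ z in 𝓝 ((0 : κ → ℝ), x₀),
        u z = ContinuousMap.const _ z.2 + primitiveCLM E (flowField X z.1 (u z))) :
    ∀ᶠ z in 𝓝 ((0 : κ → ℝ), x₀), DifferentiableAt ℝ u z ∧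
      ∀ b, fderiv ℝ u z (Pi.single b 1, 0) 1 = X b (u z 1) ∧
        fderiv ℝ u z (0, X b z.2) 1 = X b (u z 1) := by
  obtain ⟨ε, hε, hball⟩ := Metric.eventually_nhds_iff.1 hcomm
  have hnear : ∀ᶠ z in 𝓝 ((0 : κ → ℝ), x₀), dist (u z) (ContinuousMap.const _ x₀) < ε := by
    have := hu.continuousAt.tendsto
    rw [hu₀] at this
    exact this.eventually (Metric.ball_mem_nhds _ hε)
  have hdiff : ∀ᶠ z in 𝓝 ((0 : κ → ℝ), x₀), DifferentiableAt ℝ u z := by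
    have := (hu.of_le (m := 1) (by simp)).eventually (by simp)
    exact this.mono fun z hz => hz.differentiableAt (by simp)
  filter_upwards [hnear, hdiff, heq.eventually_nhds] with z hz hzd hze
  refine ⟨hzd, fun b => ?_⟩
  have hzz := hze.self_of_nhds
  set w := u z with hw
  have hws : ∀ s : unitInterval, ∀ a b,
      fderiv ℝ (X a) (w s) (X b (w s)) = fderiv ℝ (X b) (w s) (X a (w s)) := fun s =>
    hball (lt_of_le_of_lt
      (ContinuousMap.dist_apply_le_dist (f := w) (g := ContinuousMap.const _ x₀) s) hz)
  -- the linearised flow equation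
  have hlin : ∀ δ : (κ → ℝ) × E, fderiv ℝ u z δ = ContinuousMap.const _ δ.2 + primitiveCLM E
      (fderiv ℝ (fun v : (κ → ℝ) × C(unitInterval, E) => flowField X v.1 v.2) (z.1, w)
        (δ.1, fderiv ℝ u z δ)) := by
    intro δ
    have h1 : HasFDerivAt (fun y : (κ → ℝ) × E => ContinuousMap.const unitInterval y.2
        + primitiveCLM E (flowField X y.1 (u y))) _ z :=
      (((constCLM E).comp (ContinuousLinearMap.snd ℝ (κ → ℝ) E)).hasFDerivAt (x := z)).fun_add
        ((primitiveCLM E).hasFDerivAt.comp z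
          (HasFDerivAt.comp (g := fun v : (κ → ℝ) × C(unitInterval, E) => flowField X v.1 v.2)
            (f := fun y : (κ → ℝ) × E => (y.1, u y)) z
            ((contDiff_flowField X hX).differentiable (by simp) (z.1, u z)).hasFDerivAt
            (hasFDerivAt_fst.prodMk hzd.hasFDerivAt)))
    have h2 := hzd.hasFDerivAt.unique (h1.congr_of_eventuallyEq hze)
    conv_lhs => rw [h2]
    simp [hw]
  have hX0 : ∀ a, Continuous (fderiv ℝ (X a)) := fun a => (hX a).continuous_fderiv (by simp)
  let A : C(unitInterval, E →L[ℝ] E) :=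
    ⟨fun s => ∑ a, z.1 a • fderiv ℝ (X a) (w s), by fun_prop⟩
  have hA : ∀ s ∈ Set.Icc (0 : ℝ) 1, ∀ v,
      pathExt A s v = ∑ a, z.1 a • fderiv ℝ (X a) (pathExt w s) v := by
    intro s hs v
    rw [pathExt_of_mem A hs, pathExt_of_mem w hs]
    simp [A]
  have hp : ∀ δ : (κ → ℝ) × E, ∀ s ∈ Set.Icc (0 : ℝ) 1, HasDerivWithinAt
      (pathExt (fderiv ℝ u z δ)) (∑ a, δ.1 a • X a (pathExt w s)
        + pathExt A s (pathExt (fderiv ℝ u z δ) s)) (Set.Icc 0 1) s := by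
    intro δ s hs
    have := hasDerivWithinAt_pathExt_of_eq_primitive (hlin δ) hs
    rw [pathExt_of_mem (fderiv ℝ (fun v : (κ → ℝ) × C(unitInterval, E) => flowField X v.1 v.2)
      (z.1, w) (δ.1, fderiv ℝ u z δ)) hs, hasFDerivAt_flowField_apply X hX] at this
    rw [hA s hs]
    simpa only [pathExt_of_mem _ hs] using this
  have hq : ∀ s ∈ Set.Icc (0 : ℝ) 1, HasDerivWithinAt
      (fun s => X b (pathExt w s)) (pathExt A s (X b (pathExt w s))) (Set.Icc 0 1) s := by
    intro s hs
    have h1 := hasDerivWithinAt_pathExt_of_eq_primitive hzz hs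
    rw [pathExt_flowField] at h1
    have h2 := ((hX b).differentiable (by simp) (pathExt w s)).hasFDerivAt.comp_hasDerivWithinAt
      s h1
    rw [hA s hs]
    have h3 : ∑ a, z.1 a • fderiv ℝ (X a) (pathExt w s) (X b (pathExt w s))
        = fderiv ℝ (X b) (pathExt w s) (∑ a, z.1 a • X a (pathExt w s)) := by
      simp only [map_sum, map_smul]
      rw [pathExt_of_mem w hs]
      exact Finset.sum_congr rfl fun a _ => by rw [hws ⟨s, hs⟩ a b]
    rw [h3]
    exact h2
  have hend : ∀ v : C(unitInterval, E), pathExt v 1 = v 1 := fun v => pathExt_coe v 1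
  have h1mem : (1 : ℝ) ∈ Set.Icc (0 : ℝ) 1 := ⟨zero_le_one, le_rfl⟩
  constructor
  · have hq' : ∀ s ∈ Set.Icc (0 : ℝ) 1, HasDerivWithinAt
        (fun s => s • X b (pathExt w s)) (X b (pathExt w s)
          + pathExt A s (s • X b (pathExt w s))) (Set.Icc 0 1) s := by
      intro s hs
      have := (hasDerivWithinAt_id s (Set.Icc 0 1)).fun_smul (hq s hs)
      simpa [add_comm] using this
    have hp' := hp (Pi.single b 1, 0)
    simp only [Pi.single_apply, ite_smul, one_smul, zero_smul, Finset.sum_ite_eq',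
      Finset.mem_univ, if_true] at hp'
    have := eqOn_of_linear_ode hp' hq' (by
      rw [pathExt_zero_of_eq_primitive (hlin _)]; simp) h1mem
    simpa [hend] using this
  · have hp' := hp (0, X b z.2)
    simp only [Pi.zero_apply, zero_smul, Finset.sum_const_zero] at hp'
    have := eqOn_of_linear_ode (b := fun _ => 0) hp' (by simpa using hq) (by
      rw [pathExt_zero_of_eq_primitive (hlin _), pathExt_zero_of_eq_primitive hzz]) h1mem
    simpa [hend] using this

end Flow

section Straightening

variable {E : Type*} [NormedAddCommGroup E] [NormedSpace ℝ E]
variable {κ : Type*} [Fintype κ]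

theorem ContinuousLinearMap.isInvertible_of_injective_pi
    (L : (κ → ℝ) →L[ℝ] (κ → ℝ)) (hL : Function.Injective L) : L.IsInvertible := by
  let e : (κ → ℝ) ≃L[ℝ] (κ → ℝ) :=
    (LinearEquiv.ofInjectiveEndo (L : (κ → ℝ) →ₗ[ℝ] (κ → ℝ)) hL).toContinuousLinearEquiv
  have : L = (e : (κ → ℝ) →L[ℝ] (κ → ℝ)) := by ext v; rfl
  rw [this]; exact ContinuousLinearMap.isInvertible_equiv

theorem ContinuousLinearMap.apply_eq_sum_single [DecidableEq κ] {F : Type*}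
    [AddCommGroup F] [Module ℝ F] [TopologicalSpace F] (L : (κ → ℝ) →L[ℝ] F) (v : κ → ℝ) :
    L v = ∑ a, v a • L (Pi.single a 1) := by
  conv_lhs => rw [pi_eq_sum_univ' v]
  simp only [map_sum, map_smul]

/-- The matrix of derivatives `X_a f_b`. -/
noncomputable def derivMatrix (X : κ → E → E) (f : E → κ → ℝ) (x : E) : Matrix κ κ ℝ :=
  Matrix.of fun a b => fderiv ℝ f x (X a x) b

theorem vecMul_derivMatrix (X : κ → E → E) (f : E → κ → ℝ) (x : E) (v : κ → ℝ) :
    Matrix.vecMul v (derivMatrix X f x) = fderiv ℝ f x (∑ a, v a • X a x) := by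
  ext b
  simp [Matrix.vecMul, dotProduct, derivMatrix, map_sum, Finset.sum_apply]

/-- Given a commuting family of vector fields that is transversal to the surface `f = 0` at `x₀`,
the leaves through nearby points meet the surface exactly once: `τ x` is the time at which the flow
from `x` reaches the surface, and `r x` the point where it does. -/
theorem exists_straightening [DecidableEq κ] [CompleteSpace E] (X : κ → C(E, E))
    (hX : ∀ a, ContDiff ℝ ∞ (X a)) (x₀ : E)
    (hcomm : ∀ᶠ x in 𝓝 x₀, ∀ a b, fderiv ℝ (X a) x (X b x) = fderiv ℝ (X b) x (X a x))
    {f : E → κ → ℝ} (hfs : ∀ᶠ x in 𝓝 x₀, ContDiffAt ℝ ∞ f x) (hf₀ : f x₀ = 0)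
    (hinv : IsUnit (derivMatrix (fun a => X a) f x₀).det) :
    ∃ (τ : E → κ → ℝ) (r : E → E), (∀ᶠ x in 𝓝 x₀, ContDiffAt ℝ ∞ τ x ∧ ContDiffAt ℝ ∞ r x) ∧
      r x₀ = x₀ ∧
      (∀ᶠ x in 𝓝 x₀, f (r x) = 0 ∧ (f x = 0 → τ x = 0 ∧ r x = x) ∧
        (∀ a, fderiv ℝ τ x (X a x) = -Pi.single a 1) ∧ (∀ a, fderiv ℝ r x (X a x) = 0) ∧
        (f x = 0 → ∀ v, fderiv ℝ r x v = v + ∑ a, fderiv ℝ τ x v a • X a x)) ∧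
      ∀ W ∈ 𝓝 x₀, ∀ᶠ x in 𝓝 x₀, ∃ γ : ℝ → E, γ 0 = x ∧ γ 1 = r x ∧
        ∀ s ∈ Set.Icc (0 : ℝ) 1, γ s ∈ W ∧
          HasDerivWithinAt γ (∑ a, τ x a • X a (γ s)) (Set.Icc 0 1) s := by
  obtain ⟨u, hus, hu₀, heq⟩ := exists_smooth_local_flow X hX x₀
  have hu := hus.self_of_nhds
  have hf := hfs.self_of_nhds
  have hvar := eventually_fderiv_flow X hX x₀ hcomm hu hu₀ heq
  let ev : C(unitInterval, E) →L[ℝ] E := ContinuousMap.evalCLM ℝ 1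
  have hev : ∀ w, ev w = w 1 := fun _ => rfl
  -- at parameter zero the flow is constant
  have hu0 : ∀ᶠ x in 𝓝 x₀, u (0, x) = ContinuousMap.const _ x := by
    have ht : Tendsto (fun x : E => ((0 : κ → ℝ), x)) (𝓝 x₀) (𝓝 (0, x₀)) :=
      (Continuous.prodMk_right _).tendsto x₀
    filter_upwards [ht.eventually heq] with x hx
    rw [hx]; ext s; simp [flowField]
  let H : E × (κ → ℝ) → κ → ℝ := fun y => f (ev (u (y.2, y.1)))
  have hHs : ∀ᶠ y in 𝓝 (x₀, (0 : κ → ℝ)), ContDiffAt ℝ ∞ H y := by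
    have ht : Tendsto (fun y : E × (κ → ℝ) => (y.2, y.1)) (𝓝 (x₀, 0)) (𝓝 (0, x₀)) :=
      continuous_swap.tendsto _
    have ht' : Tendsto (fun y : E × (κ → ℝ) => ev (u (y.2, y.1))) (𝓝 (x₀, 0)) (𝓝 x₀) := by
      have := (ev.continuous.tendsto _).comp (hu.continuousAt.tendsto.comp ht)
      rwa [hu₀] at this
    filter_upwards [ht.eventually hus, ht'.eventually hfs] with y h1 h2
    exact h2.comp y (ev.contDiff.contDiffAt.comp y
      (ContDiffAt.comp y h1 (contDiff_snd.prodMk contDiff_fst).contDiffAt))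
  have hH := hHs.self_of_nhds
  have hfd : DifferentiableAt ℝ f x₀ := hf.differentiableAt (by simp)
  have hud : HasFDerivAt u (fderiv ℝ u (0, x₀)) (0, x₀) :=
    (hu.differentiableAt (by simp)).hasFDerivAt
  have hpart : ∀ v, (fderiv ℝ H (x₀, 0) ∘L .inr ℝ E (κ → ℝ)) v
      = Matrix.vecMul v (derivMatrix (fun a => X a) f x₀) := by
    intro v
    have h1 : HasFDerivAt (fun t => H (x₀, t))
        (fderiv ℝ H (x₀, 0) ∘L .inr ℝ E (κ → ℝ)) 0 :=
      (hH.differentiableAt (by simp)).hasFDerivAt.comp (0 : κ → ℝ)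
        (hasFDerivAt_prodMk_right x₀ (0 : κ → ℝ))
    have h2 : HasFDerivAt (fun t => H (x₀, t)) (fderiv ℝ f x₀ ∘L (ev ∘L (fderiv ℝ u (0, x₀) ∘L
        .inl ℝ (κ → ℝ) E))) (0 : κ → ℝ) := by
      refine HasFDerivAt.comp (g := f) (f := fun t => ev (u (t, x₀))) (0 : κ → ℝ) ?_
        (ev.hasFDerivAt.comp (0 : κ → ℝ) (HasFDerivAt.comp (0 : κ → ℝ) hud
          (hasFDerivAt_prodMk_left (0 : κ → ℝ) x₀)))
      simpa [hev, hu₀] using hfd.hasFDerivAt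
    rw [h1.unique h2, ContinuousLinearMap.apply_eq_sum_single, vecMul_derivMatrix, map_sum]
    refine Finset.sum_congr rfl fun a _ => ?_
    have h3 := (hvar.self_of_nhds.2 a).1
    simp only [ContinuousLinearMap.comp_apply, ContinuousLinearMap.inl_apply, hev, h3, hu₀,
      ContinuousMap.const_apply, map_smul]
  have hHinv : (fderiv ℝ H (x₀, 0) ∘L .inr ℝ E (κ → ℝ)).IsInvertible := by
    refine ContinuousLinearMap.isInvertible_of_injective_pi _ fun v w hvw => ?_
    rw [hpart, hpart] at hvw
    exact Matrix.vecMul_injective_of_isUnit ((Matrix.isUnit_iff_isUnit_det _).2 hinv) hvw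
  have hH0 : H (x₀, 0) = 0 := by simp [H, hev, hu₀, hf₀]
  let τ := hH.implicitFunction (by simp) hHinv
  have hτs : ∀ᶠ x in 𝓝 x₀, ContDiffAt ℝ ∞ τ x :=
    ContDiffAt.eventually_contDiffAt_implicitFunction hHs hHinv
  have hτ := hτs.self_of_nhds
  have hτ0 : τ x₀ = 0 := hH.implicitFunction_apply_self (by simp) hHinv
  let r : E → E := fun x => ev (u (τ x, x))
  have hT : ContDiffAt ℝ ∞ (fun x => (τ x, x)) x₀ := hτ.prodMk contDiffAt_id
  have huT : ContDiffAt ℝ ∞ (fun x => u (τ x, x)) x₀ := by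
    refine ContDiffAt.comp x₀ ?_ hT
    rw [hτ0]; exact hu
  have hr : ContDiffAt ℝ ∞ r x₀ := ev.contDiff.contDiffAt.comp x₀ huT
  have hr0 : r x₀ = x₀ := by simp [r, hτ0, hu₀, hev]
  have hTt : Tendsto (fun x => (τ x, x)) (𝓝 x₀) (𝓝 (0, x₀)) := by
    have := hT.continuousAt.tendsto
    rwa [hτ0] at this
  have hrt : Tendsto r (𝓝 x₀) (𝓝 x₀) := by
    have := hr.continuousAt.tendsto
    rwa [hr0] at this
  have hfr : ∀ᶠ x in 𝓝 x₀, f (r x) = 0 := by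
    have := hH.eventually_apply_implicitFunction (by simp) hHinv
    filter_upwards [this] with x hx
    rw [hH0] at hx
    exact hx
  have hfτ : ∀ᶠ x in 𝓝 x₀, f x = 0 → τ x = 0 ∧ r x = x := by
    have ht : Tendsto (fun x : E => (x, (0 : κ → ℝ))) (𝓝 x₀) (𝓝 (x₀, 0)) :=
      (Continuous.prodMk_left _).tendsto x₀
    filter_upwards [ht.eventually (hH.eventually_apply_eq_iff_implicitFunction (by simp) hHinv),
      hu0] with x hx hx0 hfx
    have h1 : H (x, 0) = H (x₀, 0) := by simp [H, hev, hx0, hfx, hf₀, hu₀]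
    have h2 : τ x = 0 := hx.1 h1
    exact ⟨h2, by simp [r, h2, hx0, hev]⟩
  have hdet : ∀ᶠ x in 𝓝 x₀, IsUnit (derivMatrix (fun a => X a) f x).det := by
    have hc : ContinuousAt (fun x => (derivMatrix (fun a => X a) f x).det) x₀ := by
      have h1 : ContinuousAt (fderiv ℝ f) x₀ :=
        (hf.fderiv_right (m := ∞) (by simp)).continuousAt
      refine ContinuousAt.comp (g := Matrix.det)
        (f := fun x => derivMatrix (fun a => X a) f x) (continuous_id.matrix_det).continuousAt ?_
      refine continuousAt_pi.2 fun a => continuousAt_pi.2 fun b => ?_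
      exact (continuous_apply b).continuousAt.comp (h1.clm_apply (X a).continuous.continuousAt)
    exact (hc.eventually_ne hinv.ne_zero).mono fun x hx => hx.isUnit
  refine ⟨τ, r, ?_, hr0, ?_, ?_⟩
  · filter_upwards [hτs, hTt.eventually hus] with x h1 h2
    exact ⟨h1, ev.contDiff.contDiffAt.comp x
      (ContDiffAt.comp (f := fun x => (τ x, x)) x h2 (h1.prodMk contDiffAt_id))⟩
  · have hev1 : ∀ {g : E → κ → ℝ}, ContDiffAt ℝ ∞ g x₀ → ∀ᶠ x in 𝓝 x₀, DifferentiableAt ℝ g x :=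
      fun hg => ((hg.of_le (m := 1) (by simp)).eventually (by simp)).mono
        fun x hx => hx.differentiableAt (by simp)
    filter_upwards [hfr, hfr.eventually_nhds, hfτ, hrt.eventually hdet, hrt.eventually (hev1 hf),
      hev1 hτ, hTt.eventually hvar, hu0.eventually_nhds] with x h1 h1' h2 h3 h4 h5 h6 h7
    have hrd : HasFDerivAt r (ev ∘L (fderiv ℝ u (τ x, x) ∘L
        ((fderiv ℝ τ x).prod (ContinuousLinearMap.id ℝ E)))) x :=
      ev.hasFDerivAt.comp x (HasFDerivAt.comp (f := fun x => (τ x, x)) x h6.1.hasFDerivAt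
        (h5.hasFDerivAt.prodMk (hasFDerivAt_id x)))
    have hrv : ∀ v, fderiv ℝ r x v
        = ∑ a, fderiv ℝ τ x v a • X a (r x) + fderiv ℝ u (τ x, x) (0, v) 1 := by
      intro v
      rw [hrd.fderiv]
      have hsplit : (fderiv ℝ τ x v, v) = ContinuousLinearMap.inl ℝ (κ → ℝ) E (fderiv ℝ τ x v)
          + (0, v) := by simp
      simp only [ContinuousLinearMap.comp_apply, ContinuousLinearMap.prod_apply,
        ContinuousLinearMap.id_apply]
      rw [hsplit, map_add, map_add, ← ContinuousLinearMap.comp_apply (fderiv ℝ u (τ x, x)),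
        ContinuousLinearMap.apply_eq_sum_single, map_sum]
      refine congrArg₂ _ (Finset.sum_congr rfl fun a _ => ?_) rfl
      rw [map_smul, ContinuousLinearMap.comp_apply, ContinuousLinearMap.inl_apply, hev, (h6.2 a).1]
      rfl
    have hrX : ∀ a, fderiv ℝ r x (X a x)
        = ∑ b, (fderiv ℝ τ x (X a x) + Pi.single a 1 : κ → ℝ) b • X b (r x) := by
      intro a
      rw [hrv, (h6.2 a).2]
      simp [add_smul, Finset.sum_add_distrib, Pi.single_apply, ite_smul]
      rfl
    have hτX : ∀ a, fderiv ℝ τ x (X a x) + Pi.single a 1 = 0 := by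
      intro a
      have h8 : HasFDerivAt (fun y => f (r y)) (fderiv ℝ f (r x) ∘L fderiv ℝ r x) x :=
        h4.hasFDerivAt.comp x hrd.differentiableAt.hasFDerivAt
      have h9 : HasFDerivAt (fun y => f (r y)) (0 : E →L[ℝ] κ → ℝ) x :=
        (hasFDerivAt_const (0 : κ → ℝ) x).congr_of_eventuallyEq h1'
      have h10 := congrArg (fun L => L (X a x)) (h8.unique h9)
      simp only [ContinuousLinearMap.comp_apply, _root_.zero_apply, hrX] at h10
      rw [← vecMul_derivMatrix (fun a => X a)] at h10
      exact Matrix.vecMul_injective_of_isUnit ((Matrix.isUnit_iff_isUnit_det _).2 h3)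
        (h10.trans (Matrix.zero_vecMul _).symm)
    refine ⟨h1, h2, fun a => eq_neg_of_add_eq_zero_left (hτX a), fun a => ?_, fun hfx v => ?_⟩
    · rw [hrX, hτX]; simp
    · obtain ⟨h11, h12⟩ := h2 hfx
      rw [hrv, h12, add_comm]
      congr 1
      have h13 : HasFDerivAt (fun y => u (0, y)) (fderiv ℝ u (τ x, x) ∘L .inr ℝ (κ → ℝ) E) x := by
        have := h6.1.hasFDerivAt
        rw [h11] at this ⊢
        exact this.comp x (hasFDerivAt_prodMk_right (0 : κ → ℝ) x)
      have h14 : HasFDerivAt (fun y => u (0, y)) (constCLM E) x :=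
        (constCLM E).hasFDerivAt.congr_of_eventuallyEq h7
      have := congrArg (fun L => L v 1) (h13.unique h14)
      simpa using this
  · intro W hW
    obtain ⟨ε, hε, hball⟩ := Metric.mem_nhds_iff.1 hW
    have hnear : ∀ᶠ x in 𝓝 x₀, dist (u (τ x, x)) (ContinuousMap.const _ x₀) < ε := by
      have := huT.continuousAt.tendsto
      rw [hτ0, hu₀] at this
      exact this.eventually (Metric.ball_mem_nhds _ hε)
    filter_upwards [hnear, hTt.eventually heq] with x hx hxe
    refine ⟨pathExt (u (τ x, x)), pathExt_zero_of_eq_primitive hxe, pathExt_coe _ 1,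
      fun s hs => ⟨hball ?_, ?_⟩⟩
    · rw [pathExt_of_mem _ hs]
      exact lt_of_le_of_lt (ContinuousMap.dist_apply_le_dist (f := u (τ x, x))
        (g := ContinuousMap.const _ x₀) ⟨s, hs⟩) hx
    · have := hasDerivWithinAt_pathExt_of_eq_primitive hxe hs
      rwa [pathExt_flowField] at this

end Straightening

/-! ### Local division by regular functions -/

section Division

variable {E F : Type*} [NormedAddCommGroup E] [NormedSpace ℝ E]
  [NormedAddCommGroup F] [NormedSpace ℝ F]

/-- A locally defined smooth function extends, after shrinking its domain, to the whole space. -/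
theorem exists_contDiff_eventuallyEq [HasContDiffBump E] {g : E → F} {x₀ : E}
    (hg : ∀ᶠ x in 𝓝 x₀, ContDiffAt ℝ ∞ g x) :
    ∃ g' : E → F, ContDiff ℝ ∞ g' ∧ g' =ᶠ[𝓝 x₀] g := by
  obtain ⟨ε, hε, hball⟩ := Metric.eventually_nhds_iff_ball.1 hg
  let b : ContDiffBump x₀ := ⟨ε / 4, ε / 2, by positivity, by linarith⟩
  refine ⟨fun x => b x • g x, ?_, ?_⟩
  · rw [contDiff_iff_contDiffAt]
    intro x
    by_cases hx : x ∈ Metric.ball x₀ ε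
    · exact b.contDiffAt.fun_smul (hball x hx)
    · have h1 : x ∉ tsupport b := by
        rw [b.tsupport_eq]
        intro h
        exact hx (Metric.closedBall_subset_ball (by change ε / 2 < ε; linarith) h)
      refine (contDiffAt_const (c := (0 : F))).congr_of_eventuallyEq ?_
      filter_upwards [notMem_tsupport_iff_eventuallyEq.1 h1] with y hy
      simp [hy]
  · filter_upwards [b.eventuallyEq_one] with x hx
    simp [hx]

universe u v in
/-- Smooth dependence of an integral over `[0, 1]` on parameters. -/
theorem contDiff_integral_unitInterval {E : Type u} {F : Type v} [NormedAddCommGroup E]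
    [NormedSpace ℝ E] [NormedAddCommGroup F] [NormedSpace ℝ F] {G : ℝ × E → F}
    (hG : ContDiff ℝ ∞ G) : ContDiff ℝ ∞ fun y => ∫ t in (0 : ℝ)..1, G (t, y) := by
  let c : C(unitInterval, ℝ × E) := ⟨fun t => ((t : ℝ), 0), by fun_prop⟩
  let P : E → C(unitInterval, ℝ × E) := fun y =>
    c + ((constCLM (ℝ × E)).comp (ContinuousLinearMap.inr ℝ ℝ E)) y
  have hP : ContDiff ℝ ∞ P := contDiff_const.add (ContinuousLinearMap.contDiff _)
  let G' : C(ℝ × E, F) := ⟨G, hG.continuous⟩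
  have h := (ContinuousMap.evalCLM ℝ (1 : unitInterval)).contDiff.comp
    ((primitiveCLM F).contDiff.comp ((ContinuousMap.contDiff_postcomp G' hG).comp hP))
  convert h using 1
  ext y
  change _ = ∫ t in (0 : ℝ)..((1 : unitInterval) : ℝ), pathExt (G'.comp (P y)) t
  refine intervalIntegral.integral_congr fun t ht => ?_
  rw [Set.uIcc_of_le (by simp)] at ht
  rw [pathExt_of_mem _ ht]
  simp [G', P, c]

variable {κ : Type*} [Fintype κ]

/-- Functions with linearly independent differentials are, in a suitable local chart, linear. -/
theorem exists_linearizing_chart [DecidableEq κ] [CompleteSpace E] {c : E → κ → ℝ} {x₀ : E}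
    (hc : ∀ᶠ x in 𝓝 x₀, ContDiffAt ℝ ∞ c x) {e : κ → E}
    (he : ∀ a, fderiv ℝ c x₀ (e a) = Pi.single a 1) :
    ∃ ψ φ : E → E, (∀ᶠ x in 𝓝 x₀, ContDiffAt ℝ ∞ ψ x) ∧
      (∀ᶠ y in 𝓝 (ψ x₀), ContDiffAt ℝ ∞ φ y) ∧ φ (ψ x₀) = x₀ ∧
      (∀ᶠ x in 𝓝 x₀, φ (ψ x) = x) ∧ ∀ᶠ y in 𝓝 (ψ x₀), c (φ y) = fderiv ℝ c x₀ y := by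
  set ℓ := fderiv ℝ c x₀ with hℓ
  let L : (κ → ℝ) →L[ℝ] E :=
    ∑ a, (ContinuousLinearMap.proj (R := ℝ) (φ := fun _ : κ => ℝ) a).smulRight (e a)
  have hL : ∀ v, ℓ (L v) = v := by
    intro v
    ext b
    simp [L, he, Finset.sum_apply, Pi.single_apply]
  let ψ : E → E := fun x => x - L (ℓ x) + L (c x)
  have hψ : ∀ x, ContDiffAt ℝ ∞ c x → ContDiffAt ℝ ∞ ψ x := fun x hx =>
    (contDiffAt_id.sub (L.contDiff.comp ℓ.contDiff).contDiffAt).add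
      (L.contDiff.contDiffAt.comp x hx)
  have hψℓ : ∀ x, ℓ (ψ x) = c x := by
    intro x
    simp [ψ, hL]
  have hψd : HasFDerivAt ψ (ContinuousLinearMap.id ℝ E) x₀ := by
    have h1 : HasFDerivAt ψ (ContinuousLinearMap.id ℝ E - L ∘L ℓ + L ∘L ℓ) x₀ :=
      ((hasFDerivAt_id x₀).sub (L.hasFDerivAt.comp x₀ ℓ.hasFDerivAt)).add
        (L.hasFDerivAt.comp x₀ (hc.self_of_nhds.differentiableAt (by simp)).hasFDerivAt)
    simpa using h1
  let f : E × E → E := fun y => ψ y.2 - y.1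
  have hf : ∀ᶠ v in 𝓝 (ψ x₀, x₀), ContDiffAt ℝ ∞ f v := by
    have : Tendsto Prod.snd (𝓝 (ψ x₀, x₀)) (𝓝 x₀) := continuous_snd.tendsto _
    filter_upwards [this.eventually hc] with v hv
    exact (ContDiffAt.comp v (hψ _ hv) contDiffAt_snd).sub contDiffAt_fst
  have hpart : fderiv ℝ f (ψ x₀, x₀) ∘L .inr ℝ E E = ContinuousLinearMap.id ℝ E := by
    have h1 : HasFDerivAt (fun x => f (ψ x₀, x)) (fderiv ℝ f (ψ x₀, x₀) ∘L .inr ℝ E E) x₀ :=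
      (hf.self_of_nhds.differentiableAt (by simp)).hasFDerivAt.comp x₀
        (hasFDerivAt_prodMk_right (ψ x₀) x₀)
    exact h1.unique (hψd.sub_const _)
  have hinv : (fderiv ℝ f (ψ x₀, x₀) ∘L .inr ℝ E E).IsInvertible := by
    rw [hpart]; exact ContinuousLinearMap.isInvertible_equiv (f := .refl ℝ E)
  have cdf := hf.self_of_nhds
  have hf0 : f (ψ x₀, x₀) = 0 := sub_self _
  refine ⟨ψ, cdf.implicitFunction (by simp) hinv, hc.mono hψ,
    ContDiffAt.eventually_contDiffAt_implicitFunction hf hinv,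
    cdf.implicitFunction_apply_self (by simp) hinv, ?_, ?_⟩
  · have ht : Tendsto (fun x => (ψ x, x)) (𝓝 x₀) (𝓝 (ψ x₀, x₀)) :=
      hψd.continuousAt.tendsto.prodMk_nhds tendsto_id
    filter_upwards [ht.eventually (cdf.eventually_apply_eq_iff_implicitFunction (by simp) hinv)]
      with x hx
    exact hx.1 (by rw [hf0]; exact sub_self _)
  · filter_upwards [cdf.eventually_apply_implicitFunction (by simp) hinv] with y hy
    rw [hf0] at hy
    have h1 : ψ (cdf.implicitFunction (by simp) hinv y) = y := sub_eq_zero.1 hy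
    conv_rhs => rw [← h1]
    rw [hψℓ]

/-- The contraction of the space onto the kernel of `ℓ` along the span of `e`. -/
def contraction (ℓ : E →L[ℝ] κ → ℝ) (e : κ → E) (t : ℝ) (y : E) : E :=
  y - (1 - t) • ∑ a, ℓ y a • e a

theorem contDiff_contraction (ℓ : E →L[ℝ] κ → ℝ) (e : κ → E) :
    ContDiff ℝ ∞ fun p : ℝ × E => contraction ℓ e p.1 p.2 := by
  unfold contraction
  refine contDiff_snd.sub (ContDiff.fun_smul (contDiff_const.sub contDiff_fst)
    (ContDiff.sum fun a _ => ContDiff.fun_smul ?_ contDiff_const))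
  exact (contDiff_apply ℝ ℝ a).comp (ℓ.contDiff.comp contDiff_snd)

theorem apply_contraction [DecidableEq κ] {ℓ : E →L[ℝ] κ → ℝ} {e : κ → E}
    (he : ∀ a, ℓ (e a) = Pi.single a 1) (t : ℝ) (y : E) :
    ℓ (contraction ℓ e t y) = t • ℓ y := by
  ext b
  simp [contraction, he, Finset.sum_apply, Pi.single_apply]
  ring

theorem eventually_contraction_mem {ℓ : E →L[ℝ] κ → ℝ} {e : κ → E} {y₀ : E} (h0 : ℓ y₀ = 0)
    {W : Set E} (hW : W ∈ 𝓝 y₀) :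
    ∀ᶠ y in 𝓝 y₀, ∀ t ∈ Set.Icc (0 : ℝ) 1, contraction ℓ e t y ∈ W := by
  refine isCompact_Icc.eventually_forall_of_forall_eventually fun t _ => ?_
  have h1 : Tendsto (fun p : E × ℝ => contraction ℓ e p.2 p.1) (𝓝 (y₀, t)) (𝓝 y₀) := by
    have h2 := ((contDiff_contraction ℓ e).continuous.comp continuous_swap).tendsto (y₀, t)
    have h3 : contraction ℓ e t y₀ = y₀ := by simp [contraction, h0]
    simp only [Function.comp_apply, Prod.swap_prod_mk, h3] at h2
    exact h2
  exact h1.eventually hW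

theorem hasDerivAt_comp_contraction {ℓ : E →L[ℝ] κ → ℝ} {e : κ → E} {g : E → F}
    (hg : ContDiff ℝ ∞ g) (y : E) (t : ℝ) :
    HasDerivAt (fun t => g (contraction ℓ e t y))
      (∑ a, ℓ y a • fderiv ℝ g (contraction ℓ e t y) (e a)) t := by
  have h1 : HasDerivAt (fun t => contraction ℓ e t y) (∑ a, ℓ y a • e a) t := by
    have := (((hasDerivAt_id t).const_sub 1).smul_const (∑ a, ℓ y a • e a)).const_sub y
    simpa [contraction] using this
  have h2 := ((hg.differentiable (by simp) (contraction ℓ e t y)).hasFDerivAt).comp_hasDerivAt t h1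
  simp only [map_sum, map_smul] at h2
  exact h2

theorem Submodule.mem_of_forall_dual {S : Submodule ℝ F} {v : F}
    (h : ∀ f : F →ₗ[ℝ] ℝ, S ≤ LinearMap.ker f → f v = 0) : v ∈ S := by
  by_contra hv
  obtain ⟨f, hf, hfS⟩ := S.exists_le_ker_of_notMem hv
  exact hf (h f hfS)

theorem fderiv_mem_of_eventually_mem [FiniteDimensional ℝ F] {S : Submodule ℝ F} {g : E → F} {x : E}
    (hg : DifferentiableAt ℝ g x) (h : ∀ᶠ y in 𝓝 x, g y ∈ S) (v : E) : fderiv ℝ g x v ∈ S := by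
  refine Submodule.mem_of_forall_dual fun f hf => ?_
  have h1 := (LinearMap.toContinuousLinearMap f).hasFDerivAt.comp x hg.hasFDerivAt
  have h2 : HasFDerivAt (LinearMap.toContinuousLinearMap f ∘ g) (0 : E →L[ℝ] ℝ) x :=
    (hasFDerivAt_const (0 : ℝ) x).congr_of_eventuallyEq (h.mono fun y hy => hf hy)
  simpa using congrArg (fun L => L v) (h1.unique h2)

theorem intervalIntegral_mem [FiniteDimensional ℝ F] {S : Submodule ℝ F} {g : ℝ → F}
    (hg : Continuous g) (h : ∀ t ∈ Set.Icc (0 : ℝ) 1, g t ∈ S) : ∫ t in (0 : ℝ)..1, g t ∈ S := by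
  refine Submodule.mem_of_forall_dual fun f hf => ?_
  have h1 := (LinearMap.toContinuousLinearMap f).intervalIntegral_comp_comm
    (hg.intervalIntegrable (μ := MeasureTheory.volume) 0 1)
  change LinearMap.toContinuousLinearMap f _ = 0
  rw [← h1]
  refine (intervalIntegral.integral_congr (g := fun _ => (0 : ℝ)) fun t ht => ?_).trans (by simp)
  rw [Set.uIcc_of_le zero_le_one] at ht
  exact hf (h t ht)

/-- Hadamard's lemma near a point of the surface `c = 0`. -/
theorem exists_local_division_of_eq_zero [DecidableEq κ] [CompleteSpace E] [CompleteSpace F]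
    [HasContDiffBump E]
    {c : E → κ → ℝ} {x₀ : E} (hc : ∀ᶠ x in 𝓝 x₀, ContDiffAt ℝ ∞ c x) (hc₀ : c x₀ = 0) {e : κ → E}
    (he : ∀ a, fderiv ℝ c x₀ (e a) = Pi.single a 1) {z : E → F}
    (hz : ∀ᶠ x in 𝓝 x₀, ContDiffAt ℝ ∞ z x) (hzc : ∀ᶠ x in 𝓝 x₀, c x = 0 → z x = 0) :
    ∃ A : κ → E → F, (∀ᶠ x in 𝓝 x₀, ∀ a, ContDiffAt ℝ ∞ (A a) x) ∧
      ∀ᶠ x in 𝓝 x₀, z x = ∑ a, c x a • A a x := by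
  obtain ⟨ψ, φ, hψ, hφ, hφ₀, hφψ, hcφ⟩ := exists_linearizing_chart hc he
  set ℓ := fderiv ℝ c x₀
  have hℓ₀ : ℓ (ψ x₀) = 0 := by rw [← hcφ.self_of_nhds, hφ₀, hc₀]
  have hφt : Tendsto φ (𝓝 (ψ x₀)) (𝓝 x₀) := by
    have := hφ.self_of_nhds.continuousAt.tendsto
    rwa [hφ₀] at this
  have hψt : Tendsto ψ (𝓝 x₀) (𝓝 (ψ x₀)) := hψ.self_of_nhds.continuousAt.tendsto
  obtain ⟨g, hg, hgz⟩ := exists_contDiff_eventuallyEq (g := z ∘ φ) (x₀ := ψ x₀) (by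
    filter_upwards [hφ, hφt.eventually hz] with y h1 h2 using h2.comp y h1)
  have hG : ∀ a, ContDiff ℝ ∞ fun p : ℝ × E =>
      fderiv ℝ g (contraction ℓ e p.1 p.2) (e a) := fun a =>
    (((hg.fderiv_right (m := ∞) (by simp)).comp (contDiff_contraction ℓ e)).clm_apply
      contDiff_const)
  refine ⟨fun a x => ∫ t in (0 : ℝ)..1, fderiv ℝ g (contraction ℓ e t (ψ x)) (e a), ?_, ?_⟩
  · filter_upwards [hψ] with x hx a
    exact (contDiff_integral_unitInterval (hG a)).contDiffAt.comp x hx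
  · have hg0 : ∀ᶠ y in 𝓝 (ψ x₀), ℓ y = 0 → g y = 0 := by
      filter_upwards [hgz, hcφ, hφt.eventually hzc] with y h1 h2 h3 h4
      rw [h1]; exact h3 (h2.trans h4)
    filter_upwards [hψt.eventually (eventually_contraction_mem (e := e) hℓ₀ hg0),
      hψt.eventually hgz, hφψ, hψt.eventually hcφ] with x h1 h2 h3 h4
    have hcont : ∀ a, Continuous fun t => fderiv ℝ g (contraction ℓ e t (ψ x)) (e a) := fun a =>
      (hG a).continuous.comp (Continuous.prodMk_left (ψ x))
    have h5 := intervalIntegral.integral_eq_sub_of_hasDerivAt (a := 0) (b := 1)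
      (fun t _ => hasDerivAt_comp_contraction (ℓ := ℓ) (e := e) hg (ψ x) t)
      (Continuous.intervalIntegrable (by fun_prop) _ _)
    have h6 : g (contraction ℓ e 0 (ψ x)) = 0 :=
      h1 0 ⟨le_rfl, zero_le_one⟩ (by rw [apply_contraction he]; simp)
    have h7 : contraction ℓ e 1 (ψ x) = ψ x := by simp [contraction]
    rw [h6, h7, h2, sub_zero, Function.comp_apply, h3,
      intervalIntegral.integral_finsetSum
        (fun a _ => Continuous.intervalIntegrable (by fun_prop) _ _)] at h5
    rw [← h5, ← h4, h3]
    simp only [intervalIntegral.integral_smul]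

/-- The Koszul complex of functions with independent differentials is exact near a point of their
zero set. `p a` and `d a` are multiplication by and contraction with the `a`-th generator. In the
linearizing chart `∑ p_a ∂_a` is a homotopy for `∑ c_a d_a` up to the Euler operator, which is
inverted by integrating along the contraction. -/
theorem exists_local_koszul_primitive_of_eq_zero [DecidableEq κ] [CompleteSpace E]
    [FiniteDimensional ℝ F] [HasContDiffBump E]
    {c : E → κ → ℝ} {x₀ : E} (hc : ∀ᶠ x in 𝓝 x₀, ContDiffAt ℝ ∞ c x) (hc₀ : c x₀ = 0) {e : κ → E}
    (he : ∀ a, fderiv ℝ c x₀ (e a) = Pi.single a 1) (p d : κ → F →L[ℝ] F)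
    (hdp : ∀ a b v, d b (p a v) = (if a = b then v else 0) - p a (d b v))
    {S T : Submodule ℝ F} (hpST : ∀ a, ∀ v ∈ S, p a v ∈ T) {j : ℕ} {z : E → F}
    (hz : ∀ᶠ x in 𝓝 x₀, ContDiffAt ℝ ∞ z x) (hzS : ∀ᶠ x in 𝓝 x₀, z x ∈ S)
    (hj : ∀ᶠ x in 𝓝 x₀, ∑ a, p a (d a (z x)) = (j : ℝ) • z x)
    (hδ : ∀ᶠ x in 𝓝 x₀, ∑ a, c x a • d a (z x) = 0)
    (hj₀ : j = 0 → ∀ᶠ x in 𝓝 x₀, (∀ a, d a (z x) = 0) ∧ (c x = 0 → z x = 0)) :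
    ∃ w : E → F, (∀ᶠ x in 𝓝 x₀, ContDiffAt ℝ ∞ w x) ∧
      ∀ᶠ x in 𝓝 x₀, w x ∈ T ∧ ∑ a, c x a • d a (w x) = z x := by
  have := FiniteDimensional.complete ℝ F
  obtain ⟨ψ, φ, hψ, hφ, hφ₀, hφψ, hcφ⟩ := exists_linearizing_chart hc he
  set ℓ := fderiv ℝ c x₀
  have hℓ₀ : ℓ (ψ x₀) = 0 := by rw [← hcφ.self_of_nhds, hφ₀, hc₀]
  have hφt : Tendsto φ (𝓝 (ψ x₀)) (𝓝 x₀) := by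
    have := hφ.self_of_nhds.continuousAt.tendsto
    rwa [hφ₀] at this
  have hψt : Tendsto ψ (𝓝 x₀) (𝓝 (ψ x₀)) := hψ.self_of_nhds.continuousAt.tendsto
  obtain ⟨g, hg, hgz⟩ := exists_contDiff_eventuallyEq (g := z ∘ φ) (x₀ := ψ x₀) (by
    filter_upwards [hφ, hφt.eventually hz] with y h1 h2 using h2.comp y h1)
  have hgd : ∀ y, HasFDerivAt g (fderiv ℝ g y) y := fun y =>
    (hg.differentiable (by simp) y).hasFDerivAt
  have hG : ContDiff ℝ ∞ fun q : ℝ × E =>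
      ∑ a, q.1 ^ j • p a (fderiv ℝ g (contraction ℓ e q.1 q.2) (e a)) :=
    ContDiff.sum fun a _ => (contDiff_fst.pow j).fun_smul ((p a).contDiff.comp
      (((hg.fderiv_right (m := ∞) (by simp)).comp (contDiff_contraction ℓ e)).clm_apply
        contDiff_const))
  refine ⟨fun x => ∫ t in (0 : ℝ)..1,
    ∑ a, t ^ j • p a (fderiv ℝ g (contraction ℓ e t (ψ x)) (e a)), ?_, ?_⟩
  · filter_upwards [hψ] with x hx
    exact (contDiff_integral_unitInterval hG).contDiffAt.comp x hx
  · have hgS : ∀ᶠ y in 𝓝 (ψ x₀), g y ∈ S := by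
      filter_upwards [hgz, hφt.eventually hzS] with y h1 h2
      rw [h1]; exact h2
    have hgj : ∀ᶠ y in 𝓝 (ψ x₀), ∑ a, p a (d a (g y)) = (j : ℝ) • g y := by
      filter_upwards [hgz, hφt.eventually hj] with y h1 h2
      rw [h1]; exact h2
    have hgδ : ∀ᶠ y in 𝓝 (ψ x₀), ∑ a, ℓ y a • d a (g y) = 0 := by
      filter_upwards [hgz, hcφ, hφt.eventually hδ] with y h1 h2 h3
      rw [h1, ← h2]; exact h3
    have hgj₀ : j = 0 → ∀ᶠ y in 𝓝 (ψ x₀), (∀ a, d a (g y) = 0) ∧ (ℓ y = 0 → g y = 0) := by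
      intro h
      filter_upwards [hgz, hcφ, hφt.eventually (hj₀ h)] with y h1 h2 h3
      rw [h1, ← h2]; exact h3
    -- the derivative of the closedness condition
    have hgδ' : ∀ᶠ y in 𝓝 (ψ x₀), ∀ a,
        d a (g y) + ∑ b, ℓ y b • d b (fderiv ℝ g y (e a)) = 0 := by
      filter_upwards [hgδ.eventually_nhds] with y h1 a
      have h2 : HasFDerivAt (fun y => ∑ b, ℓ y b • d b (g y)) _ y :=
        HasFDerivAt.fun_sum fun b _ => HasFDerivAt.fun_smul
          (((ContinuousLinearMap.proj (R := ℝ) (φ := fun _ : κ => ℝ) b).comp ℓ).hasFDerivAt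
            (x := y)) ((d b).hasFDerivAt.comp y (hgd y))
      have h3 := h2.unique ((hasFDerivAt_const (0 : F) y).congr_of_eventuallyEq h1)
      have h4 := congrArg (fun L => L (e a)) h3
      simpa [he, Finset.sum_add_distrib, Pi.single_apply, add_comm] using h4
    have hgj₀' : j = 0 → ∀ᶠ y in 𝓝 (ψ x₀), ∀ a b, d b (fderiv ℝ g y (e a)) = 0 := by
      intro h
      filter_upwards [(hgj₀ h).eventually_nhds] with y h1 a b
      have h2 := ((d b).hasFDerivAt.comp y (hgd y)).unique
        ((hasFDerivAt_const (0 : F) y).congr_of_eventuallyEq (h1.mono fun y hy => hy.1 b))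
      simpa using congrArg (fun L => L (e a)) h2
    have hall := hgS.eventually_nhds.and (hgj.and (hgδ'.and hgδ))
    have hall₀ : ∀ᶠ y in 𝓝 (ψ x₀), j = 0 →
        (∀ a b, d b (fderiv ℝ g y (e a)) = 0) ∧ (ℓ y = 0 → g y = 0) := by
      by_cases h : j = 0
      · filter_upwards [hgj₀ h, hgj₀' h] with y h1 h2 _ using ⟨h2, h1.2⟩
      · exact Eventually.of_forall fun y hy => absurd hy h
    filter_upwards [hψt.eventually (eventually_contraction_mem (e := e) hℓ₀ (hall.and hall₀)),
      hψt.eventually hgz, hφψ, hψt.eventually hcφ] with x h1 h2 h3 h4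
    have hcont : Continuous fun t : ℝ =>
        ∑ a, t ^ j • p a (fderiv ℝ g (contraction ℓ e t (ψ x)) (e a)) :=
      hG.continuous.comp (Continuous.prodMk_left (ψ x))
    refine ⟨intervalIntegral_mem hcont fun t ht => Submodule.sum_mem _ fun a _ =>
      T.smul_mem _ (hpST a _ (fderiv_mem_of_eventually_mem (hgd _).differentiableAt
        (h1 t ht).1.1 _)), ?_⟩
    have hDcont : ∀ a, Continuous fun t => fderiv ℝ g (contraction ℓ e t (ψ x)) (e a) := fun a =>
      (((hg.continuous_fderiv (by simp)).comp ((contDiff_contraction ℓ e).continuous.comp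
        (Continuous.prodMk_left (ψ x)))).clm_apply continuous_const)
    have hgcont : Continuous fun t => g (contraction ℓ e t (ψ x)) :=
      hg.continuous.comp ((contDiff_contraction ℓ e).continuous.comp
        (Continuous.prodMk_left (ψ x)))
    -- the total derivative of `t ^ j • g` along the contraction
    have h5 := intervalIntegral.integral_eq_sub_of_hasDerivAt (a := 0) (b := 1)
      (fun t _ => (hasDerivAt_pow j t).fun_smul
        (hasDerivAt_comp_contraction (ℓ := ℓ) (e := e) hg (ψ x) t))
      (Continuous.intervalIntegrable (((continuous_pow j).smul (continuous_finsetSum _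
        fun a _ => (hDcont a).const_smul _)).add
          ((continuous_const.mul (continuous_pow _)).smul hgcont)) _ _)
    have h6 : (0 : ℝ) ^ j • g (contraction ℓ e 0 (ψ x)) = 0 := by
      by_cases h : j = 0
      · rw [((h1 0 ⟨le_rfl, zero_le_one⟩).2 h).2 (by rw [apply_contraction he]; simp), smul_zero]
      · rw [zero_pow h, zero_smul]
    have h7 : contraction ℓ e 1 (ψ x) = ψ x := by simp [contraction]
    have h8 : ℓ (ψ x) = c x := by rw [← h4, h3]
    rw [h6, h7, h2, sub_zero, Function.comp_apply, h3, one_pow, one_smul] at h5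
    rw [← h5]
    have h9 : ∀ a, d a (∫ t in (0 : ℝ)..1,
        ∑ b, t ^ j • p b (fderiv ℝ g (contraction ℓ e t (ψ x)) (e b)))
        = ∫ t in (0 : ℝ)..1,
          d a (∑ b, t ^ j • p b (fderiv ℝ g (contraction ℓ e t (ψ x)) (e b))) := fun a =>
      ((d a).intervalIntegral_comp_comm (hcont.intervalIntegrable _ _)).symm
    simp only [h9, ← intervalIntegral.integral_smul]
    rw [← intervalIntegral.integral_finsetSum
      (fun a _ => Continuous.intervalIntegrable (by fun_prop) _ _)]
    refine intervalIntegral.integral_congr fun t ht => ?_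
    rw [Set.uIcc_of_le zero_le_one] at ht
    obtain ⟨⟨-, k1, k2, -⟩, k3⟩ := h1 t ht
    simp only [← h8]
    set y := contraction ℓ e t (ψ x)
    have hy : ℓ y = t • ℓ (ψ x) := apply_contraction he t (ψ x)
    have k4 : ∑ a, ℓ (ψ x) a • d a (∑ b, t ^ j • p b (fderiv ℝ g y (e b)))
        = t ^ j • ∑ a, ℓ (ψ x) a • fderiv ℝ g y (e a)
          - t ^ j • ∑ b, p b (∑ a, ℓ (ψ x) a • d a (fderiv ℝ g y (e b))) := by
      simp only [map_sum, map_smul, hdp, Finset.smul_sum, smul_sub, Finset.sum_sub_distrib]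
      congr 1
      · refine Finset.sum_congr rfl fun a _ => ?_
        simp [smul_smul, mul_comm]
      · rw [Finset.sum_comm]
        refine Finset.sum_congr rfl fun a _ => Finset.sum_congr rfl fun b _ => ?_
        rw [smul_comm]
    rw [k4, sub_eq_add_neg]
    congr 1
    rcases j with _ | i
    · simp [(k3 rfl).1]
    · have k5 : ∀ b, t • ∑ a, ℓ (ψ x) a • d a (fderiv ℝ g y (e b)) = - d b (g y) := by
        intro b
        rw [eq_neg_iff_add_eq_zero, add_comm, ← k2 b, hy]
        simp [Finset.smul_sum, smul_smul]
      have k6 : t • ∑ b, p b (∑ a, ℓ (ψ x) a • d a (fderiv ℝ g y (e b)))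
          = -(((i + 1 : ℕ) : ℝ) • g y) := by
        rw [Finset.smul_sum, ← k1, ← Finset.sum_neg_distrib]
        refine Finset.sum_congr rfl fun b _ => ?_
        rw [← map_smul, k5, map_neg]
      rw [pow_succ, mul_smul _ _ (∑ b, p b _), k6]
      simp [smul_smul, mul_comm]

/-- Linearly independent linear forms admit a dual family of vectors. -/
theorem exists_dual_family [DecidableEq κ] {ℓ : κ → E →L[ℝ] ℝ} (h : LinearIndependent ℝ ℓ) :
    ∃ e : κ → E, ∀ a b, ℓ b (e a) = (Pi.single a 1 : κ → ℝ) b := by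
  let Φ : E →ₗ[ℝ] κ → ℝ := LinearMap.pi fun b => (ℓ b : E →ₗ[ℝ] ℝ)
  have hΦ : LinearMap.range Φ = ⊤ := by
    by_contra hne
    obtain ⟨f, hf, hle⟩ := (LinearMap.range Φ).exists_le_ker_of_lt_top (lt_top_iff_ne_top.2 hne)
    apply hf
    have h1 : ∑ b, f (Pi.single b 1) • ℓ b = 0 := by
      ext v
      have h2 : f (Φ v) = 0 := hle ⟨v, rfl⟩
      rw [pi_eq_sum_univ' (Φ v)] at h2
      simpa [Φ, mul_comm] using h2
    have h3 := Fintype.linearIndependent_iff.1 h _ h1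
    exact LinearMap.pi_ext' fun b => LinearMap.ext_ring (by simpa using h3 b)
  have hs := LinearMap.range_eq_top.1 hΦ
  choose e he using fun a => hs (Pi.single a 1)
  exact ⟨e, fun a b => congrFun (he a) b⟩

end Division

section GlobalDivision

variable {E F : Type*} [NormedAddCommGroup E] [NormedSpace ℝ E] [FiniteDimensional ℝ E]
  [NormedAddCommGroup F] [NormedSpace ℝ F] {κ : Type*} [Fintype κ]

/-- Where some `c a` is nonzero, division by the family `c` is trivial. -/
theorem exists_local_division [CompleteSpace F] {c : κ → E → ℝ} {x₀ : E}
    (hc : ∀ᶠ x in 𝓝 x₀, ∀ a, ContDiffAt ℝ ∞ (c a) x)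
    (hreg : (∀ a, c a x₀ = 0) → LinearIndependent ℝ fun a => fderiv ℝ (c a) x₀) {z : E → F}
    (hz : ∀ᶠ x in 𝓝 x₀, ContDiffAt ℝ ∞ z x) (hzc : ∀ᶠ x in 𝓝 x₀, (∀ a, c a x = 0) → z x = 0) :
    ∃ A : κ → E → F, (∀ᶠ x in 𝓝 x₀, ∀ a, ContDiffAt ℝ ∞ (A a) x) ∧
      ∀ᶠ x in 𝓝 x₀, z x = ∑ a, c a x • A a x := by
  classical
  have := FiniteDimensional.complete ℝ E
  by_cases h0 : ∀ a, c a x₀ = 0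
  · obtain ⟨e, he⟩ := exists_dual_family (hreg h0)
    have hd : HasFDerivAt (fun x a => c a x)
        (ContinuousLinearMap.pi fun a => fderiv ℝ (c a) x₀) x₀ :=
      hasFDerivAt_pi.2 fun a => ((hc.self_of_nhds a).differentiableAt (by simp)).hasFDerivAt
    obtain ⟨A, hA, hzA⟩ := exists_local_division_of_eq_zero (c := fun x a => c a x) (e := e)
      (hc.mono fun x hx => contDiffAt_pi.2 hx) (funext h0)
      (fun a => by rw [hd.fderiv]; ext b; exact he a b) hz
      (hzc.mono fun x hx h => hx (congrFun h))
    exact ⟨A, hA, hzA⟩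
  · push Not at h0
    obtain ⟨a, ha⟩ := h0
    refine ⟨Pi.single a fun x => (c a x)⁻¹ • z x, ?_, ?_⟩
    · filter_upwards [hc, hz, (hc.self_of_nhds a).continuousAt.eventually_ne ha]
        with x h1 h2 h3 b
      by_cases hb : b = a
      · subst hb
        simpa using ((h1 b).inv h3).fun_smul h2
      · rw [Pi.single_eq_of_ne hb]
        exact contDiffAt_const
    · filter_upwards [(hc.self_of_nhds a).continuousAt.eventually_ne ha] with x h3
      rw [Finset.sum_eq_single a (fun b _ hb => by simp [hb]) (by simp)]
      simp [smul_smul, h3]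

theorem exists_local_koszul_primitive [DecidableEq κ] [FiniteDimensional ℝ F]
    {c : κ → E → ℝ} {x₀ : E} (hc : ∀ᶠ x in 𝓝 x₀, ∀ a, ContDiffAt ℝ ∞ (c a) x)
    (hreg : (∀ a, c a x₀ = 0) → LinearIndependent ℝ fun a => fderiv ℝ (c a) x₀)
    (p d : κ → F →L[ℝ] F)
    (hdp : ∀ a b v, d b (p a v) = (if a = b then v else 0) - p a (d b v))
    {S T : Submodule ℝ F} (hpST : ∀ a, ∀ v ∈ S, p a v ∈ T) {j : ℕ} {z : E → F}
    (hz : ∀ᶠ x in 𝓝 x₀, ContDiffAt ℝ ∞ z x) (hzS : ∀ᶠ x in 𝓝 x₀, z x ∈ S)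
    (hj : ∀ᶠ x in 𝓝 x₀, ∑ a, p a (d a (z x)) = (j : ℝ) • z x)
    (hδ : ∀ᶠ x in 𝓝 x₀, ∑ a, c a x • d a (z x) = 0)
    (hj₀ : j = 0 → ∀ᶠ x in 𝓝 x₀, (∀ a, d a (z x) = 0) ∧ ((∀ a, c a x = 0) → z x = 0)) :
    ∃ w : E → F, (∀ᶠ x in 𝓝 x₀, ContDiffAt ℝ ∞ w x) ∧
      ∀ᶠ x in 𝓝 x₀, w x ∈ T ∧ ∑ a, c a x • d a (w x) = z x := by
  have := FiniteDimensional.complete ℝ E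
  by_cases h0 : ∀ a, c a x₀ = 0
  · obtain ⟨e, he⟩ := exists_dual_family (hreg h0)
    have hd : HasFDerivAt (fun x a => c a x)
        (ContinuousLinearMap.pi fun a => fderiv ℝ (c a) x₀) x₀ :=
      hasFDerivAt_pi.2 fun a => ((hc.self_of_nhds a).differentiableAt (by simp)).hasFDerivAt
    exact exists_local_koszul_primitive_of_eq_zero (c := fun x a => c a x) (e := e)
      (hc.mono fun x hx => contDiffAt_pi.2 hx) (funext h0)
      (fun a => by rw [hd.fderiv]; ext b; exact he a b) p d hdp hpST hz hzS hj hδ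
      (fun h => (hj₀ h).mono fun x hx => ⟨hx.1, fun h' => hx.2 (congrFun h')⟩)
  · push Not at h0
    obtain ⟨a, ha⟩ := h0
    refine ⟨fun x => (c a x)⁻¹ • p a (z x), ?_, ?_⟩
    · filter_upwards [hc, hz, (hc.self_of_nhds a).continuousAt.eventually_ne ha] with x h1 h2 h3
      exact ((h1 a).inv h3).fun_smul ((p a).contDiff.contDiffAt.comp x h2)
    · filter_upwards [(hc.self_of_nhds a).continuousAt.eventually_ne ha, hzS, hδ] with x h3 h4 h5
      refine ⟨T.smul_mem _ (hpST a _ h4), ?_⟩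
      simp only [map_smul, hdp, smul_sub, Finset.sum_sub_distrib]
      have h6 : ∑ b, c b x • (c a x)⁻¹ • p a (d b (z x)) = 0 := by
        rw [← smul_zero (c a x)⁻¹, ← map_zero (p a), ← h5, map_sum, Finset.smul_sum]
        exact Finset.sum_congr rfl fun b _ => by rw [map_smul, smul_comm]
      rw [h6, sub_zero, Finset.sum_eq_single a (fun b _ hb => by simp [Ne.symm hb]) (by simp)]
      simp [smul_smul, h3]

/-- Smooth local solutions of a convex condition over an open set patch together. -/
theorem exists_contDiffOn_forall_mem_convex_of_local (U : Opens E) {t : E → Set F}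
    (ht : ∀ x ∈ U, Convex ℝ (t x))
    (hloc : ∀ x ∈ U, ∃ w : E → F, (∀ᶠ y in 𝓝 x, ContDiffAt ℝ ∞ w y) ∧ ∀ᶠ y in 𝓝 x, w y ∈ t y) :
    ∃ w : E → F, ContDiffOn ℝ ∞ w U ∧ ∀ x ∈ U, w x ∈ t x := by
  have : LocallyCompactSpace U := U.2.locallyCompactSpace
  have : SigmaCompactSpace U := inferInstance
  obtain ⟨g, hg⟩ := exists_contMDiffMap_forall_mem_convex_of_local (M := U) (n := ⊤)
    (modelWithCornersSelf ℝ E) (t := fun x => t x.1) (fun x => ht x.1 x.2) (fun x => by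
      obtain ⟨w, h1, h2⟩ := hloc x.1 x.2
      have h3 : Tendsto (Subtype.val : U → E) (𝓝 x) (𝓝 x.1) := continuous_subtype_val.tendsto x
      refine ⟨_, h3.eventually (h1.and h2), fun y => w y.1, fun y hy => ?_, fun y hy => hy.2⟩
      have h4 : ContMDiffAt (modelWithCornersSelf ℝ E) (modelWithCornersSelf ℝ F) ∞ w y.1 :=
        (show ContDiffAt ℝ ∞ w y.1 from hy.1).contMDiffAt
      exact ((contMDiffAt_subtype_iff (x := y)).2 h4).contMDiffWithinAt)
  classical
  refine ⟨fun x => if h : x ∈ U then g ⟨x, h⟩ else 0, fun x hx => ?_, fun x hx => ?_⟩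
  · have h1 : (fun y : U => (fun x => if h : x ∈ U then g ⟨x, h⟩ else 0 : E → F) y.1) = g := by
      ext y; simp
    have h2 := g.contMDiff ⟨x, hx⟩
    have h3 := (contMDiffAt_subtype_iff (I := modelWithCornersSelf ℝ E) (n := ∞)
      (I' := modelWithCornersSelf ℝ F) (U := U)
      (f := fun x => if h : x ∈ U then g ⟨x, h⟩ else 0) (x := ⟨x, hx⟩)).1 (by rw [h1]; exact h2)
    exact h3.contDiffAt.contDiffWithinAt
  · simpa [hx] using hg ⟨x, hx⟩

/-- The Koszul complex of a regular irreducible family of functions on `U`, with smooth coefficients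
and extended by the functions vanishing on the surface `c = 0` in degree zero, is exact. -/
theorem exists_koszul_primitive [DecidableEq κ] [FiniteDimensional ℝ F] (U : Opens E)
    {c : κ → E → ℝ} (hc : ∀ a, ContDiffOn ℝ ∞ (c a) U)
    (hreg : ∀ x ∈ U, (∀ a, c a x = 0) → LinearIndependent ℝ fun a => fderiv ℝ (c a) x)
    (p d : κ → F →L[ℝ] F)
    (hdp : ∀ a b v, d b (p a v) = (if a = b then v else 0) - p a (d b v))
    {S T : Submodule ℝ F} (hpST : ∀ a, ∀ v ∈ S, p a v ∈ T) {j : ℕ} {z : E → F}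
    (hz : ContDiffOn ℝ ∞ z U) (hzS : ∀ x ∈ U, z x ∈ S)
    (hj : ∀ x ∈ U, ∑ a, p a (d a (z x)) = (j : ℝ) • z x)
    (hδ : ∀ x ∈ U, ∑ a, c a x • d a (z x) = 0)
    (hj₀ : j = 0 → ∀ x ∈ U, (∀ a, d a (z x) = 0) ∧ ((∀ a, c a x = 0) → z x = 0)) :
    ∃ w : E → F, ContDiffOn ℝ ∞ w U ∧
      ∀ x ∈ U, w x ∈ T ∧ ∑ a, c a x • d a (w x) = z x := by
  refine exists_contDiffOn_forall_mem_convex_of_local U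
    (t := fun x => {w | w ∈ T ∧ ∑ a, c a x • d a w = z x}) (fun x _ => ?_) (fun x hx => ?_)
  · rintro v ⟨hv, hv'⟩ w ⟨hw, hw'⟩ r s - - hrs
    refine ⟨T.add_mem (T.smul_mem _ hv) (T.smul_mem _ hw), ?_⟩
    calc _ = r • ∑ a, c a x • d a v + s • ∑ a, c a x • d a w := by
          simp only [map_add, map_smul, smul_add, Finset.sum_add_distrib, Finset.smul_sum]
          congr 1 <;> exact Finset.sum_congr rfl fun a _ => smul_comm _ _ _
      _ = z x := by rw [hv', hw', ← add_smul, hrs, one_smul]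
  · have hU : ∀ᶠ y in 𝓝 x, y ∈ U := U.2.mem_nhds hx
    exact exists_local_koszul_primitive
      (hU.mono fun y hy a => (hc a).contDiffAt (U.2.mem_nhds hy)) (hreg x hx) p d hdp hpST
      (hU.mono fun y hy => hz.contDiffAt (U.2.mem_nhds hy)) (hU.mono hzS) (hU.mono hj)
      (hU.mono hδ) (fun h => hU.mono (hj₀ h))

end GlobalDivision

/-! ### Hamiltonian vector fields -/

section Poisson

variable {ι : Type*} [Fintype ι] [DecidableEq ι]

/-- The isomorphism from covectors to vectors defined by the canonical Poisson structure. -/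
noncomputable def sharp (ι : Type*) [Fintype ι] [DecidableEq ι] :
    (PhaseSpace ι →L[ℝ] ℝ) →L[ℝ] PhaseSpace ι :=
  ∑ i, ((ContinuousLinearMap.apply ℝ ℝ (dirQ i)).smulRight (dirP i)
    - (ContinuousLinearMap.apply ℝ ℝ (dirP i)).smulRight (dirQ i))

/-- The canonical Poisson structure as a bilinear form on covectors. -/
noncomputable def poissonForm (ℓ m : PhaseSpace ι →L[ℝ] ℝ) : ℝ :=
  ∑ i, (ℓ (dirQ i) * m (dirP i) - ℓ (dirP i) * m (dirQ i))

theorem apply_sharp (ℓ m : PhaseSpace ι →L[ℝ] ℝ) : m (sharp ι ℓ) = poissonForm ℓ m := by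
  simp [sharp, poissonForm, map_sum]

theorem poissonForm_antisymm (ℓ m : PhaseSpace ι →L[ℝ] ℝ) :
    poissonForm ℓ m = -poissonForm m ℓ := by
  simp only [poissonForm, ← Finset.sum_neg_distrib]
  exact Finset.sum_congr rfl fun i _ => by ring

/-- The Hamiltonian vector field of `f`. -/
noncomputable def hamVec (f : PhaseSpace ι → ℝ) (x : PhaseSpace ι) : PhaseSpace ι :=
  sharp ι (fderiv ℝ f x)

theorem poissonBracket_eq_poissonForm (f g : PhaseSpace ι → ℝ) (x : PhaseSpace ι) :
    poissonBracket f g x = poissonForm (fderiv ℝ f x) (fderiv ℝ g x) := rfl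

theorem fderiv_apply_hamVec (f g : PhaseSpace ι → ℝ) (x : PhaseSpace ι) :
    fderiv ℝ g x (hamVec f x) = poissonBracket f g x := apply_sharp _ _

theorem poissonBracket_antisymm (f g : PhaseSpace ι → ℝ) (x : PhaseSpace ι) :
    poissonBracket f g x = -poissonBracket g f x := poissonForm_antisymm _ _

variable {f g h : PhaseSpace ι → ℝ} {x : PhaseSpace ι}

theorem ContDiffAt.fderiv_infty {E F : Type*} [NormedAddCommGroup E] [NormedSpace ℝ E]
    [NormedAddCommGroup F] [NormedSpace ℝ F] {f : E → F} {x : E} (hf : ContDiffAt ℝ ∞ f x) :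
    ContDiffAt ℝ ∞ (fderiv ℝ f) x :=
  hf.fderiv_right (by simp)

theorem ContDiffAt.hasFDerivAt_fderiv {E F : Type*} [NormedAddCommGroup E] [NormedSpace ℝ E]
    [NormedAddCommGroup F] [NormedSpace ℝ F] {f : E → F} {x : E} (hf : ContDiffAt ℝ ∞ f x) :
    HasFDerivAt (fderiv ℝ f) (fderiv ℝ (fderiv ℝ f) x) x :=
  (hf.fderiv_infty.differentiableAt (by simp)).hasFDerivAt

theorem contDiffAt_hamVec (hf : ContDiffAt ℝ ∞ f x) : ContDiffAt ℝ ∞ (hamVec f) x :=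
  (sharp ι).contDiff.contDiffAt.comp x hf.fderiv_infty

theorem contDiffAt_poissonBracket (hf : ContDiffAt ℝ ∞ f x) (hg : ContDiffAt ℝ ∞ g x) :
    ContDiffAt ℝ ∞ (poissonBracket f g) x := by
  have : poissonBracket f g = fun x => fderiv ℝ g x (hamVec f x) :=
    funext fun x => (fderiv_apply_hamVec f g x).symm
  rw [this]
  exact hg.fderiv_infty.clm_apply (contDiffAt_hamVec hf)

theorem fderiv_hamVec (hf : ContDiffAt ℝ ∞ f x) (v : PhaseSpace ι) :
    fderiv ℝ (hamVec f) x v = sharp ι (fderiv ℝ (fderiv ℝ f) x v) := by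
  have h1 : HasFDerivAt (hamVec f) (sharp ι ∘L fderiv ℝ (fderiv ℝ f) x) x :=
    (sharp ι).hasFDerivAt.comp x hf.hasFDerivAt_fderiv
  rw [h1.fderiv]; rfl

theorem fderiv_poissonBracket (hf : ContDiffAt ℝ ∞ f x) (hg : ContDiffAt ℝ ∞ g x)
    (v : PhaseSpace ι) :
    fderiv ℝ (poissonBracket f g) x v = fderiv ℝ (fderiv ℝ g) x v (hamVec f x)
      - fderiv ℝ (fderiv ℝ f) x v (hamVec g x) := by
  have h1 : poissonBracket f g = fun x => fderiv ℝ g x (hamVec f x) :=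
    funext fun x => (fderiv_apply_hamVec f g x).symm
  have h2 := hg.hasFDerivAt_fderiv.clm_apply
    ((contDiffAt_hamVec hf).differentiableAt (by simp)).hasFDerivAt
  rw [h1, h2.fderiv]
  simp only [_root_.add_apply, ContinuousLinearMap.comp_apply,
    ContinuousLinearMap.flip_apply, fderiv_hamVec hf]
  rw [apply_sharp, poissonForm_antisymm, ← apply_sharp, hamVec, hamVec]
  ring

theorem fderiv_fderiv_symm {E : Type*} [NormedAddCommGroup E] [NormedSpace ℝ E]
    {f : E → ℝ} {x : E} (hf : ContDiffAt ℝ ∞ f x) (v w : E) :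
    fderiv ℝ (fderiv ℝ f) x v w = fderiv ℝ (fderiv ℝ f) x w v :=
  (hf.isSymmSndFDerivAt (by simpa using ENat.LEInfty.out)).eq v w

theorem fderiv_eq_zero_of_eventually_const {E : Type*} [NormedAddCommGroup E] [NormedSpace ℝ E]
    {f : E → ℝ} {x : E} {k : ℝ} (h : ∀ᶠ y in 𝓝 x, f y = k) :
    fderiv ℝ f x = 0 :=
  ((hasFDerivAt_const k x).congr_of_eventuallyEq h).fderiv

/-- Hamiltonian vector fields of functions with locally constant bracket commute. -/
theorem hamVec_comm {k : ℝ} (hf : ContDiffAt ℝ ∞ f x) (hg : ContDiffAt ℝ ∞ g x)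
    (hfg : ∀ᶠ y in 𝓝 x, poissonBracket f g y = k) :
    fderiv ℝ (hamVec f) x (hamVec g x) = fderiv ℝ (hamVec g) x (hamVec f x) := by
  rw [fderiv_hamVec hf, fderiv_hamVec hg]
  refine congrArg _ (ContinuousLinearMap.ext fun v => ?_)
  have h1 := fderiv_poissonBracket hf hg v
  rw [fderiv_eq_zero_of_eventually_const hfg] at h1
  rw [fderiv_fderiv_symm hf, fderiv_fderiv_symm hg]
  exact (sub_eq_zero.1 h1.symm).symm

/-- The Jacobi identity, for functions whose brackets with `h` are locally constant. -/
theorem fderiv_poissonBracket_hamVec_eq_zero {k k' : ℝ} (hh : ContDiffAt ℝ ∞ h x)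
    (hf : ContDiffAt ℝ ∞ f x) (hg : ContDiffAt ℝ ∞ g x)
    (hhf : ∀ᶠ y in 𝓝 x, poissonBracket h f y = k) (hhg : ∀ᶠ y in 𝓝 x, poissonBracket h g y = k') :
    fderiv ℝ (poissonBracket f g) x (hamVec h x) = 0 := by
  have h1 := fderiv_poissonBracket hh hf (hamVec g x)
  have h2 := fderiv_poissonBracket hh hg (hamVec f x)
  rw [fderiv_eq_zero_of_eventually_const hhf] at h1
  rw [fderiv_eq_zero_of_eventually_const hhg] at h2
  rw [fderiv_poissonBracket hf hg, fderiv_fderiv_symm hg, fderiv_fderiv_symm hf]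
  have h3 := fderiv_fderiv_symm hh (hamVec f x) (hamVec g x)
  simp only [_root_.zero_apply] at h1 h2
  linarith

variable {κ : Type*} [Fintype κ] [DecidableEq κ]

/-- Straightening along the Hamiltonian flows of functions `Q a` with locally constant brackets,
relative to the surface `f = 0`: `r` retracts onto the surface along the flows, and the times `τ`
are canonically conjugate to the `Q a`. -/
theorem exists_hamiltonian_straightening {Q f : κ → PhaseSpace ι → ℝ} {x₀ : PhaseSpace ι}
    (hQ : ∀ᶠ x in 𝓝 x₀, ∀ a, ContDiffAt ℝ ∞ (Q a) x)
    (hf : ∀ᶠ x in 𝓝 x₀, ∀ a, ContDiffAt ℝ ∞ (f a) x) {C : Matrix κ κ ℝ}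
    (hQQ : ∀ᶠ x in 𝓝 x₀, bracketMatrix Q Q x = C) (hf₀ : ∀ a, f a x₀ = 0)
    (hinv : IsUnit (bracketMatrix Q f x₀).det) :
    ∃ (τ : κ → PhaseSpace ι → ℝ) (r : PhaseSpace ι → PhaseSpace ι),
      (∀ᶠ x in 𝓝 x₀, (∀ a, ContDiffAt ℝ ∞ (τ a) x) ∧ ContDiffAt ℝ ∞ r x) ∧ r x₀ = x₀ ∧
      (∀ᶠ x in 𝓝 x₀, (∀ a, f a (r x) = 0) ∧ ((∀ a, f a x = 0) → (∀ a, τ a x = 0) ∧ r x = x) ∧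
        bracketMatrix Q τ x = -1 ∧ (∀ a, fderiv ℝ r x (hamVec (Q a) x) = 0) ∧
        ((∀ a, f a x = 0) → ∀ v, fderiv ℝ r x v = v + ∑ a, fderiv ℝ (τ a) x v • hamVec (Q a) x)) ∧
      ∀ W ∈ 𝓝 x₀, ∀ᶠ x in 𝓝 x₀, ∃ γ : ℝ → PhaseSpace ι, γ 0 = x ∧ γ 1 = r x ∧
        ∀ s ∈ Set.Icc (0 : ℝ) 1, γ s ∈ W ∧
          HasDerivWithinAt γ (∑ a, τ a x • hamVec (Q a) (γ s)) (Set.Icc 0 1) s := by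
  have hX : ∀ a, ∃ X : PhaseSpace ι → PhaseSpace ι, ContDiff ℝ ∞ X ∧ X =ᶠ[𝓝 x₀] hamVec (Q a) :=
    fun a => exists_contDiff_eventuallyEq (hQ.mono fun x hx => contDiffAt_hamVec (hx a))
  choose X' hX' hXQ' using hX
  let X : κ → C(PhaseSpace ι, PhaseSpace ι) := fun a => ⟨X' a, (hX' a).continuous⟩
  have hXQ : ∀ᶠ x in 𝓝 x₀, ∀ a, X a x = hamVec (Q a) x := eventually_all.2 hXQ'
  have hcomm : ∀ᶠ x in 𝓝 x₀, ∀ a b, fderiv ℝ (X a) x (X b x) = fderiv ℝ (X b) x (X a x) := by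
    filter_upwards [hXQ.eventually_nhds, hQ, hQQ.eventually_nhds] with x h1 h2 h3 a b
    have h4 : ∀ a, fderiv ℝ (X a) x = fderiv ℝ (hamVec (Q a)) x := fun a =>
      Filter.EventuallyEq.fderiv_eq (h1.mono fun y hy => hy a)
    rw [h4, h4, h1.self_of_nhds, h1.self_of_nhds]
    exact hamVec_comm (h2 a) (h2 b) (h3.mono fun y hy => congrFun (congrFun hy a) b)
  have hpi : ∀ {g : κ → PhaseSpace ι → ℝ} {x : PhaseSpace ι},
      (∀ a, DifferentiableAt ℝ (g a) x) → ∀ v b,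
        fderiv ℝ (fun x a => g a x) x v b = fderiv ℝ (g b) x v := by
    intro g x hg v b
    rw [(hasFDerivAt_pi.2 fun a => (hg a).hasFDerivAt).fderiv]
    rfl
  have hM : derivMatrix (fun a => X a) (fun x a => f a x) x₀ = bracketMatrix Q f x₀ := by
    ext a b
    simp only [derivMatrix, bracketMatrix, Matrix.of_apply]
    rw [hXQ.self_of_nhds, hpi fun a => (hf.self_of_nhds a).differentiableAt (by simp)]
    exact fderiv_apply_hamVec _ _ _
  obtain ⟨τ, r, hs, hr0, hev, hpath⟩ := exists_straightening X hX' x₀ hcomm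
    (f := fun x a => f a x) (hf.mono fun x hx => contDiffAt_pi.2 hx) (funext hf₀)
    (by rw [hM]; exact hinv)
  refine ⟨fun a x => τ x a, r, hs.mono fun x hx => ⟨contDiffAt_pi.1 hx.1, hx.2⟩, hr0, ?_, ?_⟩
  · filter_upwards [hs, hev, hXQ] with x h1 h2 h3
    obtain ⟨k1, k2, k3, k4, k5⟩ := h2
    have hτ : ∀ v b, fderiv ℝ τ x v b = fderiv ℝ (fun x => τ x b) x v := fun v b =>
      hpi (g := fun a x => τ x a)
        (fun a => (contDiffAt_pi.1 h1.1 a).differentiableAt (by simp)) v b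
    refine ⟨congrFun k1, fun h => ⟨congrFun (k2 (funext h)).1, (k2 (funext h)).2⟩, ?_,
      fun a => by rw [← h3]; exact k4 a, fun h v => ?_⟩
    · ext a b
      have := congrFun (k3 a) b
      rw [hτ, h3, fderiv_apply_hamVec] at this
      simp [bracketMatrix, this, Matrix.one_apply, Pi.single_apply, eq_comm]
    · rw [k5 (funext h)]
      simp only [hτ, h3]
  · intro W hW
    filter_upwards [hpath _ (inter_mem hW hXQ)] with x hx
    obtain ⟨γ, h1, h2, h3⟩ := hx
    refine ⟨γ, h1, h2, fun s hs => ⟨(h3 s hs).1.1, ?_⟩⟩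
    have h4 : ∀ a, X a (γ s) = hamVec (Q a) (γ s) := (h3 s hs).1.2
    simpa only [h4] using (h3 s hs).2

/-- Along a path whose velocity is a combination of Hamiltonian vector fields, functions commuting
with the generators are constant. -/
theorem eq_of_path {κ : Type*} [Fintype κ] {Q : κ → PhaseSpace ι → ℝ} {c : κ → ℝ}
    {γ : ℝ → PhaseSpace ι}
    {g : PhaseSpace ι → ℝ}
    (hγ : ∀ s ∈ Set.Icc (0 : ℝ) 1, DifferentiableAt ℝ g (γ s) ∧
      (∀ a, fderiv ℝ g (γ s) (hamVec (Q a) (γ s)) = 0) ∧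
      HasDerivWithinAt γ (∑ a, c a • hamVec (Q a) (γ s)) (Set.Icc 0 1) s) :
    ∀ s ∈ Set.Icc (0 : ℝ) 1, g (γ s) = g (γ 0) := by
  have h1 : ∀ s ∈ Set.Icc (0 : ℝ) 1, HasDerivWithinAt (fun s => g (γ s)) 0 (Set.Icc 0 1) s := by
    intro s hs
    obtain ⟨k1, k2, k3⟩ := hγ s hs
    have := k1.hasFDerivAt.comp_hasDerivWithinAt s k3
    simp only [map_sum, map_smul, k2, smul_zero, Finset.sum_const_zero] at this
    exact this
  exact constant_of_has_deriv_right_zero (fun s hs => (h1 s hs).continuousWithinAt)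
    (fun s hs => (h1 s (Set.Ico_subset_Icc_self hs)).mono_of_mem_nhdsWithin
      (Icc_mem_nhdsGE_of_mem hs))

end Poisson

/-! ### Abelian and canonically conjugate constraints -/

section Abelianization

variable {ι A B : Type*} [Fintype ι] [DecidableEq ι] [Fintype A] [DecidableEq A]

theorem poissonForm_sum_right (ℓ : PhaseSpace ι →L[ℝ] ℝ) (k : A → ℝ)
    (m : A → PhaseSpace ι →L[ℝ] ℝ) :
    poissonForm ℓ (∑ a, k a • m a) = ∑ a, k a * poissonForm ℓ (m a) := by
  simp only [← apply_sharp]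
  simp

theorem poissonForm_sum_left (ℓ : PhaseSpace ι →L[ℝ] ℝ) (k : A → ℝ)
    (m : A → PhaseSpace ι →L[ℝ] ℝ) :
    poissonForm (∑ a, k a • m a) ℓ = ∑ a, k a * poissonForm (m a) ℓ := by
  rw [poissonForm_antisymm, poissonForm_sum_right, ← Finset.sum_neg_distrib]
  exact Finset.sum_congr rfl fun a _ => by rw [poissonForm_antisymm (m a)]; ring

/-- On the constraint surface the differentials of `M c` are the combinations of those of `c`. -/
theorem fderiv_dressed {M : PhaseSpace ι → Matrix A A ℝ} {c : A → PhaseSpace ι → ℝ}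
    {x : PhaseSpace ι} (hM : ∀ a b, DifferentiableAt ℝ (fun x => M x a b) x)
    (hc : ∀ a, DifferentiableAt ℝ (c a) x) (h0 : ∀ a, c a x = 0) (a : A) :
    fderiv ℝ (dressed M c a) x = ∑ b, M x a b • fderiv ℝ (c b) x := by
  have h1 : HasFDerivAt (dressed M c a) _ x := HasFDerivAt.fun_sum fun b (_ : b ∈ Finset.univ) =>
    (hM a b).hasFDerivAt.fun_mul (hc b).hasFDerivAt
  rw [h1.fderiv]
  simp [h0]

theorem contDiffAt_dressed {M : PhaseSpace ι → Matrix A A ℝ} {c : A → PhaseSpace ι → ℝ}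
    {x : PhaseSpace ι} (hM : ∀ a b, ContDiffAt ℝ ∞ (fun x => M x a b) x)
    (hc : ∀ a, ContDiffAt ℝ ∞ (c a) x) (a : A) : ContDiffAt ℝ ∞ (dressed M c a) x :=
  ContDiffAt.sum fun b _ => (hM a b).mul (hc b)

theorem bracketMatrix_dressed_left {M : PhaseSpace ι → Matrix A A ℝ} {c : A → PhaseSpace ι → ℝ}
    {x : PhaseSpace ι} (hM : ∀ a b, DifferentiableAt ℝ (fun x => M x a b) x)
    (hc : ∀ a, DifferentiableAt ℝ (c a) x) (h0 : ∀ a, c a x = 0) (d : B → PhaseSpace ι → ℝ) :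
    bracketMatrix (dressed M c) d x = M x * bracketMatrix c d x := by
  ext a b
  simp only [bracketMatrix, Matrix.of_apply, Matrix.mul_apply, poissonBracket_eq_poissonForm,
    fderiv_dressed hM hc h0, poissonForm_sum_left]

theorem bracketMatrix_dressed_right {M : PhaseSpace ι → Matrix A A ℝ} {c : A → PhaseSpace ι → ℝ}
    {x : PhaseSpace ι} (hM : ∀ a b, DifferentiableAt ℝ (fun x => M x a b) x)
    (hc : ∀ a, DifferentiableAt ℝ (c a) x) (h0 : ∀ a, c a x = 0) (d : B → PhaseSpace ι → ℝ) :
    bracketMatrix d (dressed M c) x = bracketMatrix d c x * (M x).transpose := by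
  ext a b
  simp only [bracketMatrix, Matrix.of_apply, Matrix.mul_apply, poissonBracket_eq_poissonForm,
    fderiv_dressed hM hc h0, poissonForm_sum_right, Matrix.transpose_apply]
  exact Finset.sum_congr rfl fun _ _ => mul_comm _ _

theorem bracketMatrix_congr {c c' : A → PhaseSpace ι → ℝ} {d d' : B → PhaseSpace ι → ℝ}
    {x : PhaseSpace ι} (hc : ∀ a, c a =ᶠ[𝓝 x] c' a) (hd : ∀ b, d b =ᶠ[𝓝 x] d' b) :
    bracketMatrix c d x = bracketMatrix c' d' x := by
  ext a b
  simp only [bracketMatrix, Matrix.of_apply, poissonBracket_eq_poissonForm,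
    (hc a).fderiv_eq, (hd b).fderiv_eq]

theorem bracketMatrix_antisymm (c : A → PhaseSpace ι → ℝ) (d : B → PhaseSpace ι → ℝ)
    (x : PhaseSpace ι) : bracketMatrix c d x = -(bracketMatrix d c x).transpose := by
  ext a b
  simp [bracketMatrix, poissonBracket_antisymm (c a)]

/-- First class functions `f` transversal to the flows of functions `Q` with constant brackets can
be replaced by equivalent Abelian ones that are canonically conjugate to `Q`: the straightening
times `τ` of the flows relative to the surface `f = 0`. Their brackets are constant along the flows
by the Jacobi identity and vanish on the surface. -/
theorem exists_abelian_conjugate {Q f : A → PhaseSpace ι → ℝ} {x₀ : PhaseSpace ι}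
    (hQ : ∀ᶠ x in 𝓝 x₀, ∀ a, ContDiffAt ℝ ∞ (Q a) x)
    (hf : ∀ᶠ x in 𝓝 x₀, ∀ a, ContDiffAt ℝ ∞ (f a) x) {C : Matrix A A ℝ}
    (hQQ : ∀ᶠ x in 𝓝 x₀, bracketMatrix Q Q x = C) (hf₀ : ∀ a, f a x₀ = 0)
    (hreg : LinearIndependent ℝ fun a => fderiv ℝ (f a) x₀)
    (hff : ∀ᶠ x in 𝓝 x₀, (∀ a, f a x = 0) → bracketMatrix f f x = 0)
    (hinv : IsUnit (bracketMatrix Q f x₀).det) :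
    ∃ M : PhaseSpace ι → Matrix A A ℝ, ∀ᶠ x in 𝓝 x₀,
      (∀ a b, ContDiffAt ℝ ∞ (fun x => M x a b) x) ∧ IsUnit (M x).det ∧
      bracketMatrix Q (dressed M f) x = 1 ∧ bracketMatrix (dressed M f) (dressed M f) x = 0 := by
  obtain ⟨τ, r, hs, hr0, hev, hpath⟩ := exists_hamiltonian_straightening hQ hf hQQ hf₀ hinv
  have hdiv : ∀ a, ∃ D : A → PhaseSpace ι → ℝ, (∀ᶠ x in 𝓝 x₀, ∀ b, ContDiffAt ℝ ∞ (D b) x) ∧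
      ∀ᶠ x in 𝓝 x₀, -τ a x = ∑ b, f b x • D b x := fun a =>
    exists_local_division (z := fun x => -τ a x) hf (fun _ => hreg)
      (hs.mono fun x hx => (hx.1 a).neg) (hev.mono fun x hx h => by simp [(hx.2.1 h).1 a])
  choose D hD hτD using hdiv
  let M : PhaseSpace ι → Matrix A A ℝ := fun x => Matrix.of fun a b => D a b x
  have hM : ∀ᶠ x in 𝓝 x₀, ∀ a b, ContDiffAt ℝ ∞ (fun x => M x a b) x := eventually_all.2 hD
  have hMτ : ∀ᶠ x in 𝓝 x₀, ∀ a, dressed M f a x = -τ a x := by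
    filter_upwards [eventually_all.2 hτD] with x hx a
    rw [hx a]
    simp [dressed, M, mul_comm]
  have hP : ∀ᶠ x in 𝓝 x₀, ∀ a, ContDiffAt ℝ ∞ (dressed M f a) x := by
    filter_upwards [hM, hf] with x h1 h2 using contDiffAt_dressed h1 h2
  have hQP : ∀ᶠ x in 𝓝 x₀, bracketMatrix Q (dressed M f) x = 1 := by
    filter_upwards [hMτ.eventually_nhds, hev] with x h1 h2
    have h3 : bracketMatrix Q (dressed M f) x = bracketMatrix Q (fun a x => -τ a x) x :=
      bracketMatrix_congr (fun _ => EventuallyEq.rfl) (fun a => h1.mono fun y hy => hy a)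
    have h4 : bracketMatrix Q (fun a x => -τ a x) x = -bracketMatrix Q τ x := by
      ext a b
      simp [bracketMatrix, ← fderiv_apply_hamVec]
    rw [h3, h4, h2.2.2.1, neg_neg]
  refine ⟨M, ?_⟩
  have hdet : ∀ᶠ x in 𝓝 x₀, IsUnit (M x).det := by
    have h1 : ContinuousAt (fun x => (M x).det) x₀ := by
      refine ContinuousAt.comp (g := Matrix.det) (f := M) continuous_id.matrix_det.continuousAt ?_
      exact continuousAt_pi.2 fun a => continuousAt_pi.2 fun b =>
        (hM.self_of_nhds a b).continuousAt
    have h2 : bracketMatrix Q f x₀ * (M x₀).transpose = 1 := by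
      rw [← bracketMatrix_dressed_right
        (fun a b => (hM.self_of_nhds a b).differentiableAt (by simp))
        (fun a => (hf.self_of_nhds a).differentiableAt (by simp)) hf₀, hQP.self_of_nhds]
    have h3 : (M x₀).det ≠ 0 := by
      intro h
      have := congrArg Matrix.det h2
      rw [Matrix.det_mul, Matrix.det_transpose, h, mul_zero, Matrix.det_one] at this
      exact zero_ne_one this
    exact (h1.eventually_ne h3).mono fun x hx => hx.isUnit
  have hrt : Tendsto r (𝓝 x₀) (𝓝 x₀) := by
    have := hs.self_of_nhds.2.continuousAt.tendsto
    rwa [hr0] at this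
  -- the brackets of the new functions vanish on the surface and are constant along the flows
  have hsurf : ∀ᶠ x in 𝓝 x₀, (∀ a, f a x = 0) →
      bracketMatrix (dressed M f) (dressed M f) x = 0 := by
    filter_upwards [hM, hf, hff] with x h1 h2 h3 h4
    have h1' := fun a b => (h1 a b).differentiableAt (by simp)
    have h2' := fun a => (h2 a).differentiableAt (by simp)
    rw [bracketMatrix_dressed_left h1' h2' h4, bracketMatrix_dressed_right h1' h2' h4, h3 h4]
    simp
  have hinvar : ∀ᶠ x in 𝓝 x₀, ∀ a b,
      ContDiffAt ℝ ∞ (poissonBracket (dressed M f a) (dressed M f b)) x ∧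
      ∀ c, fderiv ℝ (poissonBracket (dressed M f a) (dressed M f b)) x (hamVec (Q c) x) = 0 := by
    filter_upwards [hP, hQ, hQP.eventually_nhds] with x h1 h2 h3 a b
    exact ⟨contDiffAt_poissonBracket (h1 a) (h1 b), fun c =>
      fderiv_poissonBracket_hamVec_eq_zero (h2 c) (h1 a) (h1 b)
        (h3.mono fun y hy => congrFun (congrFun hy c) a)
        (h3.mono fun y hy => congrFun (congrFun hy c) b)⟩
  filter_upwards [hM, hdet, hQP, hpath _ hinvar, hrt.eventually hsurf, hev]
    with x h1 h2 h3 h4 h5 h6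
  refine ⟨h1, h2, h3, ?_⟩
  obtain ⟨γ, k1, k2, k3⟩ := h4
  ext a b
  have h7 := eq_of_path (Q := Q) (c := fun a => τ a x) (γ := γ)
    (g := poissonBracket (dressed M f a) (dressed M f b)) fun s hs =>
      ⟨((k3 s hs).1 a b).1.differentiableAt (by simp), ((k3 s hs).1 a b).2, (k3 s hs).2⟩
  replace h7 := h7 1 ⟨zero_le_one, le_rfl⟩
  rw [k1, k2] at h7
  exact h7.symm.trans (congrFun (congrFun (h5 h6.1) a) b)

/-- First class sets `χ`, `σ` whose surfaces intersect in a symplectic surface are, locally and up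
to invertible matrices, Abelian and canonically conjugate to each other. Straightening `χ` along
the constant Hamiltonian fields given by the differentials of `σ` at one point makes it Abelian;
straightening `σ` along the resulting commuting flows makes it Abelian and conjugate. -/
theorem exists_conjugate_abelianization {U : Set (PhaseSpace ι)} (hU : IsOpen U)
    {χ σ : A → PhaseSpace ι → ℝ} (hχ : IsFirstClassSystem U χ) (hσ : IsFirstClassSystem U σ)
    {x₀ : PhaseSpace ι} (hχ₀ : x₀ ∈ constraintSurface U χ) (hσ₀ : x₀ ∈ constraintSurface U σ)
    (hinv : IsUnit (bracketMatrix χ σ x₀).det) :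
    ∃ M N : PhaseSpace ι → Matrix A A ℝ, ∀ᶠ x in 𝓝 x₀,
      (∀ a b, ContDiffAt ℝ ∞ (fun x => M x a b) x) ∧
      (∀ a b, ContDiffAt ℝ ∞ (fun x => N x a b) x) ∧ IsUnit (M x).det ∧ IsUnit (N x).det ∧
      bracketMatrix (dressed M χ) (dressed M χ) x = 0 ∧
      bracketMatrix (dressed N σ) (dressed N σ) x = 0 ∧
      bracketMatrix (dressed M χ) (dressed N σ) x = 1 := by
  have hxU : ∀ᶠ x in 𝓝 x₀, x ∈ U := hU.mem_nhds hχ₀.1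
  have hχs : ∀ᶠ x in 𝓝 x₀, ∀ a, ContDiffAt ℝ ∞ (χ a) x :=
    hxU.mono fun x hx a => (hχ.smooth a).contDiffAt (hU.mem_nhds hx)
  have hσs : ∀ᶠ x in 𝓝 x₀, ∀ a, ContDiffAt ℝ ∞ (σ a) x :=
    hxU.mono fun x hx a => (hσ.smooth a).contDiffAt (hU.mem_nhds hx)
  have hχχ : ∀ᶠ x in 𝓝 x₀, (∀ a, χ a x = 0) → bracketMatrix χ χ x = 0 :=
    hxU.mono fun x hx h => by ext a b; exact hχ.first_class x ⟨hx, h⟩ a b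
  have hσσ : ∀ᶠ x in 𝓝 x₀, (∀ a, σ a x = 0) → bracketMatrix σ σ x = 0 :=
    hxU.mono fun x hx h => by ext a b; exact hσ.first_class x ⟨hx, h⟩ a b
  let Q : A → PhaseSpace ι → ℝ := fun a x => fderiv ℝ (σ a) x₀ x
  have hQd : ∀ a x, fderiv ℝ (Q a) x = fderiv ℝ (σ a) x₀ := fun a x =>
    (fderiv ℝ (σ a) x₀).fderiv
  have hQf : bracketMatrix Q χ x₀ = bracketMatrix σ χ x₀ := by
    ext a b
    simp [bracketMatrix, poissonBracket_eq_poissonForm, hQd]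
  obtain ⟨M, hM⟩ := exists_abelian_conjugate (Q := Q) (f := χ) (C := bracketMatrix σ σ x₀)
    (Eventually.of_forall fun x a => (fderiv ℝ (σ a) x₀).contDiff.contDiffAt) hχs
    (Eventually.of_forall fun x => by
      ext a b
      simp [bracketMatrix, poissonBracket_eq_poissonForm, hQd])
    hχ₀.2 (hχ.regular_irreducible x₀ hχ₀) hχχ (by
      rw [hQf, bracketMatrix_antisymm, Matrix.det_neg, Matrix.det_transpose]
      exact (IsUnit.pow _ (by simp)).mul hinv)
  have hPs : ∀ᶠ x in 𝓝 x₀, ∀ a, ContDiffAt ℝ ∞ (dressed M χ a) x := by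
    filter_upwards [hM, hχs] with x h1 h2 using contDiffAt_dressed h1.1 h2
  obtain ⟨N, hN⟩ := exists_abelian_conjugate (Q := dressed M χ) (f := σ) (C := 0) hPs hσs
    (hM.mono fun x hx => hx.2.2.2) hσ₀.2 (hσ.regular_irreducible x₀ hσ₀) hσσ (by
      rw [bracketMatrix_dressed_left
        (fun a b => (hM.self_of_nhds.1 a b).differentiableAt (by simp))
        (fun a => (hχs.self_of_nhds a).differentiableAt (by simp)) hχ₀.2, Matrix.det_mul]
      exact hM.self_of_nhds.2.1.mul hinv)
  exact ⟨M, N, by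
    filter_upwards [hM, hN] with x h1 h2
    exact ⟨h1.1, h2.1, h1.2.1, h2.2.1, h1.2.2.2, h2.2.2.2, h2.2.2.1⟩⟩

end Abelianization

/-! ### Transport of the untraded constraints -/

section Transport

/-- A vector function whose derivative along a path is bounded by a multiple of its norm vanishes at
both ends of the path or at neither. -/
theorem path_eq_zero_iff {F : Type*} [NormedAddCommGroup F] [NormedSpace ℝ F] {h h' : ℝ → F} {K : ℝ}
    (hd : ∀ s ∈ Set.Icc (0 : ℝ) 1, HasDerivWithinAt h (h' s) (Set.Icc 0 1) s)
    (hK : ∀ s ∈ Set.Icc (0 : ℝ) 1, ‖h' s‖ ≤ K * ‖h s‖) : h 0 = 0 ↔ h 1 = 0 := by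
  have key : ∀ {h h' : ℝ → F},
      (∀ s ∈ Set.Icc (0 : ℝ) 1, HasDerivWithinAt h (h' s) (Set.Icc 0 1) s) →
      (∀ s ∈ Set.Icc (0 : ℝ) 1, ‖h' s‖ ≤ K * ‖h s‖) → h 0 = 0 → h 1 = 0 := by
    intro h h' hd hK h0
    exact eq_zero_of_abs_deriv_le_mul_abs_self_of_eq_zero_right
      (fun s hs => (hd s hs).continuousWithinAt)
      (fun s hs => (hd s (Set.Ico_subset_Icc_self hs)).mono_of_mem_nhdsWithin
        (Icc_mem_nhdsGE_of_mem hs)) h0 (fun s hs => hK s (Set.Ico_subset_Icc_self hs)) 1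
      ⟨zero_le_one, le_rfl⟩
  refine ⟨key hd hK, fun h1 => ?_⟩
  have hmem : ∀ {s : ℝ}, s ∈ Set.Icc (0 : ℝ) 1 → 1 - s ∈ Set.Icc (0 : ℝ) 1 := fun hs =>
    ⟨by linarith [hs.2], by linarith [hs.1]⟩
  have := key (h := fun s => h (1 - s)) (h' := fun s => (-1 : ℝ) • h' (1 - s)) (fun s hs => ?_)
    (fun s hs => by simpa using hK _ (hmem hs)) (by simpa using h1)
  · simpa using this
  · exact HasDerivWithinAt.scomp s (hd _ (hmem hs))
      ((hasDerivAt_id s).const_sub 1).hasDerivWithinAt (fun t ht => hmem ht)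

variable {ι A I : Type*} [Fintype ι] [DecidableEq ι] [Fintype A] [Fintype I]

/-- The surface `χ = η = 0` is invariant under the flows of Abelian generators `P` of the surface
`χ = 0`: on `χ = 0` the derivatives of `η` along the flows are combinations of `η` itself. -/
theorem exists_nhds_path_eq_zero_iff {U : Set (PhaseSpace ι)} (hU : IsOpen U)
    {χ : A → PhaseSpace ι → ℝ} {η : I → PhaseSpace ι → ℝ}
    (hχη : IsFirstClassSystem U (Sum.elim χ η)) {x₀ : PhaseSpace ι} (hx₀ : x₀ ∈ U)
    {P : A → PhaseSpace ι → ℝ} (hP : ∀ᶠ x in 𝓝 x₀, ∀ a, ContDiffAt ℝ ∞ (P a) x)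
    (hPP : ∀ᶠ x in 𝓝 x₀, bracketMatrix P P x = 0)
    (hPχ : ∀ᶠ x in 𝓝 x₀, (∀ a, P a x = 0) ↔ ∀ a, χ a x = 0)
    (hPη : ∀ᶠ x in 𝓝 x₀, (∀ a, χ a x = 0) → (∀ i, η i x = 0) → bracketMatrix P η x = 0) :
    ∃ W ∈ 𝓝 x₀, ∀ (γ : ℝ → PhaseSpace ι) (c : A → ℝ), (∀ a, χ a (γ 0) = 0) →
      (∀ s ∈ Set.Icc (0 : ℝ) 1, γ s ∈ W ∧
        HasDerivWithinAt γ (∑ a, c a • hamVec (P a) (γ s)) (Set.Icc 0 1) s) →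
      ((∀ i, η i (γ 0) = 0) ↔ ∀ i, η i (γ 1) = 0) := by
  have hxU : ∀ᶠ x in 𝓝 x₀, x ∈ U := hU.mem_nhds hx₀
  have hs : ∀ᶠ x in 𝓝 x₀, ∀ a, ContDiffAt ℝ ∞ (Sum.elim χ η a) x :=
    hxU.mono fun x hx a => (hχη.smooth a).contDiffAt (hU.mem_nhds hx)
  have hdiv : ∀ q : A × I, ∃ D : A ⊕ I → PhaseSpace ι → ℝ,
      (∀ᶠ x in 𝓝 x₀, ∀ b, ContDiffAt ℝ ∞ (D b) x) ∧
      ∀ᶠ x in 𝓝 x₀, poissonBracket (P q.1) (η q.2) x = ∑ b, Sum.elim χ η b x • D b x := by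
    intro q
    refine exists_local_division hs (fun h => hχη.regular_irreducible x₀ ⟨hx₀, h⟩) ?_ ?_
    · filter_upwards [hP, hs] with x h1 h2
      exact contDiffAt_poissonBracket (h1 q.1) (h2 (Sum.inr q.2))
    · filter_upwards [hPη] with x h1 h2
      exact congrFun (congrFun (h1 (fun a => h2 (Sum.inl a)) fun i => h2 (Sum.inr i)) q.1) q.2
  choose D hD hDeq using hdiv
  have hbound : ∀ᶠ x in 𝓝 x₀, ∀ q b, ‖D q b x‖ < ∑ q, ∑ b, ‖D q b x₀‖ + 1 := by
    refine eventually_all.2 fun q => eventually_all.2 fun b => ?_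
    have h1 : ContinuousAt (fun x => ‖D q b x‖) x₀ :=
      ((hD q).self_of_nhds b).continuousAt.norm
    refine h1.eventually_lt continuousAt_const ?_
    have h2 : ‖D q b x₀‖ ≤ ∑ b, ‖D q b x₀‖ :=
      Finset.single_le_sum (f := fun b => ‖D q b x₀‖) (fun _ _ => norm_nonneg _)
        (Finset.mem_univ b)
    have h3 : ∑ b, ‖D q b x₀‖ ≤ ∑ q, ∑ b, ‖D q b x₀‖ :=
      Finset.single_le_sum (f := fun q => ∑ b, ‖D q b x₀‖)
        (fun _ _ => Finset.sum_nonneg fun _ _ => norm_nonneg _) (Finset.mem_univ q)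
    linarith
  set K₀ := ∑ q, ∑ b, ‖D q b x₀‖ + 1 with hK₀
  have hK₀0 : 0 ≤ K₀ := by positivity
  refine ⟨_, (hs.and (hP.and (hPP.and (hPχ.and (hbound.and (eventually_all.2 hDeq)))))),
    fun γ c h0 hγ => ?_⟩
  have hχ0 : ∀ s ∈ Set.Icc (0 : ℝ) 1, ∀ a, χ a (γ s) = 0 := by
    intro s hs'
    obtain ⟨-, -, -, h4, -, -⟩ := (hγ s hs').1
    obtain ⟨-, -, -, h4', -, -⟩ := (hγ 0 ⟨le_rfl, zero_le_one⟩).1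
    refine h4.1 fun a => ?_
    have h5 := eq_of_path (Q := P) (c := c) (γ := γ) (g := P a) (fun t ht => by
      obtain ⟨⟨-, h2, h3, -⟩, h5⟩ := hγ t ht
      exact ⟨(h2 a).differentiableAt (by simp), fun b => by
        rw [fderiv_apply_hamVec]; exact congrFun (congrFun h3 b) a, h5⟩) s hs'
    rw [h5]; exact h4'.2 h0 a
  have hiff := path_eq_zero_iff (h := fun s i => η i (γ s))
    (h' := fun s i => fderiv ℝ (η i) (γ s) (∑ a, c a • hamVec (P a) (γ s)))
    (K := (∑ a, |c a|) * (Fintype.card I * K₀)) (fun s hs' => ?_) (fun s hs' => ?_)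
  · simpa [funext_iff] using hiff
  · refine hasDerivWithinAt_pi.2 fun i => ?_
    obtain ⟨⟨h1, -⟩, h5⟩ := hγ s hs'
    exact ((h1 (Sum.inr i)).differentiableAt (by simp)).hasFDerivAt.comp_hasDerivWithinAt s h5
  · obtain ⟨⟨-, -, -, -, h5, h6⟩, -⟩ := hγ s hs'
    rw [pi_norm_le_iff_of_nonneg (by positivity)]
    intro i
    have h7 : ∀ a, |poissonBracket (P a) (η i) (γ s)|
        ≤ Fintype.card I * K₀ * ‖fun i => η i (γ s)‖ := by
      intro a
      rw [h6 (a, i), Fintype.sum_sum_type]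
      simp only [Sum.elim_inl, Sum.elim_inr, hχ0 s hs', zero_smul, Finset.sum_const_zero, zero_add]
      refine (Finset.abs_sum_le_sum_abs _ _).trans ?_
      have h8 : ∀ j ∈ Finset.univ, |η j (γ s) • D (a, i) (Sum.inr j) (γ s)|
          ≤ K₀ * ‖fun i => η i (γ s)‖ := by
        intro j _
        rw [smul_eq_mul, abs_mul, mul_comm]
        exact mul_le_mul (h5 (a, i) (Sum.inr j)).le (norm_le_pi_norm (fun i => η i (γ s)) j)
          (abs_nonneg _) hK₀0
      refine (Finset.sum_le_card_nsmul _ _ _ h8).trans ?_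
      rw [nsmul_eq_mul, Finset.card_univ, mul_assoc]
    simp only [map_sum, map_smul, fderiv_apply_hamVec]
    refine (norm_sum_le _ _).trans ?_
    rw [mul_assoc, Finset.sum_mul]
    refine Finset.sum_le_sum fun a _ => ?_
    rw [norm_smul, Real.norm_eq_abs, Real.norm_eq_abs]
    exact mul_le_mul_of_nonneg_left (h7 a) (abs_nonneg _)

end Transport

/-! ### Untraded constraints that commute with the traded pairs -/

section Untraded

variable {ι A I : Type*} [Fintype ι] [DecidableEq ι] [Fintype A] [DecidableEq A] [Finite I]

/-- The functions `η` can be continued from the symplectic surface `P = S = 0` to functions `η'`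
that are constant along the flows of the canonical pairs `P`, `S`; the `η'` commute with `P` and
`S` everywhere. -/
theorem exists_commuting_constraints {P S : A → PhaseSpace ι → ℝ} {η : I → PhaseSpace ι → ℝ}
    {x₀ : PhaseSpace ι} (hP : ∀ᶠ x in 𝓝 x₀, ∀ a, ContDiffAt ℝ ∞ (P a) x)
    (hS : ∀ᶠ x in 𝓝 x₀, ∀ a, ContDiffAt ℝ ∞ (S a) x)
    (hη : ∀ᶠ x in 𝓝 x₀, ∀ i, ContDiffAt ℝ ∞ (η i) x)
    (hPP : ∀ᶠ x in 𝓝 x₀, bracketMatrix P P x = 0) (hSS : ∀ᶠ x in 𝓝 x₀, bracketMatrix S S x = 0)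
    (hPS : ∀ᶠ x in 𝓝 x₀, bracketMatrix P S x = 1) (hP₀ : ∀ a, P a x₀ = 0) (hS₀ : ∀ a, S a x₀ = 0)
    (hreg : (∀ i, η i x₀ = 0) → LinearIndependent ℝ fun i => fderiv ℝ (η i) x₀)
    (hfc : ∀ᶠ x in 𝓝 x₀, (∀ a, P a x = 0) → (∀ a, S a x = 0) → (∀ i, η i x = 0) →
      bracketMatrix P η x = 0 ∧ bracketMatrix S η x = 0 ∧ bracketMatrix η η x = 0)
    {WP WS : Set (PhaseSpace ι)} (hWP : WP ∈ 𝓝 x₀) (hWS : WS ∈ 𝓝 x₀)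
    (hPinv : ∀ (γ : ℝ → PhaseSpace ι) (c : A → ℝ), (∀ a, P a (γ 0) = 0) →
      (∀ s ∈ Set.Icc (0 : ℝ) 1, γ s ∈ WP ∧
        HasDerivWithinAt γ (∑ a, c a • hamVec (P a) (γ s)) (Set.Icc 0 1) s) →
      ((∀ i, η i (γ 0) = 0) ↔ ∀ i, η i (γ 1) = 0))
    (hSinv : ∀ (γ : ℝ → PhaseSpace ι) (c : A → ℝ), (∀ a, S a (γ 0) = 0) →
      (∀ s ∈ Set.Icc (0 : ℝ) 1, γ s ∈ WS ∧
        HasDerivWithinAt γ (∑ a, c a • hamVec (S a) (γ s)) (Set.Icc 0 1) s) →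
      ((∀ i, η i (γ 0) = 0) ↔ ∀ i, η i (γ 1) = 0)) :
    ∃ η' : I → PhaseSpace ι → ℝ, ∀ᶠ x in 𝓝 x₀, (∀ i, ContDiffAt ℝ ∞ (η' i) x) ∧
      bracketMatrix P η' x = 0 ∧ bracketMatrix S η' x = 0 ∧
      ((∀ i, η' i x = 0) →
        (LinearIndependent ℝ fun i => fderiv ℝ (η' i) x) ∧ bracketMatrix η' η' x = 0) ∧
      ((∀ a, P a x = 0) → ((∀ i, η' i x = 0) ↔ ∀ i, η i x = 0)) ∧
      ((∀ a, S a x = 0) → ((∀ i, η' i x = 0) ↔ ∀ i, η i x = 0)) := by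
  set Q : A ⊕ A → PhaseSpace ι → ℝ := Sum.elim P S with hQdef
  set C : Matrix (A ⊕ A) (A ⊕ A) ℝ := Matrix.fromBlocks 0 1 (-1) 0 with hC
  have hQ : ∀ᶠ x in 𝓝 x₀, ∀ a, ContDiffAt ℝ ∞ (Q a) x := by
    filter_upwards [hP, hS] with x h1 h2
    rintro (a | a)
    exacts [h1 a, h2 a]
  have hQQ : ∀ᶠ x in 𝓝 x₀, bracketMatrix Q Q x = C := by
    filter_upwards [hPP, hSS, hPS] with x h1 h2 h3
    have h4 : bracketMatrix S P x = -1 := by rw [bracketMatrix_antisymm, h3]; simp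
    ext (a | a) (b | b)
    exacts [congrFun (congrFun h1 a) b, congrFun (congrFun h3 a) b, congrFun (congrFun h4 a) b,
      congrFun (congrFun h2 a) b]
  have hCdet : IsUnit C.det := by
    have : C * Matrix.fromBlocks 0 (-1) 1 0 = 1 := by
      rw [hC, Matrix.fromBlocks_multiply]; simp
    exact (Matrix.isUnit_iff_isUnit_det C).1 (IsUnit.of_mul_eq_one _ this)
  have hQ₀ : ∀ a, Q a x₀ = 0 := by rintro (a | a); exacts [hP₀ a, hS₀ a]
  obtain ⟨τ, r, hs, hr0, hev, hpath⟩ := exists_hamiltonian_straightening hQ hQ hQQ hQ₀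
    (by rw [hQQ.self_of_nhds]; exact hCdet)
  have hrt : Tendsto r (𝓝 x₀) (𝓝 x₀) := by
    simpa [ContinuousAt, hr0] using hs.self_of_nhds.2.continuousAt
  have hQη' : ∀ᶠ x in 𝓝 x₀, ∀ i, ContDiffAt ℝ ∞ (η i ∘ r) x ∧
      ∀ v, fderiv ℝ (η i ∘ r) x v = fderiv ℝ (η i) (r x) (fderiv ℝ r x v) := by
    filter_upwards [hs, hrt.eventually hη] with x h1 h2 i
    refine ⟨(h2 i).comp x h1.2, fun v => ?_⟩
    rw [fderiv_comp x ((h2 i).differentiableAt (by simp)) (h1.2.differentiableAt (by simp))]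
    rfl
  have hcomm : ∀ᶠ x in 𝓝 x₀, ∀ a i, poissonBracket (Q a) (η i ∘ r) x = 0 := by
    filter_upwards [hQη', hev] with x h1 h2 a i
    rw [← fderiv_apply_hamVec, (h1 i).2, h2.2.2.2.1 a, map_zero]
  -- On the surface `Q = 0` the differentials of `η ∘ r` and of `η` agree where `η` vanishes.
  have hfd : ∀ᶠ x in 𝓝 x₀, (∀ a, Q a x = 0) → (∀ i, η i x = 0) →
      (∀ i, fderiv ℝ (η i ∘ r) x = fderiv ℝ (η i) x) ∧ bracketMatrix η η x = 0 := by
    filter_upwards [hQη', hev, hfc] with x h1 h2 h3 hq he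
    obtain ⟨k1, k2, k3⟩ := h3 (fun a => hq (Sum.inl a)) (fun a => hq (Sum.inr a)) he
    refine ⟨fun i => ContinuousLinearMap.ext fun v => ?_, k3⟩
    have k4 : ∀ a, fderiv ℝ (η i) x (hamVec (Q a) x) = 0 := by
      rintro (a | a) <;> rw [fderiv_apply_hamVec]
      exacts [congrFun (congrFun k1 a) i, congrFun (congrFun k2 a) i]
    rw [(h1 i).2, (h2.2.1 hq).2, h2.2.2.2.2 hq, map_add, map_sum]
    simp [k4]
  -- The straightening times are the functions `P` and `-S`, by uniqueness along the flows.
  have hτP : ∀ᶠ x in 𝓝 x₀, ∀ a, τ (Sum.inr a) x = P a x ∧ τ (Sum.inl a) x = -S a x := by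
    have hW : ∀ᶠ x in 𝓝 x₀, (∀ a, ContDiffAt ℝ ∞ (Q a) x) ∧ (∀ a, ContDiffAt ℝ ∞ (τ a) x) ∧
        bracketMatrix Q τ x = -1 ∧ bracketMatrix Q Q x = C := by
      filter_upwards [hQ, hs, hev, hQQ] with x h1 h2 h3 h4 using ⟨h1, h2.1, h3.2.2.1, h4⟩
    filter_upwards [hpath _ hW, hev, hrt.eventually hev] with x ⟨γ, hγ0, hγ1, hγ⟩ h2 h3 a
    have hQr := h2.1
    have hτr := (h3.2.1 hQr).1
    have key : ∀ (b b' : A ⊕ A) (ε : ℝ), (∀ a, -(1 : Matrix (A ⊕ A) (A ⊕ A) ℝ) a b = ε * C a b') →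
        τ b x = ε * Q b' x := by
      intro b b' ε hε
      have h4 := eq_of_path (Q := Q) (g := fun x => τ b x - ε * Q b' x) (c := fun a => τ a x)
        (γ := γ) (fun s hs' => ?_) 1 ⟨zero_le_one, le_rfl⟩
      · simp only [hγ0, hγ1, hτr, hQr] at h4
        linarith
      · obtain ⟨⟨k1, k2, k3, k4⟩, k5⟩ := hγ s hs'
        have d1 := (k2 b).differentiableAt (n := ∞) (by simp)
        have d2 := (k1 b').differentiableAt (n := ∞) (by simp)
        refine ⟨d1.sub (d2.const_mul ε), fun a => ?_, k5⟩
        have h5 : HasFDerivAt (fun x => τ b x - ε * Q b' x) _ (γ s) :=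
          d1.hasFDerivAt.sub (d2.hasFDerivAt.const_mul ε)
        rw [h5.fderiv]
        simp only [_root_.sub_apply, _root_.smul_apply, fderiv_apply_hamVec, smul_eq_mul]
        have e1 := congrFun (congrFun k3 a) b
        have e2 := congrFun (congrFun k4 a) b'
        simp only [bracketMatrix, Matrix.of_apply] at e1 e2
        rw [e1, e2, Matrix.neg_apply, hε a, sub_self]
    refine ⟨?_, ?_⟩
    · rw [key (Sum.inr a) (Sum.inl a) 1 ?_]
      · simp [hQdef]
      · rintro (b | b) <;> by_cases h : b = a <;> simp [hC, Matrix.one_apply, h]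
    · rw [key (Sum.inl a) (Sum.inr a) (-1) ?_]
      · simp [hQdef]
      · rintro (b | b) <;> by_cases h : b = a <;> simp [hC, Matrix.one_apply, h]
  have hreg' : ∀ᶠ x in 𝓝 x₀, (∀ i, (η i ∘ r) x = 0) →
      LinearIndependent ℝ fun i => fderiv ℝ (η i ∘ r) x := by
    by_cases h0 : ∀ i, η i x₀ = 0
    · have h1 : ContinuousAt (fun x => fun i => fderiv ℝ (η i ∘ r) x) x₀ :=
        continuousAt_pi.2 fun i => (hQη'.self_of_nhds i).1.fderiv_infty.continuousAt
      have h2 : (fun i => fderiv ℝ (η i ∘ r) x₀)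
          ∈ {f : I → (PhaseSpace ι →L[ℝ] ℝ) | LinearIndependent ℝ f} := by
        have : (fun i => fderiv ℝ (η i ∘ r) x₀) = fun i => fderiv ℝ (η i) x₀ :=
          funext (hfd.self_of_nhds hQ₀ h0).1
        rw [Set.mem_ofPred_eq, this]
        exact hreg h0
      have : Fintype I := Fintype.ofFinite I
      exact (h1.eventually_mem (isOpen_setOfPred_linearIndependent.mem_nhds h2)).mono
        fun x hx _ => hx
    · push Not at h0
      obtain ⟨i, hi⟩ := h0
      have h1 : ContinuousAt (η i ∘ r) x₀ := (hQη'.self_of_nhds i).1.continuousAt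
      filter_upwards [h1.eventually_ne (by simpa [hr0] using hi)] with x hx h
      exact absurd (h i) hx
  -- The brackets `{η', η'}` are constant along the flows, and on the surface `Q = 0` they agree
  -- with `{η, η}` where `η` vanishes.
  refine ⟨fun i => η i ∘ r, ?_⟩
  have hW : ∀ᶠ x in 𝓝 x₀, (∀ i j, DifferentiableAt ℝ (poissonBracket (η i ∘ r) (η j ∘ r)) x ∧
      ∀ a, fderiv ℝ (poissonBracket (η i ∘ r) (η j ∘ r)) x (hamVec (Q a) x) = 0) := by
    filter_upwards [hQη', hcomm.eventually_nhds, hQ] with x h1 h2 h3 i j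
    exact ⟨(contDiffAt_poissonBracket (h1 i).1 (h1 j).1).differentiableAt (by simp), fun a =>
      fderiv_poissonBracket_hamVec_eq_zero (h3 a) (h1 i).1 (h1 j).1 (h2.mono fun y hy => hy a i)
        (h2.mono fun y hy => hy a j)⟩
  filter_upwards [hQη', hcomm, hreg', hpath _ hW, hpath _ hWP, hpath _ hWS, hev, hτP,
    hrt.eventually hfd] with x h1 h2 h3 ⟨γ, hγ0, hγ1, hγ⟩ h5 h6 h7 h8 h9
  refine ⟨fun i => (h1 i).1, ?_, ?_, fun h0 => ⟨h3 h0, ?_⟩, fun h0 => ?_, fun h0 => ?_⟩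
  · ext a i; exact h2 (Sum.inl a) i
  · ext a i; exact h2 (Sum.inr a) i
  · obtain ⟨k1, k2⟩ := h9 h7.1 h0
    ext i j
    have := eq_of_path (fun s hs' => ⟨((hγ s hs').1 i j).1, ((hγ s hs').1 i j).2, (hγ s hs').2⟩) 1
      ⟨zero_le_one, le_rfl⟩
    rw [hγ0, hγ1] at this
    rw [bracketMatrix, Matrix.of_apply, ← this, poissonBracket_eq_poissonForm, k1, k1]
    exact congrFun (congrFun k2 i) j
  -- On `P = 0` the times along the flows of `S` vanish: the retraction follows those of `P` alone.
  · obtain ⟨γ, hγ0, hγ1, hγ⟩ := h5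
    have := hPinv γ (fun a => τ (Sum.inl a) x) (by rwa [hγ0]) fun s hs' => by
      refine ⟨(hγ s hs').1, ?_⟩
      simpa [hQdef, (h8 _).1, h0] using (hγ s hs').2
    rw [hγ0, hγ1] at this
    exact this.symm
  · obtain ⟨γ, hγ0, hγ1, hγ⟩ := h6
    have := hSinv γ (fun a => τ (Sum.inr a) x) (by rwa [hγ0]) fun s hs' => by
      refine ⟨(hγ s hs').1, ?_⟩
      simpa [hQdef, (h8 _).2, h0] using (hγ s hs').2
    rw [hγ0, hγ1] at this
    exact this.symm

end Untraded

/-! ### Changes of basis of first class systems and their Dirac brackets -/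

section Dressing

theorem contDiffOn_matrix_det {E B : Type*} [NormedAddCommGroup E] [NormedSpace ℝ E] [Fintype B]
    [DecidableEq B] {M : E → Matrix B B ℝ} {s : Set E}
    (hM : ∀ a b, ContDiffOn ℝ ∞ (fun x => M x a b) s) : ContDiffOn ℝ ∞ (fun x => (M x).det) s := by
  simp only [Matrix.det_apply']
  exact ContDiffOn.sum fun σ _ => contDiffOn_const.mul (contDiffOn_prod fun i _ => hM _ _)

theorem contDiffOn_matrix_inv {E B : Type*} [NormedAddCommGroup E] [NormedSpace ℝ E] [Fintype B]
    [DecidableEq B] {M : E → Matrix B B ℝ} {s : Set E}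
    (hM : ∀ a b, ContDiffOn ℝ ∞ (fun x => M x a b) s) (hdet : ∀ x ∈ s, IsUnit (M x).det) (a b : B) :
    ContDiffOn ℝ ∞ (fun x => (M x)⁻¹ a b) s := by
  simp only [Matrix.inv_def, Matrix.smul_apply, Ring.inverse_eq_inv', smul_eq_mul,
    Matrix.adjugate_apply]
  refine ((contDiffOn_matrix_det hM).inv fun x hx => (hdet x hx).ne_zero).mul
    (contDiffOn_matrix_det fun i j => ?_)
  by_cases h : i = b
  · subst h; simpa using contDiffOn_const
  · simpa [Matrix.updateRow_apply, h] using hM i j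

/-- An invertible matrix maps linearly independent families to linearly independent families. -/
theorem LinearIndependent.sum_smul {E B : Type*} [AddCommGroup E] [Module ℝ E] [Fintype B]
    [DecidableEq B] {v : B → E} (hv : LinearIndependent ℝ v) {D : Matrix B B ℝ}
    (hD : IsUnit D.det) : LinearIndependent ℝ fun a => ∑ b, D a b • v b := by
  rw [Fintype.linearIndependent_iff] at hv ⊢
  intro g hg
  have h1 : ∑ b, (Matrix.vecMul g D) b • v b = 0 := by
    rw [← hg]
    simp only [Matrix.vecMul, dotProduct, Finset.sum_smul, Finset.smul_sum, smul_smul]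
    exact Finset.sum_comm
  have h2 : Matrix.vecMul g D = 0 := funext (hv _ h1)
  exact congrFun (Matrix.eq_zero_of_vecMul_eq_zero hD.ne_zero h2)

variable {ι A B I : Type*} [Fintype ι] [DecidableEq ι] [Fintype B] [DecidableEq B]
  [Fintype A] [DecidableEq A]

theorem IsFirstClassSystem.congr {U : Set (PhaseSpace ι)} (hU : IsOpen U)
    {c d : I → PhaseSpace ι → ℝ} (hc : IsFirstClassSystem U c) (h : ∀ x ∈ U, ∀ a, d a x = c a x) :
    IsFirstClassSystem U d := by
  have hs : ∀ x ∈ constraintSurface U d, x ∈ constraintSurface U c := fun x hx =>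
    ⟨hx.1, fun a => by rw [← h x hx.1, hx.2]⟩
  have hf : ∀ x ∈ U, ∀ a, d a =ᶠ[𝓝 x] c a := fun x hx a =>
    Filter.mem_of_superset (hU.mem_nhds hx) fun y hy => h y hy a
  refine ⟨fun a => (hc.smooth a).congr fun x hx => h x hx a, fun x hx => ?_, fun x hx a b => ?_⟩
  · simpa only [(hf x hx.1 _).fderiv_eq] using hc.regular_irreducible x (hs x hx)
  · simpa only [poissonBracket_eq_poissonForm, (hf x hx.1 _).fderiv_eq]
      using hc.first_class x (hs x hx) a b

theorem forall_dressed_eq_zero_iff {D : PhaseSpace ι → Matrix B B ℝ} {c : B → PhaseSpace ι → ℝ}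
    {x : PhaseSpace ι} (hD : IsUnit (D x).det) :
    (∀ a, dressed D c a x = 0) ↔ ∀ a, c a x = 0 := by
  refine ⟨fun h => ?_, fun h a => by simp [dressed, h]⟩
  exact congrFun (Matrix.eq_zero_of_mulVec_eq_zero hD.ne_zero (v := fun a => c a x) (funext h))

theorem IsFirstClassSystem.dressed {U : Set (PhaseSpace ι)} (hU : IsOpen U)
    {c : B → PhaseSpace ι → ℝ} (hc : IsFirstClassSystem U c) {D : PhaseSpace ι → Matrix B B ℝ}
    (hD : ∀ a b, ContDiffOn ℝ ∞ (fun x => D x a b) U) (hdet : ∀ x ∈ U, IsUnit (D x).det) :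
    IsFirstClassSystem U (dressed D c) := by
  have hs : ∀ x ∈ constraintSurface U (_root_.dressed D c), x ∈ constraintSurface U c :=
    fun x hx => ⟨hx.1, (forall_dressed_eq_zero_iff (hdet x hx.1)).1 hx.2⟩
  have hdD : ∀ x ∈ U, ∀ a b, DifferentiableAt ℝ (fun x => D x a b) x := fun x hx a b =>
    ((hD a b).contDiffAt (hU.mem_nhds hx)).differentiableAt (by simp)
  have hdc : ∀ x ∈ U, ∀ a, DifferentiableAt ℝ (c a) x := fun x hx a =>
    ((hc.smooth a).contDiffAt (hU.mem_nhds hx)).differentiableAt (by simp)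
  refine ⟨fun a => ContDiffOn.sum fun b _ => (hD a b).mul (hc.smooth b), fun x hx => ?_,
    fun x hx a b => ?_⟩
  · simp only [fderiv_dressed (hdD x hx.1) (hdc x hx.1) (hs x hx).2]
    exact (hc.regular_irreducible x (hs x hx)).sum_smul (hdet x hx.1)
  · have h0 : bracketMatrix c c x = 0 := by
      ext a b; exact hc.first_class x (hs x hx) a b
    have h1 : bracketMatrix (_root_.dressed D c) (_root_.dressed D c) x = 0 := by
      rw [bracketMatrix_dressed_left (hdD x hx.1) (hdc x hx.1) (hs x hx).2,
        bracketMatrix_dressed_right (hdD x hx.1) (hdc x hx.1) (hs x hx).2, h0, zero_mul, mul_zero]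
    exact congrFun (congrFun h1 a) b

theorem dressed_fromBlocks {D : PhaseSpace ι → Matrix A A ℝ} {D' : PhaseSpace ι → Matrix B B ℝ}
    (c : A → PhaseSpace ι → ℝ) (d : B → PhaseSpace ι → ℝ) :
    dressed (fun x => Matrix.fromBlocks (D x) 0 0 (D' x)) (Sum.elim c d)
      = Sum.elim (dressed D c) (dressed D' d) := by
  ext (a | a) x <;> simp [dressed, Fintype.sum_sum_type]

theorem IsFirstClassSystem.sum_dressed {U : Set (PhaseSpace ι)} (hU : IsOpen U)
    {c : A → PhaseSpace ι → ℝ} {d : B → PhaseSpace ι → ℝ}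
    (hc : IsFirstClassSystem U (Sum.elim c d)) {D : PhaseSpace ι → Matrix A A ℝ}
    {D' : PhaseSpace ι → Matrix B B ℝ}
    (hD : ∀ a b, ContDiffOn ℝ ∞ (fun x => D x a b) U) (hdet : ∀ x ∈ U, IsUnit (D x).det)
    (hD' : ∀ a b, ContDiffOn ℝ ∞ (fun x => D' x a b) U) (hdet' : ∀ x ∈ U, IsUnit (D' x).det) :
    IsFirstClassSystem U (Sum.elim (_root_.dressed D c) (_root_.dressed D' d)) := by
  have := hc.dressed hU (D := fun x => Matrix.fromBlocks (D x) 0 0 (D' x)) ?_ fun x hx => ?_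
  · rwa [dressed_fromBlocks] at this
  · rintro (a | a) (b | b)
    exacts [hD a b, contDiffOn_const, contDiffOn_const, hD' a b]
  · rw [Matrix.det_fromBlocks_zero₂₁]
    exact (hdet x hx).mul (hdet' x hx)

theorem dressed_one (d : B → PhaseSpace ι → ℝ) : dressed (fun _ => 1) d = d := by
  ext a x; simp [dressed, Matrix.one_apply]

theorem bracketMatrix_sumElim {ψ L : A → PhaseSpace ι → ℝ} {x : PhaseSpace ι} {K : Matrix A A ℝ}
    (hψ : bracketMatrix ψ ψ x = 0) (hL : bracketMatrix L L x = 0) (hK : bracketMatrix ψ L x = K) :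
    bracketMatrix (Sum.elim ψ L) (Sum.elim ψ L) x = Matrix.fromBlocks 0 K (-K.transpose) 0 := by
  have h4 : bracketMatrix L ψ x = -K.transpose := by rw [bracketMatrix_antisymm, hK]
  ext (a | a) (b | b)
  exacts [congrFun (congrFun hψ a) b, congrFun (congrFun hK a) b, congrFun (congrFun h4 a) b,
    congrFun (congrFun hL a) b]

theorem fromBlocks_mul_inv_eq_one {K : Matrix A A ℝ} (hK : IsUnit K.det) :
    Matrix.fromBlocks 0 K (-K.transpose) 0
      * Matrix.fromBlocks 0 (-(K⁻¹).transpose) K⁻¹ 0 = 1 := by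
  rw [Matrix.fromBlocks_multiply]
  simp [Matrix.mul_nonsing_inv _ hK, ← Matrix.transpose_mul, Matrix.nonsing_inv_mul _ hK]

theorem diracBracket_comp_equiv (e : A ≃ B) (ψ : B → PhaseSpace ι → ℝ) (f g : PhaseSpace ι → ℝ)
    (x : PhaseSpace ι) : diracBracket (fun a => ψ (e a)) f g x = diracBracket ψ f g x := by
  have h1 : bracketMatrix (fun a => ψ (e a)) (fun a => ψ (e a)) x
      = (bracketMatrix ψ ψ x).submatrix e e := rfl
  simp only [diracBracket, h1, Matrix.inv_submatrix_equiv, Matrix.submatrix_apply]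
  rw [← e.sum_comp]
  congr 1
  refine Finset.sum_congr rfl fun a _ => ?_
  rw [← e.sum_comp]

/-- The Dirac bracket of canonical pairs `ψ`, `θ` does not change when `θ` is replaced by an
equivalent set `L`. -/
theorem diracBracket_sumElim {ψ L θ : A → PhaseSpace ι → ℝ} {x : PhaseSpace ι} {D : Matrix A A ℝ}
    (hD : IsUnit D.det) (hL : ∀ a, fderiv ℝ (L a) x = ∑ b, D a b • fderiv ℝ (θ b) x)
    (hψ : bracketMatrix ψ ψ x = 0) (hθ : bracketMatrix θ θ x = 0) {ε : ℝ} (hε : ε * ε = 1)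
    (hψθ : bracketMatrix ψ θ x = ε • 1) (F G : PhaseSpace ι → ℝ) :
    diracBracket (Sum.elim ψ L) F G x = poissonBracket F G x
      + ε * ∑ a, (poissonBracket F (ψ a) x * poissonBracket (θ a) G x
        - poissonBracket F (θ a) x * poissonBracket (ψ a) G x) := by
  have hr : ∀ (f : PhaseSpace ι → ℝ) a,
      poissonBracket f (L a) x = ∑ b, D a b * poissonBracket f (θ b) x := fun f a => by
    simp only [poissonBracket_eq_poissonForm, hL, poissonForm_sum_right]
  have hl : ∀ (f : PhaseSpace ι → ℝ) a,
      poissonBracket (L a) f x = ∑ b, D a b * poissonBracket (θ b) f x := fun f a => by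
    simp only [poissonBracket_eq_poissonForm, hL, poissonForm_sum_left]
  have hψθ' : ∀ a b, poissonBracket (ψ a) (θ b) x = ε * (1 : Matrix A A ℝ) a b := fun a b =>
    congrFun (congrFun hψθ a) b
  have h1 : bracketMatrix ψ L x = ε • D.transpose := by
    ext a b
    simp [bracketMatrix, hr, hψθ', Matrix.one_apply, mul_comm]
  have h2 : bracketMatrix L L x = 0 := by
    ext a b
    have h0 : ∀ a b, poissonBracket (θ a) (θ b) x = 0 := fun a b => congrFun (congrFun hθ a) b
    simp [bracketMatrix, hr, hl, h0]
  have hε0 : IsUnit (ε • D.transpose).det := by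
    rw [Matrix.det_smul, Matrix.det_transpose]
    exact ((IsUnit.of_mul_eq_one _ hε).pow _).mul hD
  have h3 : (bracketMatrix (Sum.elim ψ L) (Sum.elim ψ L) x)⁻¹
      = Matrix.fromBlocks 0 (-(ε • D⁻¹)) (ε • (D⁻¹).transpose) 0 := by
    have hinv : (ε • D.transpose)⁻¹ = ε • (D⁻¹).transpose := by
      refine Matrix.inv_eq_right_inv ?_
      rw [smul_mul_smul_comm, hε, one_smul, ← Matrix.transpose_mul, Matrix.nonsing_inv_mul _ hD,
        Matrix.transpose_one]
    rw [bracketMatrix_sumElim hψ h2 h1]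
    refine Matrix.inv_eq_right_inv ?_
    have := fromBlocks_mul_inv_eq_one hε0
    rwa [hinv, Matrix.transpose_smul, Matrix.transpose_transpose] at this
  have hθ1 : ∀ a (f : PhaseSpace ι → ℝ),
      ∑ b, D⁻¹ a b * poissonBracket (L b) f x = poissonBracket (θ a) f x := by
    intro a f
    have h5 : (fun b => poissonBracket (L b) f x)
        = D.mulVec fun b => poissonBracket (θ b) f x := funext fun b => hl f b
    have h6 : (D⁻¹.mulVec fun b => poissonBracket (L b) f x) a = poissonBracket (θ a) f x := by
      rw [h5, Matrix.mulVec_mulVec, Matrix.nonsing_inv_mul _ hD, Matrix.one_mulVec]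
    exact h6
  have hθ2 : ∀ a (f : PhaseSpace ι → ℝ),
      ∑ b, D⁻¹ a b * poissonBracket f (L b) x = poissonBracket f (θ a) x := by
    intro a f
    have := hθ1 a f
    simp only [poissonBracket_antisymm (L _), poissonBracket_antisymm (θ _), mul_neg,
      Finset.sum_neg_distrib, neg_inj] at this
    exact this
  have e1 : ∑ a, ∑ b, poissonBracket F (ψ a) x * (-(ε • D⁻¹)) a b * poissonBracket (L b) G x
      = -(ε * ∑ a, poissonBracket F (ψ a) x * poissonBracket (θ a) G x) := by
    rw [Finset.mul_sum, ← Finset.sum_neg_distrib]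
    refine Finset.sum_congr rfl fun a _ => ?_
    rw [← hθ1, Finset.mul_sum, Finset.mul_sum, ← Finset.sum_neg_distrib]
    refine Finset.sum_congr rfl fun b _ => ?_
    simp only [Matrix.neg_apply, Matrix.smul_apply, smul_eq_mul]; ring
  have e2 : ∑ a, ∑ b, poissonBracket F (L a) x * (ε • (D⁻¹).transpose) a b
        * poissonBracket (ψ b) G x
      = ε * ∑ a, poissonBracket F (θ a) x * poissonBracket (ψ a) G x := by
    rw [Finset.mul_sum, Finset.sum_comm]
    refine Finset.sum_congr rfl fun a _ => ?_
    rw [← hθ2, Finset.sum_mul, Finset.mul_sum]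
    refine Finset.sum_congr rfl fun b _ => ?_
    simp only [Matrix.transpose_apply, Matrix.smul_apply, smul_eq_mul]; ring
  simp only [diracBracket, h3, Fintype.sum_sum_type, Sum.elim_inl, Sum.elim_inr,
    Matrix.fromBlocks_apply₁₁, Matrix.fromBlocks_apply₁₂, Matrix.fromBlocks_apply₂₁,
    Matrix.fromBlocks_apply₂₂, Matrix.zero_apply, mul_zero, zero_mul, Finset.sum_const_zero,
    zero_add, add_zero, e1, e2, Finset.sum_sub_distrib]
  ring

theorem gaugeFixedTheoriesAgree {U : Set (PhaseSpace ι)} {χ σ : A → PhaseSpace ι → ℝ}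
    (η : I → PhaseSpace ι → ℝ) (hχ : IsFirstClassSystem U χ) (hσ : IsFirstClassSystem U σ)
    (hχσ : IsMaximallySymplectic U χ σ) : GaugeFixedTheoriesAgree U χ σ σ χ η := by
  have hsurf : ∀ {c d : A → PhaseSpace ι → ℝ} {x},
      x ∈ constraintSurface U (Sum.elim (Sum.elim c d) η) →
      x ∈ constraintSurface U c ∧ x ∈ constraintSurface U d ∧ ∀ i, η i x = 0 := fun h =>
    ⟨⟨h.1, fun a => h.2 (Sum.inl (Sum.inl a))⟩, ⟨h.1, fun a => h.2 (Sum.inl (Sum.inr a))⟩,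
      fun i => h.2 (Sum.inr i)⟩
  have hadm : ∀ {c d : A → PhaseSpace ι → ℝ} {x}, IsFirstClassSystem U c →
      IsFirstClassSystem U d → x ∈ constraintSurface U c → x ∈ constraintSurface U d →
      IsUnit (bracketMatrix c d x).det →
      IsUnit (bracketMatrix (Sum.elim c d) (Sum.elim c d) x).det := by
    intro c d x hc hd h1 h2 h3
    rw [bracketMatrix_sumElim (Matrix.ext fun a b => hc.first_class x h1 a b)
      (Matrix.ext fun a b => hd.first_class x h2 a b) rfl]
    exact (Matrix.isUnit_iff_isUnit_det _).1
      (IsUnit.of_mul_eq_one _ (fromBlocks_mul_inv_eq_one h3))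
  constructor
  · ext x
    simp only [constraintSurface, Set.mem_ofPred_eq, Sum.forall, Sum.elim_inl, Sum.elim_inr]
    tauto
  · intro x hx
    obtain ⟨h1, h2, -⟩ := hsurf hx
    have h3 := (hχσ x ⟨h1, h2⟩).self_of_nhds
    exact ⟨h3, hadm hχ hσ h1 h2 h3⟩
  · intro x hx
    obtain ⟨h1, h2, -⟩ := hsurf hx
    have h3 : IsUnit (bracketMatrix σ χ x).det := by
      rw [bracketMatrix_antisymm, Matrix.det_neg, Matrix.det_transpose]
      exact (isUnit_one.neg.pow _).mul (hχσ x ⟨h2, h1⟩).self_of_nhds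
    exact ⟨h3, hadm hσ hχ h1 h2 h3⟩
  · intro f g _ _ x _
    rw [← diracBracket_comp_equiv (Equiv.sumComm A A) (Sum.elim σ χ)]
    congr 1
    ext (a | a) <;> rfl

end Dressing

/-! ### The linking theory -/

section Extended

variable {ι A B I : Type*} [Fintype ι] [DecidableEq ι] [Fintype A] [DecidableEq A]

/-- The point of the extended phase space with coordinates `(q, φ; p, π)`, as a linear function of
`((q, p), φ, π)`. -/
noncomputable def extPoint : (PhaseSpace ι × (A → ℝ) × (A → ℝ)) →L[ℝ] PhaseSpace (ι ⊕ A) :=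
  LinearMap.toContinuousLinearMap
    { toFun := fun v => (Sum.elim v.1.1 v.2.1, Sum.elim v.1.2 v.2.2)
      map_add' := fun v w => by ext (a | a) <;> simp
      map_smul' := fun r v => by ext (a | a) <;> simp }

theorem extPoint_apply (v : PhaseSpace ι × (A → ℝ) × (A → ℝ)) :
    extPoint v = (Sum.elim v.1.1 v.2.1, Sum.elim v.1.2 v.2.2) := rfl

/-- `extProj` as a continuous linear map. -/
noncomputable def extProjL : PhaseSpace (ι ⊕ A) →L[ℝ] PhaseSpace ι :=
  (ContinuousLinearMap.pi fun i => ContinuousLinearMap.proj (Sum.inl i)).prodMap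
    (ContinuousLinearMap.pi fun i => ContinuousLinearMap.proj (Sum.inl i))

/-- `extPhi` as a continuous linear form. -/
noncomputable def extPhiL (a : A) : PhaseSpace (ι ⊕ A) →L[ℝ] ℝ :=
  (ContinuousLinearMap.proj (Sum.inr a)).comp (ContinuousLinearMap.fst ℝ _ _)

/-- `extPi` as a continuous linear form. -/
noncomputable def extPiL (a : A) : PhaseSpace (ι ⊕ A) →L[ℝ] ℝ :=
  (ContinuousLinearMap.proj (Sum.inr a)).comp (ContinuousLinearMap.snd ℝ _ _)

/-- The covector of the extended phase space with component `ℓ` along the original phase space and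
components `u`, `w` along `φ`, `π`. -/
noncomputable def extCovector (ℓ : PhaseSpace ι →L[ℝ] ℝ) (u w : A → ℝ) :
    PhaseSpace (ι ⊕ A) →L[ℝ] ℝ :=
  ℓ.comp extProjL + ∑ a, u a • extPhiL a + ∑ a, w a • extPiL a

theorem extCovector_extPoint (ℓ : PhaseSpace ι →L[ℝ] ℝ) (u w : A → ℝ) (x : PhaseSpace ι)
    (a b : A → ℝ) :
    extCovector ℓ u w (extPoint (x, a, b)) = ℓ x + ∑ c, u c * a c + ∑ c, w c * b c := by
  simp [extCovector, extPoint_apply, extProjL, extPhiL, extPiL]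

theorem exists_extPoint_eq (z : PhaseSpace (ι ⊕ A)) :
    z = extPoint (extProj z, fun a => extPhi a z, fun a => extPi a z) := by
  ext (a | a) <;> rfl

theorem exists_extCovector_eq (m : PhaseSpace (ι ⊕ A) →L[ℝ] ℝ) :
    ∃ (ℓ : PhaseSpace ι →L[ℝ] ℝ) (u w : A → ℝ), m = extCovector ℓ u w := by
  refine ⟨m.comp (extPoint.comp (ContinuousLinearMap.inl ℝ _ _)),
    fun a => m (extPoint (0, Pi.single a 1, 0)), fun a => m (extPoint (0, 0, Pi.single a 1)), ?_⟩
  refine ContinuousLinearMap.ext fun z => ?_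
  obtain ⟨x, a, b, rfl⟩ : ∃ (x : PhaseSpace ι) (a b : A → ℝ), z = extPoint (x, a, b) :=
    ⟨_, _, _, exists_extPoint_eq z⟩
  rw [extCovector_extPoint]
  have hdec : (x, a, b) = (x, (0 : A → ℝ), (0 : A → ℝ))
      + ∑ c, a c • ((0 : PhaseSpace ι), (Pi.single c 1 : A → ℝ), (0 : A → ℝ))
      + ∑ c, b c • ((0 : PhaseSpace ι), (0 : A → ℝ), (Pi.single c 1 : A → ℝ)) := by
    have h1 : ∀ a : A → ℝ, ∑ c, a c • (Pi.single c 1 : A → ℝ) = a := fun a =>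
      (pi_eq_sum_univ' a).symm
    refine Prod.ext ?_ (Prod.ext ?_ ?_) <;>
      simp [Prod.fst_sum, Prod.snd_sum, h1]
  conv_lhs => rw [hdec]
  simp only [map_add, map_sum, map_smul, smul_eq_mul, ContinuousLinearMap.comp_apply,
    ContinuousLinearMap.inl_apply, mul_comm]
  rfl

theorem dirQ_inl (i : ι) : (dirQ (Sum.inl i) : PhaseSpace (ι ⊕ A)) = extPoint (dirQ i, 0, 0) := by
  refine Prod.ext ?_ ?_ <;> ext (j | j) <;> simp [dirQ, extPoint_apply, Pi.single_apply]

theorem dirP_inl (i : ι) : (dirP (Sum.inl i) : PhaseSpace (ι ⊕ A)) = extPoint (dirP i, 0, 0) := by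
  refine Prod.ext ?_ ?_ <;> ext (j | j) <;> simp [dirP, extPoint_apply, Pi.single_apply]

theorem dirQ_inr (a : A) :
    (dirQ (Sum.inr a) : PhaseSpace (ι ⊕ A)) = extPoint (0, Pi.single a 1, 0) := by
  refine Prod.ext ?_ ?_ <;> ext (j | j) <;> simp [dirQ, extPoint_apply, Pi.single_apply]

theorem dirP_inr (a : A) :
    (dirP (Sum.inr a) : PhaseSpace (ι ⊕ A)) = extPoint (0, 0, Pi.single a 1) := by
  refine Prod.ext ?_ ?_ <;> ext (j | j) <;> simp [dirP, extPoint_apply, Pi.single_apply]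

theorem poissonForm_extCovector (ℓ ℓ' : PhaseSpace ι →L[ℝ] ℝ) (u w u' w' : A → ℝ) :
    poissonForm (extCovector ℓ u w) (extCovector ℓ' u' w')
      = poissonForm ℓ ℓ' + ∑ a, (u a * w' a - w a * u' a) := by
  simp only [poissonForm, Fintype.sum_sum_type, dirQ_inl, dirP_inl, dirQ_inr, dirP_inr,
    extCovector_extPoint]
  simp [Pi.single_apply]

theorem hasFDerivAt_extPhi (a : A) (z : PhaseSpace (ι ⊕ A)) :
    HasFDerivAt (extPhi a) (extCovector (0 : PhaseSpace ι →L[ℝ] ℝ) (Pi.single a 1) 0) z := by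
  have : (extCovector (0 : PhaseSpace ι →L[ℝ] ℝ) (Pi.single a 1) 0) = extPhiL a := by
    simp [extCovector, Pi.single_apply]
  rw [this]
  exact (extPhiL a).hasFDerivAt

theorem hasFDerivAt_extPi (a : A) (z : PhaseSpace (ι ⊕ A)) :
    HasFDerivAt (extPi a) (extCovector (0 : PhaseSpace ι →L[ℝ] ℝ) 0 (Pi.single a 1)) z := by
  have : (extCovector (0 : PhaseSpace ι →L[ℝ] ℝ) 0 (Pi.single a 1)) = extPiL a := by
    simp [extCovector, Pi.single_apply]
  rw [this]
  exact (extPiL a).hasFDerivAt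

theorem hasFDerivAt_comp_extProj {f : PhaseSpace ι → ℝ} {z : PhaseSpace (ι ⊕ A)}
    (hf : DifferentiableAt ℝ f (extProj z)) :
    HasFDerivAt (fun z => f (extProj z))
      (extCovector (fderiv ℝ f (extProj z)) (0 : A → ℝ) 0) z := by
  have : extCovector (fderiv ℝ f (extProj z)) (0 : A → ℝ) 0
      = (fderiv ℝ f (extProj z)).comp extProjL := by
    simp [extCovector]
  rw [this]
  exact HasFDerivAt.comp z hf.hasFDerivAt extProjL.hasFDerivAt

theorem extCovector_add (ℓ ℓ' : PhaseSpace ι →L[ℝ] ℝ) (u w u' w' : A → ℝ) :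
    extCovector ℓ u w + extCovector ℓ' u' w' = extCovector (ℓ + ℓ') (u + u') (w + w') := by
  simp only [extCovector, Pi.add_apply, add_smul, Finset.sum_add_distrib,
    ContinuousLinearMap.add_comp]
  abel

theorem extCovector_neg (ℓ : PhaseSpace ι →L[ℝ] ℝ) (u w : A → ℝ) :
    -extCovector ℓ u w = extCovector (-ℓ) (-u) (-w) := by
  refine ContinuousLinearMap.ext fun z => ?_
  rw [exists_extPoint_eq z]
  simp only [_root_.neg_apply, extCovector_extPoint, Pi.neg_apply, neg_mul, Finset.sum_neg_distrib]
  ring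

theorem hasFDerivAt_extPhi_sub {f : PhaseSpace ι → ℝ} {z : PhaseSpace (ι ⊕ A)}
    (hf : DifferentiableAt ℝ f (extProj z)) (a : A) :
    HasFDerivAt (fun z => extPhi a z - f (extProj z))
      (extCovector (-fderiv ℝ f (extProj z)) (Pi.single a 1) 0) z := by
  have := (hasFDerivAt_extPhi a z).sub (hasFDerivAt_comp_extProj hf)
  rwa [sub_eq_add_neg (extCovector _ _ _), extCovector_neg, extCovector_add, zero_add, neg_zero,
    add_zero,
    add_zero] at this

theorem hasFDerivAt_extPi_add {f : PhaseSpace ι → ℝ} {z : PhaseSpace (ι ⊕ A)}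
    (hf : DifferentiableAt ℝ f (extProj z)) (a : A) :
    HasFDerivAt (fun z => extPi a z + f (extProj z))
      (extCovector (fderiv ℝ f (extProj z)) 0 (Pi.single a 1)) z := by
  have := (hasFDerivAt_extPi a z).add (hasFDerivAt_comp_extProj hf)
  rwa [extCovector_add, zero_add, add_zero, add_zero] at this

variable {V : Set (PhaseSpace ι)}

theorem isOpen_preimage_extProj (hV : IsOpen V) :
    IsOpen (extProj ⁻¹' V : Set (PhaseSpace (ι ⊕ A))) :=
  hV.preimage (extProjL : PhaseSpace (ι ⊕ A) →L[ℝ] PhaseSpace ι).continuous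

theorem contDiffOn_comp_extProj {f : PhaseSpace ι → ℝ} (hf : ContDiffOn ℝ ∞ f V) :
    ContDiffOn ℝ ∞ (fun z : PhaseSpace (ι ⊕ A) => f (extProj z)) (extProj ⁻¹' V) :=
  hf.comp (extProjL : PhaseSpace (ι ⊕ A) →L[ℝ] PhaseSpace ι).contDiff.contDiffOn fun _ hx => hx

theorem dressed_inv_dressed {M : Matrix A A ℝ} (hM : IsUnit M.det) (v w : A → ℝ) (ε : ℝ) (a : A) :
    ∑ b, M⁻¹ a b * (v b + ε * ∑ c, M b c * w c) = ∑ b, M⁻¹ a b * v b + ε * w a := by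
  have h1 : (M⁻¹.mulVec (M.mulVec w)) a = w a := by
    rw [Matrix.mulVec_mulVec, Matrix.nonsing_inv_mul _ hM, Matrix.one_mulVec]
  simp only [mul_add, Finset.sum_add_distrib]
  rw [← h1]
  simp only [Matrix.mulVec, dotProduct, Finset.mul_sum]
  congr 1
  exact Finset.sum_congr rfl fun b _ => Finset.sum_congr rfl fun c _ => by ring

theorem linkingChi_eq_dressed {M : PhaseSpace ι → Matrix A A ℝ} {χ : A → PhaseSpace ι → ℝ}
    {z : PhaseSpace (ι ⊕ A)} (hM : IsUnit (M (extProj z)).det) (a : A) :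
    linkingChi M χ a z = dressed (fun z => (M (extProj z))⁻¹)
      (fun b z => extPhi b z - dressed M χ b (extProj z)) a z := by
  have := dressed_inv_dressed hM (fun b => extPhi b z) (fun b => χ b (extProj z)) (-1) a
  simp only [neg_one_mul, ← sub_eq_add_neg] at this
  exact this.symm

theorem linkingSigma_eq_dressed {N : PhaseSpace ι → Matrix A A ℝ} {σ : A → PhaseSpace ι → ℝ}
    {z : PhaseSpace (ι ⊕ A)} (hN : IsUnit (N (extProj z)).det) (a : A) :
    linkingSigma N σ a z = dressed (fun z => (N (extProj z))⁻¹)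
      (fun b z => extPi b z + dressed N σ b (extProj z)) a z := by
  have := dressed_inv_dressed hN (fun b => extPi b z) (fun b => σ b (extProj z)) 1 a
  simp only [one_mul] at this
  exact this.symm

/-- A criterion for phase space reduction: the gauge conditions `ψ` are canonically conjugate to
Abelian constraints `θ` equivalent to `L`. -/
theorem IsReduction.of_canonical {ι' : Type*} [Fintype ι'] [DecidableEq ι']
    {W : Set (PhaseSpace ι')} (hW : IsOpen W) {ψ L θ : A → PhaseSpace ι' → ℝ}
    {K : B → PhaseSpace ι' → ℝ} {c : B → PhaseSpace ι → ℝ} {e : PhaseSpace ι → PhaseSpace ι'}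
    {D : PhaseSpace ι' → Matrix A A ℝ} {ε : ℝ} (hε : ε * ε = 1)
    (hD : ∀ a b, ContDiffOn ℝ ∞ (fun x => D x a b) W) (hdet : ∀ x ∈ W, IsUnit (D x).det)
    (hL : ∀ z ∈ W, ∀ a, L a z = dressed D θ a z) (hθs : ∀ z ∈ W, ∀ a, DifferentiableAt ℝ (θ a) z)
    (hψ : ∀ z ∈ W, bracketMatrix ψ ψ z = 0) (hθ : ∀ z ∈ W, bracketMatrix θ θ z = 0)
    (hψθ : ∀ z ∈ W, bracketMatrix ψ θ z = ε • 1) (hinj : Set.InjOn e V)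
    (himg : e '' V = constraintSurface W (Sum.elim ψ θ))
    (hdirac : ∀ F G : PhaseSpace ι' → ℝ, ContDiffOn ℝ ∞ F W → ContDiffOn ℝ ∞ G W → ∀ x ∈ V,
      poissonBracket F G (e x) + ε * ∑ a, (poissonBracket F (ψ a) (e x)
          * poissonBracket (θ a) G (e x)
        - poissonBracket F (θ a) (e x) * poissonBracket (ψ a) G (e x))
      = poissonBracket (F ∘ e) (G ∘ e) x)
    (hfc : IsFirstClassSystem V fun a => K a ∘ e)
    (hsurf : constraintSurface V (fun a => K a ∘ e) = constraintSurface V c) :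
    IsReduction W ψ L K V c e := by
  have hmem : ∀ x ∈ V, e x ∈ W ∧ ∀ a, θ a (e x) = 0 := fun x hx => by
    have : e x ∈ constraintSurface W (Sum.elim ψ θ) := himg ▸ Set.mem_image_of_mem e hx
    exact ⟨this.1, fun a => this.2 (Sum.inr a)⟩
  have hfL : ∀ z ∈ W, ∀ a, L a =ᶠ[𝓝 z] dressed D θ a := fun z hz a =>
    Filter.mem_of_superset (hW.mem_nhds hz) fun y hy => hL y hy a
  have hDd : ∀ z ∈ W, ∀ a b, DifferentiableAt ℝ (fun x => D x a b) z := fun z hz a b =>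
    ((hD a b).contDiffAt (hW.mem_nhds hz)).differentiableAt (by simp)
  refine ⟨hinj, ?_, fun x hx => ?_, fun F G hF hG x hx => ?_, hfc, hsurf⟩
  · rw [himg]
    ext z
    simp only [constraintSurface, Set.mem_ofPred_eq, Sum.forall, Sum.elim_inl, Sum.elim_inr]
    refine and_congr_right fun hz => and_congr_right fun _ => ?_
    simp only [hL z hz]
    exact (forall_dressed_eq_zero_iff (hdet z hz)).symm
  · obtain ⟨h1, h2⟩ := hmem x hx
    rw [bracketMatrix_congr (fun a => Filter.EventuallyEq.rfl) (hfL _ h1),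
      bracketMatrix_dressed_right (hDd _ h1) (hθs _ h1) h2, hψθ _ h1, smul_mul_assoc, one_mul,
      Matrix.det_smul, Matrix.det_transpose]
    exact ((IsUnit.of_mul_eq_one _ hε).pow _).mul (hdet _ h1)
  · obtain ⟨h1, h2⟩ := hmem x hx
    rw [diracBracket_sumElim (hdet _ h1) (fun a => ?_) (hψ _ h1) (hθ _ h1) hε (hψθ _ h1),
      hdirac F G hF hG x hx]
    rw [(hfL _ h1 a).fderiv_eq, fderiv_dressed (hDd _ h1) (hθs _ h1) h2]

/-- A function pulled back along `x ↦ (x, P x, S x)`. -/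
theorem fderiv_comp_extPoint {F : PhaseSpace (ι ⊕ A) → ℝ} {P S : A → PhaseSpace ι → ℝ}
    {x : PhaseSpace ι} {ℓ : PhaseSpace ι →L[ℝ] ℝ} {u w : A → ℝ}
    (hP : ∀ a, DifferentiableAt ℝ (P a) x) (hS : ∀ a, DifferentiableAt ℝ (S a) x)
    (hF : DifferentiableAt ℝ F (extPoint (x, fun a => P a x, fun a => S a x)))
    (hm : fderiv ℝ F (extPoint (x, fun a => P a x, fun a => S a x)) = extCovector ℓ u w) :
    fderiv ℝ (fun x => F (extPoint (x, fun a => P a x, fun a => S a x))) x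
      = ℓ + ∑ a, u a • fderiv ℝ (P a) x + ∑ a, w a • fderiv ℝ (S a) x := by
  have h1 : HasFDerivAt (fun x => (x, (fun a => P a x), fun a => S a x))
      ((ContinuousLinearMap.id ℝ (PhaseSpace ι)).prod
        ((ContinuousLinearMap.pi fun a => fderiv ℝ (P a) x).prod
          (ContinuousLinearMap.pi fun a => fderiv ℝ (S a) x))) x :=
    (hasFDerivAt_id x).prodMk ((hasFDerivAt_pi.2 fun a => (hP a).hasFDerivAt).prodMk
      (hasFDerivAt_pi.2 fun a => (hS a).hasFDerivAt))
  have h2 := hF.hasFDerivAt.comp x ((extPoint (ι := ι) (A := A)).hasFDerivAt.comp x h1)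
  have h3 := h2.fderiv
  rw [hm] at h3
  refine h3.trans ?_
  ext v <;>
  simp [extCovector_extPoint]

end Extended

section Linking

variable {ι A I : Type*} [Fintype ι] [DecidableEq ι] [Fintype A] [DecidableEq A] [Fintype I]
  [DecidableEq I]

theorem poissonForm_add_sum {T : A → PhaseSpace ι →L[ℝ] ℝ} (hT : ∀ a b, poissonForm (T a) (T b) = 0)
    (ℓ ℓ' : PhaseSpace ι →L[ℝ] ℝ) (w w' : A → ℝ) :
    poissonForm (ℓ + ∑ a, w a • T a) (ℓ' + ∑ a, w' a • T a) = poissonForm ℓ ℓ'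
      + ∑ a, (w' a * poissonForm ℓ (T a) + w a * poissonForm (T a) ℓ') := by
  have hadd : ∀ ℓ m m' : PhaseSpace ι →L[ℝ] ℝ,
      poissonForm ℓ (m + m') = poissonForm ℓ m + poissonForm ℓ m' ∧
      poissonForm (m + m') ℓ = poissonForm m ℓ + poissonForm m' ℓ := fun ℓ m m' => by
    constructor <;> simp only [← apply_sharp] <;> simp
  rw [(hadd _ _ _).1, (hadd _ _ _).2, (hadd _ _ _).2, poissonForm_sum_left, poissonForm_sum_right,
    poissonForm_sum_left]
  simp only [poissonForm_sum_right, hT, mul_zero, Finset.sum_const_zero, Finset.sum_add_distrib]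
  ring

/-- Abelian functions `P` and commuting first class functions `η'` form a first class system when
the `P` are conjugate to functions `S` that commute with `η'`. -/
theorem isFirstClassSystem_sumElim {V : Set (PhaseSpace ι)} {P S : A → PhaseSpace ι → ℝ}
    {η' : I → PhaseSpace ι → ℝ} {ε : ℝ} (hε : ε * ε = 1) (hP : ∀ a, ContDiffOn ℝ ∞ (P a) V)
    (hη' : ∀ i, ContDiffOn ℝ ∞ (η' i) V) (hPP : ∀ x ∈ V, bracketMatrix P P x = 0)
    (hSP : ∀ x ∈ V, bracketMatrix S P x = ε • 1)
    (hPη : ∀ x ∈ V, bracketMatrix P η' x = 0) (hSη : ∀ x ∈ V, bracketMatrix S η' x = 0)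
    (hreg : ∀ x ∈ V, (∀ i, η' i x = 0) →
      (LinearIndependent ℝ fun i => fderiv ℝ (η' i) x) ∧ bracketMatrix η' η' x = 0) :
    IsFirstClassSystem V (Sum.elim P η') := by
  refine ⟨?_, fun x hx => ?_, fun x hx => ?_⟩
  · rintro (a | i)
    exacts [hP a, hη' i]
  · obtain ⟨h1, -⟩ := hreg x hx.1 fun i => hx.2 (Sum.inr i)
    rw [Fintype.linearIndependent_iff] at h1 ⊢
    intro g hg
    simp only [Fintype.sum_sum_type, Sum.elim_inl, Sum.elim_inr] at hg
    have h2 : ∀ a, g (Sum.inl a) = 0 := fun a => by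
      have h3 := DFunLike.congr_fun hg (hamVec (S a) x)
      have h4 : ∀ b, poissonBracket (S a) (P b) x = ε * (1 : Matrix A A ℝ) a b := fun b =>
        congrFun (congrFun (hSP x hx.1) a) b
      have h5 : ∀ i, poissonBracket (S a) (η' i) x = 0 := fun i =>
        congrFun (congrFun (hSη x hx.1) a) i
      simp [fderiv_apply_hamVec, h4, h5, Matrix.one_apply] at h3
      rcases h3 with h3 | h3
      · exact h3
      · simp [h3] at hε
    rintro (a | i)
    · exact h2 a
    · refine h1 (fun i => g (Sum.inr i)) ?_ i
      simpa [h2] using hg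
  · have h1 := (hreg x hx.1 fun i => hx.2 (Sum.inr i)).2
    rintro (a | i) (b | j)
    · exact congrFun (congrFun (hPP x hx.1) a) b
    · exact congrFun (congrFun (hPη x hx.1) a) j
    · rw [Sum.elim_inr, Sum.elim_inl, poissonBracket_antisymm, neg_eq_zero]
      exact congrFun (congrFun (hPη x hx.1) b) i
    · exact congrFun (congrFun h1 i) j

/-- Canonically conjugate Abelian sets `M χ` and `N σ` together with functions `η'` commuting with
both define a linking theory. Since `M⁻¹ φ - χ = M⁻¹ (φ - M χ)` and `N⁻¹ π + σ = N⁻¹ (π + N σ)`,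
the linking constraints are equivalent to the commuting functions `φ - M χ`, `π + N σ`. -/
theorem isLinkingTheory_of_commuting {V : Set (PhaseSpace ι)} (hV : IsOpen V)
    {χ σ : A → PhaseSpace ι → ℝ} {η η' : I → PhaseSpace ι → ℝ} {M N : PhaseSpace ι → Matrix A A ℝ}
    (hχ : ∀ a, ContDiffOn ℝ ∞ (χ a) V) (hσ : ∀ a, ContDiffOn ℝ ∞ (σ a) V)
    (hM : ∀ a b, ContDiffOn ℝ ∞ (fun x => M x a b) V)
    (hN : ∀ a b, ContDiffOn ℝ ∞ (fun x => N x a b) V)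
    (hMdet : ∀ x ∈ V, IsUnit (M x).det) (hNdet : ∀ x ∈ V, IsUnit (N x).det)
    (hPP : ∀ x ∈ V, bracketMatrix (dressed M χ) (dressed M χ) x = 0)
    (hSS : ∀ x ∈ V, bracketMatrix (dressed N σ) (dressed N σ) x = 0)
    (hPS : ∀ x ∈ V, bracketMatrix (dressed M χ) (dressed N σ) x = 1)
    (hη' : ∀ i, ContDiffOn ℝ ∞ (η' i) V)
    (hPη : ∀ x ∈ V, bracketMatrix (dressed M χ) η' x = 0)
    (hSη : ∀ x ∈ V, bracketMatrix (dressed N σ) η' x = 0)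
    (hreg : ∀ x ∈ V, (∀ i, η' i x = 0) →
      (LinearIndependent ℝ fun i => fderiv ℝ (η' i) x) ∧ bracketMatrix η' η' x = 0)
    (hηP : ∀ x ∈ V, (∀ a, χ a x = 0) → ((∀ i, η' i x = 0) ↔ ∀ i, η i x = 0))
    (hηS : ∀ x ∈ V, (∀ a, σ a x = 0) → ((∀ i, η' i x = 0) ↔ ∀ i, η i x = 0)) :
    IsLinkingTheory V χ σ η η' M N := by
  set P := dressed M χ with hPdef
  set S := dressed N σ with hSdef
  have hP : ∀ a, ContDiffOn ℝ ∞ (P a) V := fun a =>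
    ContDiffOn.sum fun b _ => (hM a b).mul (hχ b)
  have hS : ∀ a, ContDiffOn ℝ ∞ (S a) V := fun a =>
    ContDiffOn.sum fun b _ => (hN a b).mul (hσ b)
  have hdiff : ∀ {f : PhaseSpace ι → ℝ}, ContDiffOn ℝ ∞ f V → ∀ x ∈ V, DifferentiableAt ℝ f x :=
    fun hf x hx => (hf.contDiffAt (hV.mem_nhds hx)).differentiableAt (by simp)
  set W : Set (PhaseSpace (ι ⊕ A)) := extProj ⁻¹' V with hWdef
  have hW : IsOpen W := isOpen_preimage_extProj hV
  have hM' : ∀ a b, ContDiffOn ℝ ∞ (fun x => (M x)⁻¹ a b) V := contDiffOn_matrix_inv hM hMdet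
  have hN' : ∀ a b, ContDiffOn ℝ ∞ (fun x => (N x)⁻¹ a b) V := contDiffOn_matrix_inv hN hNdet
  have hM'det : ∀ x ∈ V, IsUnit ((M x)⁻¹).det := fun x hx =>
    Matrix.isUnit_nonsing_inv_det _ (hMdet x hx)
  have hN'det : ∀ x ∈ V, IsUnit ((N x)⁻¹).det := fun x hx =>
    Matrix.isUnit_nonsing_inv_det _ (hNdet x hx)
  set θχ : A → PhaseSpace (ι ⊕ A) → ℝ := fun a z => extPhi a z - P a (extProj z) with hθχ
  set θσ : A → PhaseSpace (ι ⊕ A) → ℝ := fun a z => extPi a z + S a (extProj z) with hθσ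
  have dχ : ∀ z ∈ W, ∀ a, HasFDerivAt (θχ a)
      (extCovector (-fderiv ℝ (P a) (extProj z)) (Pi.single a 1) 0) z := fun z hz a =>
    hasFDerivAt_extPhi_sub (hdiff (hP a) _ hz) a
  have dσ : ∀ z ∈ W, ∀ a, HasFDerivAt (θσ a)
      (extCovector (fderiv ℝ (S a) (extProj z)) 0 (Pi.single a 1)) z := fun z hz a =>
    hasFDerivAt_extPi_add (hdiff (hS a) _ hz) a
  have dη : ∀ z ∈ W, ∀ i, HasFDerivAt (fun z : PhaseSpace (ι ⊕ A) => η' i (extProj z))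
      (extCovector (fderiv ℝ (η' i) (extProj z)) 0 0) z := fun z hz i =>
    hasFDerivAt_comp_extProj (hdiff (hη' i) _ hz)
  have hneg : ∀ ℓ m : PhaseSpace ι →L[ℝ] ℝ, poissonForm (-ℓ) m = -poissonForm ℓ m ∧
      poissonForm ℓ (-m) = -poissonForm ℓ m := by
    intro ℓ m
    constructor <;> simp only [← apply_sharp] <;> simp
  have hzero : ∀ m : PhaseSpace ι →L[ℝ] ℝ, poissonForm 0 m = 0 ∧ poissonForm m 0 = 0 := by
    intro m
    constructor <;> simp only [← apply_sharp] <;> simp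
  have bPP : ∀ x ∈ V, ∀ a b, poissonForm (fderiv ℝ (P a) x) (fderiv ℝ (P b) x) = 0 :=
    fun x hx a b => congrFun (congrFun (hPP x hx) a) b
  have bSS : ∀ x ∈ V, ∀ a b, poissonForm (fderiv ℝ (S a) x) (fderiv ℝ (S b) x) = 0 :=
    fun x hx a b => congrFun (congrFun (hSS x hx) a) b
  have bPS : ∀ x ∈ V, ∀ a b, poissonForm (fderiv ℝ (P a) x) (fderiv ℝ (S b) x)
      = (1 : Matrix A A ℝ) a b := fun x hx a b => congrFun (congrFun (hPS x hx) a) b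
  have bPη : ∀ x ∈ V, ∀ a i, poissonForm (fderiv ℝ (P a) x) (fderiv ℝ (η' i) x) = 0 :=
    fun x hx a b => congrFun (congrFun (hPη x hx) a) b
  have bSη : ∀ x ∈ V, ∀ a i, poissonForm (fderiv ℝ (S a) x) (fderiv ℝ (η' i) x) = 0 :=
    fun x hx a b => congrFun (congrFun (hSη x hx) a) b
  have hP0 : ∀ x ∈ V, (∀ a, P a x = 0) ↔ ∀ a, χ a x = 0 := fun x hx =>
    forall_dressed_eq_zero_iff (hMdet x hx)
  have hS0 : ∀ x ∈ V, (∀ a, S a x = 0) ↔ ∀ a, σ a x = 0 := fun x hx =>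
    forall_dressed_eq_zero_iff (hNdet x hx)
  have cχχ : ∀ z ∈ W, bracketMatrix θχ θχ z = 0 := fun z hz => by
    ext a b
    simp [bracketMatrix, poissonBracket_eq_poissonForm, (dχ z hz _).fderiv,
      poissonForm_extCovector, hneg, bPP _ hz]
  have cσσ : ∀ z ∈ W, bracketMatrix θσ θσ z = 0 := fun z hz => by
    ext a b
    simp [bracketMatrix, poissonBracket_eq_poissonForm, (dσ z hz _).fderiv,
      poissonForm_extCovector, bSS _ hz]
  have cχσ : ∀ z ∈ W, bracketMatrix θχ θσ z = 0 := fun z hz => by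
    ext a b
    simp [bracketMatrix, poissonBracket_eq_poissonForm, (dσ z hz _).fderiv, (dχ z hz _).fderiv,
      poissonForm_extCovector, hneg, bPS _ hz, Matrix.one_apply, Pi.single_apply]
    simp [eq_comm]
  have cχη : ∀ z ∈ W, ∀ a i, poissonBracket (θχ a) (fun z => η' i (extProj z)) z = 0 :=
    fun z hz a i => by
      simp [poissonBracket_eq_poissonForm, (dχ z hz _).fderiv, (dη z hz _).fderiv,
        poissonForm_extCovector, hneg, bPη _ hz]
  have cση : ∀ z ∈ W, ∀ a i, poissonBracket (θσ a) (fun z => η' i (extProj z)) z = 0 :=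
    fun z hz a i => by
      simp [poissonBracket_eq_poissonForm, (dσ z hz _).fderiv, (dη z hz _).fderiv,
        poissonForm_extCovector, bSη _ hz]
  have sχ : ∀ a, ContDiffOn ℝ ∞ (θχ a) W := fun a =>
    (extPhiL a).contDiff.contDiffOn.sub (contDiffOn_comp_extProj (hP a))
  have sσ : ∀ a, ContDiffOn ℝ ∞ (θσ a) W := fun a =>
    (extPiL a).contDiff.contDiffOn.add (contDiffOn_comp_extProj (hS a))
  have hΘ : IsFirstClassSystem W
      (Sum.elim (Sum.elim θχ θσ) fun i z => η' i (extProj z)) := by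
    refine ⟨?_, fun z hz => ?_, fun z hz => ?_⟩
    · rintro ((a | a) | i)
      exacts [sχ a, sσ a, contDiffOn_comp_extProj (hη' i)]
    · have h1 := (hreg _ hz.1 fun i => hz.2 (Sum.inr i)).1
      rw [Fintype.linearIndependent_iff] at h1 ⊢
      intro g hg
      have hg' : ∀ (x : PhaseSpace ι) (a b : A → ℝ),
          ∑ c, g (Sum.inl (Sum.inl c)) * (-fderiv ℝ (P c) (extProj z) x + a c)
          + ∑ c, g (Sum.inl (Sum.inr c)) * (fderiv ℝ (S c) (extProj z) x + b c)
          + ∑ i, g (Sum.inr i) * fderiv ℝ (η' i) (extProj z) x = 0 := fun x a b => by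
        have := DFunLike.congr_fun hg (extPoint (x, a, b))
        simpa [Fintype.sum_sum_type, (dχ z hz.1 _).fderiv, (dσ z hz.1 _).fderiv,
          (dη z hz.1 _).fderiv, extCovector_extPoint, Pi.single_apply] using this
      have g1 : ∀ a, g (Sum.inl (Sum.inl a)) = 0 := fun a => by
        simpa [Pi.single_apply] using hg' 0 (Pi.single a 1) 0
      have g2 : ∀ a, g (Sum.inl (Sum.inr a)) = 0 := fun a => by
        simpa [Pi.single_apply] using hg' 0 0 (Pi.single a 1)
      rintro ((a | a) | i)
      · exact g1 a
      · exact g2 a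
      · refine h1 (fun i => g (Sum.inr i)) (ContinuousLinearMap.ext fun x => ?_) i
        simpa [g1, g2] using hg' x 0 0
    · have h1 := (hreg _ hz.1 fun i => hz.2 (Sum.inr i)).2
      rintro ((a | a) | i) ((b | b) | j)
      · exact congrFun (congrFun (cχχ z hz.1) a) b
      · exact congrFun (congrFun (cχσ z hz.1) a) b
      · exact cχη z hz.1 a j
      · rw [poissonBracket_antisymm, neg_eq_zero]
        exact congrFun (congrFun (cχσ z hz.1) b) a
      · exact congrFun (congrFun (cσσ z hz.1) a) b
      · exact cση z hz.1 a j
      · rw [poissonBracket_antisymm, neg_eq_zero]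
        exact cχη z hz.1 b i
      · rw [poissonBracket_antisymm, neg_eq_zero]
        exact cση z hz.1 b i
      · have h2 : poissonForm (fderiv ℝ (η' i) (extProj z)) (fderiv ℝ (η' j) (extProj z)) = 0 :=
          congrFun (congrFun h1 i) j
        simp [poissonBracket_eq_poissonForm, (dη z hz.1 _).fderiv, poissonForm_extCovector, h2]
  have hfcP : IsFirstClassSystem V (Sum.elim P η') :=
    isFirstClassSystem_sumElim (S := S) (ε := -1) (by norm_num) hP hη' hPP (fun x hx => by
      rw [bracketMatrix_antisymm, hPS x hx]; simp) hPη hSη hreg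
  have hfcS : IsFirstClassSystem V (Sum.elim S η') :=
    isFirstClassSystem_sumElim (S := P) (ε := 1) (by norm_num) hS hη' hSS (fun x hx => by
      rw [hPS x hx]; simp) hSη hPη hreg
  have eφ : embedPhiZero N σ = fun x => extPoint (x, fun _ => 0, fun a => -S a x) := rfl
  have eπ : embedPiZero M χ = fun x => extPoint (x, fun a => P a x, fun _ => 0) := rfl
  have hpr : ∀ x a b, extProj (extPoint (x, a, b) : PhaseSpace (ι ⊕ A)) = x := fun x a b => rfl
  refine ⟨hM, hN, hMdet, hNdet, hPP, hSS, hPS, ?_, ?_, ?_⟩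
  · have h1 := hΘ.sum_dressed hW
      (D := fun z => Matrix.fromBlocks (M (extProj z))⁻¹ 0 0 (N (extProj z))⁻¹) (D' := fun _ => 1)
      ?_ (fun z hz => ?_) (fun a b => contDiffOn_const) (fun z hz => by simp)
    · refine h1.congr hW fun z hz => ?_
      rw [dressed_fromBlocks, dressed_one]
      rintro ((a | a) | i)
      · exact linkingChi_eq_dressed (hMdet _ hz) a
      · exact linkingSigma_eq_dressed (hNdet _ hz) a
      · rfl
    · rintro (a | a) (b | b)
      exacts [contDiffOn_comp_extProj (hM' a b), contDiffOn_const, contDiffOn_const,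
        contDiffOn_comp_extProj (hN' a b)]
    · rw [Matrix.det_fromBlocks_zero₂₁]
      exact (hM'det _ hz).mul (hN'det _ hz)
  · refine IsReduction.of_canonical hW (θ := θσ) (D := fun z => (N (extProj z))⁻¹) (ε := 1)
      (by norm_num) (fun a b => contDiffOn_comp_extProj (hN' a b)) (fun z hz => hN'det _ hz)
      (fun z hz a => linkingSigma_eq_dressed (hNdet _ hz) a)
      (fun z hz a => (dσ z hz a).differentiableAt) (fun z hz => ?_) cσσ (fun z hz => ?_)
      (fun x _ y _ h => congrArg extProj h) ?_ (fun F G hF hG x hx => ?_) ?_ ?_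
    · ext a b
      simp [bracketMatrix, poissonBracket_eq_poissonForm, (hasFDerivAt_extPhi _ z).fderiv,
        poissonForm_extCovector, hzero]
    · ext a b
      simp [bracketMatrix, poissonBracket_eq_poissonForm, (hasFDerivAt_extPhi _ z).fderiv,
        (dσ z hz _).fderiv, poissonForm_extCovector, hzero, Matrix.one_apply, Pi.single_apply,
        eq_comm]
    · ext z
      constructor
      · rintro ⟨x, hx, rfl⟩
        refine ⟨hx, ?_⟩
        rintro (a | a)
        · rfl
        · exact neg_add_cancel (S a x)
      · rintro ⟨hz, h⟩
        refine ⟨extProj z, hz, ?_⟩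
        rw [eφ, exists_extPoint_eq z]
        have h1 : ∀ a, extPhi a z = 0 := fun a => h (Sum.inl a)
        have h2 : ∀ a, extPi a z = -S a (extProj z) := fun a =>
          eq_neg_of_add_eq_zero_left (h (Sum.inr a))
        simp only [h1, h2, hpr]
    · have hz : embedPhiZero N σ x ∈ W := hx
      obtain ⟨ℓ, u, w, hFm⟩ := exists_extCovector_eq (fderiv ℝ F (embedPhiZero N σ x))
      obtain ⟨ℓ', u', w', hGm⟩ := exists_extCovector_eq (fderiv ℝ G (embedPhiZero N σ x))
      have dF := (hF.contDiffAt (hW.mem_nhds hz)).differentiableAt (by simp)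
      have dG := (hG.contDiffAt (hW.mem_nhds hz)).differentiableAt (by simp)
      have hdS : ∀ a, DifferentiableAt ℝ (fun x => -S a x) x := fun a => (hdiff (hS a) x hx).neg
      have hFe := fderiv_comp_extPoint (P := fun _ _ => 0) (S := fun a x => -S a x)
        (fun a => differentiableAt_const _) hdS dF hFm
      have hGe := fderiv_comp_extPoint (P := fun _ _ => 0) (S := fun a x => -S a x)
        (fun a => differentiableAt_const _) hdS dG hGm
      have hneS : ∀ a, fderiv ℝ (fun x => -S a x) x = -fderiv ℝ (S a) x := fun a => fderiv_fun_neg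
      simp only [hneS, fderiv_fun_const, Pi.zero_apply, smul_zero, Finset.sum_const_zero,
        add_zero] at hFe hGe
      have hR : poissonBracket (F ∘ embedPhiZero N σ) (G ∘ embedPhiZero N σ) x
          = poissonForm (ℓ + ∑ a, w a • -fderiv ℝ (S a) x) (ℓ' + ∑ a, w' a • -fderiv ℝ (S a) x) :=
        congrArg₂ poissonForm hFe hGe
      rw [hR, poissonForm_add_sum fun a b => by simp [hneg, bSS x hx]]
      simp only [poissonBracket_eq_poissonForm, hFm, hGm, (hasFDerivAt_extPhi _ _).fderiv,
        (dσ _ hz _).fderiv, poissonForm_extCovector, hzero, hneg]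
      rw [add_assoc, one_mul, ← Finset.sum_add_distrib]
      congr 1
      refine Finset.sum_congr rfl fun a _ => ?_
      have hex : extProj (embedPhiZero N σ x) = x := rfl
      simp [Pi.single_apply, hex]
      ring
    · refine (hfcP.sum_dressed hV (D := fun x => (-1 : ℝ) • (M x)⁻¹) (D' := fun _ => 1)
        (fun a b => contDiffOn_const.mul (hM' a b)) (fun x hx => ?_) (fun a b => contDiffOn_const)
        (fun z hz => by simp)).congr hV fun x hx => ?_
      · rw [Matrix.det_smul]
        exact (isUnit_one.neg.pow _).mul (hM'det x hx)
      · rw [dressed_one]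
        rintro (a | i)
        · refine (linkingChi_eq_dressed (hMdet x hx) a).trans ?_
          refine Finset.sum_congr rfl fun b _ => ?_
          change (M x)⁻¹ a b * (0 - P b x) = (-1 : ℝ) * (M x)⁻¹ a b * P b x
          ring
        · rfl
    · ext x
      refine and_congr_right fun hx => ?_
      have h1 : ∀ a, linkingChi M χ a (embedPhiZero N σ x) = -χ a x := fun a => by
        change ∑ b, (M x)⁻¹ a b * 0 - χ a x = _
        simp
      simp only [Sum.forall, Sum.elim_inl, Sum.elim_inr, Function.comp_apply, h1, neg_eq_zero]
      exact and_congr_right fun h => hηP x hx h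
  · refine IsReduction.of_canonical hW (θ := θχ) (D := fun z => (M (extProj z))⁻¹) (ε := -1)
      (by norm_num) (fun a b => contDiffOn_comp_extProj (hM' a b)) (fun z hz => hM'det _ hz)
      (fun z hz a => linkingChi_eq_dressed (hMdet _ hz) a)
      (fun z hz a => (dχ z hz a).differentiableAt) (fun z hz => ?_) cχχ (fun z hz => ?_)
      (fun x _ y _ h => congrArg extProj h) ?_ (fun F G hF hG x hx => ?_) ?_ ?_
    · ext a b
      simp [bracketMatrix, poissonBracket_eq_poissonForm, (hasFDerivAt_extPi _ z).fderiv,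
        poissonForm_extCovector, hzero]
    · ext a b
      simp [bracketMatrix, poissonBracket_eq_poissonForm, (hasFDerivAt_extPi _ z).fderiv,
        (dχ z hz _).fderiv, poissonForm_extCovector, hzero, Matrix.one_apply, Pi.single_apply,
        eq_comm]
      split_ifs <;> simp
    · ext z
      constructor
      · rintro ⟨x, hx, rfl⟩
        refine ⟨hx, ?_⟩
        rintro (a | a)
        · rfl
        · exact sub_self (P a x)
      · rintro ⟨hz, h⟩
        refine ⟨extProj z, hz, ?_⟩
        rw [eπ, exists_extPoint_eq z]
        have h1 : ∀ a, extPi a z = 0 := fun a => h (Sum.inl a)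
        have h2 : ∀ a, extPhi a z = P a (extProj z) := fun a => sub_eq_zero.1 (h (Sum.inr a))
        simp only [h1, h2, hpr]
    · have hz : embedPiZero M χ x ∈ W := hx
      obtain ⟨ℓ, u, w, hFm⟩ := exists_extCovector_eq (fderiv ℝ F (embedPiZero M χ x))
      obtain ⟨ℓ', u', w', hGm⟩ := exists_extCovector_eq (fderiv ℝ G (embedPiZero M χ x))
      have dF := (hF.contDiffAt (hW.mem_nhds hz)).differentiableAt (by simp)
      have dG := (hG.contDiffAt (hW.mem_nhds hz)).differentiableAt (by simp)
      have hFe := fderiv_comp_extPoint (P := P) (S := fun _ _ => 0)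
        (fun a => hdiff (hP a) x hx) (fun a => differentiableAt_const _) dF hFm
      have hGe := fderiv_comp_extPoint (P := P) (S := fun _ _ => 0)
        (fun a => hdiff (hP a) x hx) (fun a => differentiableAt_const _) dG hGm
      simp only [fderiv_fun_const, Pi.zero_apply, smul_zero, Finset.sum_const_zero,
        add_zero] at hFe hGe
      have hR : poissonBracket (F ∘ embedPiZero M χ) (G ∘ embedPiZero M χ) x
          = poissonForm (ℓ + ∑ a, u a • fderiv ℝ (P a) x) (ℓ' + ∑ a, u' a • fderiv ℝ (P a) x) :=
        congrArg₂ poissonForm hFe hGe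
      rw [hR, poissonForm_add_sum (bPP x hx)]
      simp only [poissonBracket_eq_poissonForm, hFm, hGm, (hasFDerivAt_extPi _ _).fderiv,
        (dχ _ hz _).fderiv, poissonForm_extCovector, hzero, hneg]
      rw [add_assoc, Finset.mul_sum, ← Finset.sum_add_distrib]
      congr 1
      refine Finset.sum_congr rfl fun a _ => ?_
      have hex : extProj (embedPiZero M χ x) = x := rfl
      simp [Pi.single_apply, hex]
      ring
    · refine (hfcS.sum_dressed hV (D := fun x => (N x)⁻¹) (D' := fun _ => 1) hN' hN'det
        (fun a b => contDiffOn_const) (fun z hz => by simp)).congr hV fun x hx => ?_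
      rw [dressed_one]
      rintro (a | i)
      · refine (linkingSigma_eq_dressed (hNdet x hx) a).trans ?_
        refine Finset.sum_congr rfl fun b _ => ?_
        change (N x)⁻¹ a b * (0 + S b x) = (N x)⁻¹ a b * S b x
        ring
      · rfl
    · ext x
      refine and_congr_right fun hx => ?_
      have h1 : ∀ a, linkingSigma N σ a (embedPiZero M χ x) = σ a x := fun a => by
        change ∑ b, (N x)⁻¹ a b * 0 + σ a x = _
        simp
      simp only [Sum.forall, Sum.elim_inl, Sum.elim_inr, Function.comp_apply, h1]
      exact and_congr_right fun h => hηS x hx h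

theorem symmetryTrading {U : Set (PhaseSpace ι)} (hU : IsOpen U) {χ σ : A → PhaseSpace ι → ℝ}
    {η : I → PhaseSpace ι → ℝ} (hχ : IsFirstClassSystem U χ) (hσ : IsFirstClassSystem U σ)
    (hχη : IsFirstClassSystem U (Sum.elim χ η)) (hση : IsFirstClassSystem U (Sum.elim σ η))
    (hχσ : IsMaximallySymplectic U χ σ) : SymmetryTrading U χ σ η := by
  refine ⟨fun x₀ hx₀ => ?_, gaugeFixedTheoriesAgree η hχ hσ hχσ⟩
  obtain ⟨hχ₀, hσ₀⟩ := hx₀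
  obtain ⟨M, N, hMN⟩ := exists_conjugate_abelianization hU hχ hσ hχ₀ hσ₀
    (hχσ x₀ ⟨hχ₀, hσ₀⟩).self_of_nhds
  have hxU : ∀ᶠ x in 𝓝 x₀, x ∈ U := hU.mem_nhds hχ₀.1
  have hsχ : ∀ᶠ x in 𝓝 x₀, ∀ a, ContDiffAt ℝ ∞ (χ a) x :=
    hxU.mono fun x hx a => (hχ.smooth a).contDiffAt (hU.mem_nhds hx)
  have hsσ : ∀ᶠ x in 𝓝 x₀, ∀ a, ContDiffAt ℝ ∞ (σ a) x :=
    hxU.mono fun x hx a => (hσ.smooth a).contDiffAt (hU.mem_nhds hx)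
  have hsη : ∀ᶠ x in 𝓝 x₀, ∀ i, ContDiffAt ℝ ∞ (η i) x :=
    hxU.mono fun x hx i => (hχη.smooth (Sum.inr i)).contDiffAt (hU.mem_nhds hx)
  have hP : ∀ᶠ x in 𝓝 x₀, ∀ a, ContDiffAt ℝ ∞ (dressed M χ a) x := by
    filter_upwards [hMN, hsχ] with x h1 h2 using contDiffAt_dressed h1.1 h2
  have hS : ∀ᶠ x in 𝓝 x₀, ∀ a, ContDiffAt ℝ ∞ (dressed N σ a) x := by
    filter_upwards [hMN, hsσ] with x h1 h2 using contDiffAt_dressed h1.2.1 h2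
  have hP0 : ∀ᶠ x in 𝓝 x₀, (∀ a, dressed M χ a x = 0) ↔ ∀ a, χ a x = 0 :=
    hMN.mono fun x h => forall_dressed_eq_zero_iff h.2.2.1
  have hS0 : ∀ᶠ x in 𝓝 x₀, (∀ a, dressed N σ a x = 0) ↔ ∀ a, σ a x = 0 :=
    hMN.mono fun x h => forall_dressed_eq_zero_iff h.2.2.2.1
  have hPη : ∀ᶠ x in 𝓝 x₀, (∀ a, χ a x = 0) → (∀ i, η i x = 0) →
      bracketMatrix (dressed M χ) η x = 0 := by
    filter_upwards [hMN, hsχ, hxU] with x h1 h2 h3 h4 h5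
    have h6 : bracketMatrix χ η x = 0 := Matrix.ext fun a i =>
      hχη.first_class x ⟨h3, Sum.forall.2 ⟨h4, h5⟩⟩ (Sum.inl a) (Sum.inr i)
    rw [bracketMatrix_dressed_left (fun a b => (h1.1 a b).differentiableAt (by simp))
      (fun a => (h2 a).differentiableAt (by simp)) h4, h6, Matrix.mul_zero]
  have hSη : ∀ᶠ x in 𝓝 x₀, (∀ a, σ a x = 0) → (∀ i, η i x = 0) →
      bracketMatrix (dressed N σ) η x = 0 := by
    filter_upwards [hMN, hsσ, hxU] with x h1 h2 h3 h4 h5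
    have h6 : bracketMatrix σ η x = 0 := Matrix.ext fun a i =>
      hση.first_class x ⟨h3, Sum.forall.2 ⟨h4, h5⟩⟩ (Sum.inl a) (Sum.inr i)
    rw [bracketMatrix_dressed_left (fun a b => (h1.2.1 a b).differentiableAt (by simp))
      (fun a => (h2 a).differentiableAt (by simp)) h4, h6, Matrix.mul_zero]
  have hPP := hMN.mono fun x h => h.2.2.2.2.1
  have hSS := hMN.mono fun x h => h.2.2.2.2.2.1
  have hPS := hMN.mono fun x h => h.2.2.2.2.2.2
  obtain ⟨WP, hWP, hPinv⟩ := exists_nhds_path_eq_zero_iff hU hχη hχ₀.1 hP hPP hP0 hPη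
  obtain ⟨WS, hWS, hSinv⟩ := exists_nhds_path_eq_zero_iff hU hση hχ₀.1 hS hSS hS0 hSη
  obtain ⟨η', hη'⟩ := exists_commuting_constraints hP hS hsη hPP hSS hPS
    (hP0.self_of_nhds.2 hχ₀.2) (hS0.self_of_nhds.2 hσ₀.2)
    (fun h => (hχη.regular_irreducible x₀ ⟨hχ₀.1, Sum.forall.2 ⟨hχ₀.2, h⟩⟩).comp Sum.inr
      Sum.inr_injective)
    (by
      filter_upwards [hxU, hP0, hS0, hPη, hSη] with x h1 h2 h3 h4 h5 k1 k2 k3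
      exact ⟨h4 (h2.1 k1) k3, h5 (h3.1 k2) k3, Matrix.ext fun i j =>
        hχη.first_class x ⟨h1, Sum.forall.2 ⟨h2.1 k1, k3⟩⟩ (Sum.inr i) (Sum.inr j)⟩)
    (Filter.inter_mem hWP hP0) (Filter.inter_mem hWS hS0)
    (fun γ c h0 hγ => hPinv γ c ((hγ 0 ⟨le_rfl, zero_le_one⟩).1.2.1 h0) fun s hs =>
      ⟨(hγ s hs).1.1, (hγ s hs).2⟩)
    (fun γ c h0 hγ => hSinv γ c ((hγ 0 ⟨le_rfl, zero_le_one⟩).1.2.1 h0) fun s hs =>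
      ⟨(hγ s hs).1.1, (hγ s hs).2⟩)
  obtain ⟨V, hVsub, hV, hxV⟩ := mem_nhds_iff.1 (hxU.and (hMN.and (hη'.and (hsχ.and
    (hsσ.and (hP0.and hS0))))))
  have h : ∀ x ∈ V, _ := fun x hx => hVsub hx
  refine ⟨V, hV, hxV, fun x hx => (h x hx).1, M, N, η', ?_⟩
  exact isLinkingTheory_of_commuting hV
    (fun a x hx => ((h x hx).2.2.2.1 a).contDiffWithinAt)
    (fun a x hx => ((h x hx).2.2.2.2.1 a).contDiffWithinAt)
    (fun a b x hx => ((h x hx).2.1.1 a b).contDiffWithinAt)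
    (fun a b x hx => ((h x hx).2.1.2.1 a b).contDiffWithinAt)
    (fun x hx => (h x hx).2.1.2.2.1) (fun x hx => (h x hx).2.1.2.2.2.1)
    (fun x hx => (h x hx).2.1.2.2.2.2.1) (fun x hx => (h x hx).2.1.2.2.2.2.2.1)
    (fun x hx => (h x hx).2.1.2.2.2.2.2.2)
    (fun i x hx => ((h x hx).2.2.1.1 i).contDiffWithinAt)
    (fun x hx => (h x hx).2.2.1.2.1) (fun x hx => (h x hx).2.2.1.2.2.1)
    (fun x hx => (h x hx).2.2.1.2.2.2.1)
    (fun x hx k => (h x hx).2.2.1.2.2.2.2.1 ((h x hx).2.2.2.2.2.1.2 k))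
    (fun x hx k => (h x hx).2.2.1.2.2.2.2.2 ((h x hx).2.2.2.2.2.2.2 k))

end Linking

/-! ### Superfunctions and their derivations -/

section Exterior

variable {V W : Type*} [AddCommGroup V] [Module ℝ V] [AddCommGroup W] [Module ℝ W]

open CliffordAlgebra

theorem ExteriorAlgebra.mul_ι_eq (b : ExteriorAlgebra ℝ V) (v : V) :
    b * ExteriorAlgebra.ι ℝ v = ExteriorAlgebra.ι ℝ v * involute b := by
  induction b using CliffordAlgebra.left_induction with
  | algebraMap r => rw [AlgHom.commutes]; exact Algebra.commutes r _
  | add x y hx hy => rw [map_add, add_mul, mul_add, hx, hy]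
  | ι_mul x w hx =>
    rw [mul_assoc, hx, map_mul, involute_ι, neg_mul, mul_neg, ← mul_assoc, ← mul_assoc]
    have h := ExteriorAlgebra.ι_add_mul_swap (R := ℝ) w v
    change ExteriorAlgebra.ι ℝ w * ExteriorAlgebra.ι ℝ v * _ = _
    rw [eq_neg_of_add_eq_zero_left h, neg_mul]

/-- Supercommutativity, with the right factor split into its even and odd parts. -/
theorem ExteriorAlgebra.two_smul_mul (a b : ExteriorAlgebra ℝ V) :
    (2 : ℝ) • (b * a) = (a + involute a) * b + (a - involute a) * involute b := by
  induction a using CliffordAlgebra.left_induction generalizing b with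
  | algebraMap r =>
    rw [AlgHom.commutes, sub_self, zero_mul, add_zero, ← two_smul ℝ (algebraMap _ _ r),
      smul_mul_assoc, Algebra.commutes]
  | add x y hx hy =>
    rw [mul_add, smul_add, hx, hy, map_add]
    noncomm_ring
  | ι_mul x v hx =>
    have h1 : b * (CliffordAlgebra.ι 0 v * x) = CliffordAlgebra.ι 0 v * (involute b * x) := by
      rw [← mul_assoc, ← mul_assoc]
      exact congrArg (· * x) (ExteriorAlgebra.mul_ι_eq b v)
    rw [h1, ← mul_smul_comm, hx, map_mul, involute_ι, involute_involute]
    noncomm_ring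

theorem CliffordAlgebra.contractLeft_mul {Q : QuadraticForm ℝ V} (d : Module.Dual ℝ V)
    (a b : CliffordAlgebra Q) :
    CliffordAlgebra.contractLeft d (a * b)
      = CliffordAlgebra.contractLeft d a * b + involute a * CliffordAlgebra.contractLeft d b := by
  induction a using CliffordAlgebra.left_induction with
  | algebraMap r =>
    rw [contractLeft_algebraMap_mul, contractLeft_algebraMap, AlgHom.commutes, zero_mul, zero_add]
  | add x y hx hy => rw [add_mul, map_add, hx, hy, map_add, map_add]; noncomm_ring
  | ι_mul x v hx =>
    rw [mul_assoc, contractLeft_ι_mul, contractLeft_ι_mul, hx, map_mul, involute_ι, sub_mul,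
      smul_mul_assoc]
    noncomm_ring

theorem CliffordAlgebra.involute_contractLeft {Q : QuadraticForm ℝ V} (d : Module.Dual ℝ V)
    (a : CliffordAlgebra Q) :
    involute (CliffordAlgebra.contractLeft d a) = -CliffordAlgebra.contractLeft d (involute a) := by
  induction a using CliffordAlgebra.left_induction with
  | algebraMap r => simp
  | add x y hx hy => simp only [map_add, hx, hy, neg_add]
  | ι_mul x v hx =>
    rw [contractLeft_ι_mul, map_sub, map_mul, map_mul, hx, involute_ι,
      neg_mul (CliffordAlgebra.ι Q v),
      neg_mul, map_neg, contractLeft_ι_mul, map_smul]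
    noncomm_ring

theorem CliffordAlgebra.contractRight_eq_neg {Q : QuadraticForm ℝ V} (d : Module.Dual ℝ V)
    (a : CliffordAlgebra Q) : contractRight a d = -CliffordAlgebra.contractLeft d (involute a) := by
  induction a using CliffordAlgebra.right_induction with
  | algebraMap r => simp
  | add x y hx hy => simp only [map_add, LinearMap.add_apply, hx, hy, neg_add]
  | mul_ι v x hx =>
    rw [contractRight_mul_ι, hx, map_mul, involute_ι, contractLeft_mul, involute_involute, map_neg,
      contractLeft_ι, Algebra.smul_def, Algebra.commutes]
    noncomm_ring

theorem ExteriorAlgebra.involute_map (f : V →ₗ[ℝ] W) (a : ExteriorAlgebra ℝ V) :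
    involute (ExteriorAlgebra.map f a) = ExteriorAlgebra.map f (involute a) := by
  induction a using CliffordAlgebra.left_induction with
  | algebraMap r => simp
  | add x y hx hy => simp only [map_add, hx, hy]
  | ι_mul x v hx =>
    have h1 : ExteriorAlgebra.map f (CliffordAlgebra.ι 0 v) = ExteriorAlgebra.ι ℝ (f v) :=
      ExteriorAlgebra.map_apply_ι f v
    have h2 : involute (ExteriorAlgebra.ι ℝ (f v)) = -ExteriorAlgebra.ι ℝ (f v) := involute_ι _
    simp only [map_mul, hx, involute_ι, map_neg, h1, h2]

theorem ExteriorAlgebra.contractLeft_map (f : V →ₗ[ℝ] W) (d : Module.Dual ℝ W)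
    (a : ExteriorAlgebra ℝ V) : CliffordAlgebra.contractLeft d (ExteriorAlgebra.map f a)
      = ExteriorAlgebra.map f (CliffordAlgebra.contractLeft (d.comp f) a) := by
  induction a using CliffordAlgebra.left_induction with
  | algebraMap r => simp
  | add x y hx hy => simp only [map_add, hx, hy]
  | ι_mul x v hx =>
    have h1 : ExteriorAlgebra.map f (CliffordAlgebra.ι 0 v) = ExteriorAlgebra.ι ℝ (f v) :=
      ExteriorAlgebra.map_apply_ι f v
    have h2 : CliffordAlgebra.contractLeft d (ExteriorAlgebra.ι ℝ (f v))
        = algebraMap ℝ _ (d (f v)) :=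
      contractLeft_ι (Q := 0) d (f v)
    have h3 : involute (ExteriorAlgebra.ι ℝ (f v)) = -ExteriorAlgebra.ι ℝ (f v) := involute_ι _
    rw [map_mul, contractLeft_mul, contractLeft_mul, hx, h1, h2, h3, contractLeft_ι, involute_ι,
      map_add, map_mul, map_mul, map_neg, h1, AlgHom.commutes]
    rfl

end Exterior

section SmoothFn

variable {ι : Type*} [Fintype ι] {U : Opens (PhaseSpace ι)}

theorem zeroExt_eventuallyEq {f : U → ℝ} {g : PhaseSpace ι → ℝ} (h : ∀ x : U, f x = g x.1) (x : U) :
    zeroExt U f =ᶠ[𝓝 x.1] g :=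
  Filter.mem_of_superset (U.2.mem_nhds x.2) fun y hy => (zeroExt_apply f hy).trans (h ⟨y, hy⟩)

theorem smoothFnDeriv_apply (v : PhaseSpace ι) (f : SmoothFn U) (x : U) :
    (smoothFnDeriv v f).1 x = fderiv ℝ (zeroExt U f.1) x.1 v := rfl

theorem smoothFnDeriv_mul (v : PhaseSpace ι) (f g : SmoothFn U) :
    smoothFnDeriv v (f * g) = smoothFnDeriv v f * g + f * smoothFnDeriv v g := by
  ext x
  have h : zeroExt U (f * g).1 = fun y => zeroExt U f.1 y * zeroExt U g.1 y := by
    ext y; by_cases hy : y ∈ U <;> simp [zeroExt, hy]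
  change fderiv ℝ (zeroExt U (f * g).1) x.1 v = fderiv ℝ (zeroExt U f.1) x.1 v * g.1 x
    + f.1 x * fderiv ℝ (zeroExt U g.1) x.1 v
  rw [h, fderiv_fun_mul (smoothFn_differentiableAt f x) (smoothFn_differentiableAt g x)]
  simp [zeroExt_apply _ x.2]
  ring

theorem smoothFnDeriv_comm (v w : PhaseSpace ι) (f : SmoothFn U) :
    smoothFnDeriv v (smoothFnDeriv w f) = smoothFnDeriv w (smoothFnDeriv v f) := by
  ext x
  have hf : ContDiffAt ℝ ∞ (zeroExt U f.1) x.1 := f.2.contDiffAt (U.2.mem_nhds x.2)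
  have h1 : ∀ v w, (smoothFnDeriv v (smoothFnDeriv w f)).1 x
      = fderiv ℝ (fderiv ℝ (zeroExt U f.1)) x.1 v w := fun v w => by
    rw [smoothFnDeriv_apply, (zeroExt_eventuallyEq
      (g := fun y => fderiv ℝ (zeroExt U f.1) y w)
      (fun y => smoothFnDeriv_apply w f y) x).fderiv_eq]
    rw [(hf.hasFDerivAt_fderiv.clm_apply (hasFDerivAt_const w x.1)).fderiv]
    simp
  rw [h1, h1, fderiv_fderiv_symm hf]

end SmoothFn

/-! ### The graded Poisson bracket and its Jacobi identity -/

/-- The algebra of `{Ω, {Ω, F}}`: a sum of nested first order expressions in (twisted) derivations,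
whose part of second order in `F` cancels. -/
theorem sum_deriv_sum_eq {R T : Type*} [Ring R] [Algebra ℝ R] [Fintype T] (g : T → ℝ)
    (a b : T → R) (D : T → R →ₗ[ℝ] R) (J : T → R → R)
    (hD : ∀ t x y, D t (x * y) = D t x * y + J t x * D t y)
    (h0 : ∑ t, ∑ s, (g t * g s) • (a t * (J t (a s) * D t (b s))) = 0) :
    ∑ t, g t • (a t * D t (∑ s, g s • (a s * b s)))
      = ∑ s, g s • ((∑ t, g t • (a t * D t (a s))) * b s) := by
  simp only [map_sum, map_smul, hD, mul_add, smul_add, Finset.mul_sum, mul_smul_comm,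
    Finset.smul_sum, Finset.sum_add_distrib, smul_smul, Finset.sum_mul, smul_mul_assoc]
  rw [h0, add_zero, Finset.sum_comm]
  refine Finset.sum_congr rfl fun s _ => Finset.sum_congr rfl fun t _ => ?_
  rw [mul_assoc, mul_comm (g s)]

section SuperDeriv

variable {ι A : Type*} [Fintype ι] {U : Opens (PhaseSpace ι)}

set_option synthInstance.maxHeartbeats 400000 in
/-- A shortcut: the search through the tensor product is long. -/
noncomputable instance SuperFn.instRing : Ring (SuperFn U A) := inferInstance

noncomputable instance SuperFn.instAddCommGroup : AddCommGroup (SuperFn U A) := inferInstance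

/-- The parity involution of superfunctions, `-1` on odd elements and `1` on even ones. -/
noncomputable def superInvolute : SuperFn U A →ₐ[ℝ] SuperFn U A :=
  Algebra.TensorProduct.map (AlgHom.id ℝ (SmoothFn U)) CliffordAlgebra.involute

theorem superInvolute_tmul (f : SmoothFn U) (a : GhostAlgebra A) :
    superInvolute (f ⊗ₜ[ℝ] a) = f ⊗ₜ[ℝ] CliffordAlgebra.involute a := rfl

theorem superInvolute_superInvolute (F : SuperFn U A) : superInvolute (superInvolute F) = F := by
  induction F using TensorProduct.induction_on with
  | zero => simp
  | add x y hx hy => rw [map_add, map_add, hx, hy]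
  | tmul f a => rw [superInvolute_tmul, superInvolute_tmul, CliffordAlgebra.involute_involute]

/-- Supercommutativity, with one factor split into its even and odd parts. -/
theorem two_smul_mul_eq (F G : SuperFn U A) :
    (2 : ℝ) • (G * F) = (F + superInvolute F) * G + (F - superInvolute F) * superInvolute G := by
  induction F using TensorProduct.induction_on with
  | zero => simp
  | add x y hx hy => rw [mul_add, smul_add, hx, hy, map_add]; noncomm_ring
  | tmul f a =>
    induction G using TensorProduct.induction_on with
    | zero => simp
    | add x y hx hy => rw [add_mul, smul_add, hx, hy, map_add]; noncomm_ring
    | tmul g b =>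
      simp only [superInvolute_tmul, ← TensorProduct.tmul_add, ← TensorProduct.tmul_sub,
        Algebra.TensorProduct.tmul_mul_tmul, ← TensorProduct.tmul_smul,
        ExteriorAlgebra.two_smul_mul, mul_comm g f]

theorem SuperFn.eq_zero_of_eq_neg {F : SuperFn U A} (h : F = -F) : F = 0 := by
  have h2 : (2 : ℝ) • F = 0 := by
    rw [two_smul]
    nth_rewrite 1 [h]
    exact neg_add_cancel F
  exact (smul_eq_zero.1 h2).resolve_left two_ne_zero

/-- Even superfunctions are central. -/
theorem SuperFn.mul_comm_of_even {F : SuperFn U A} (hF : superInvolute F = F) (G : SuperFn U A) :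
    G * F = F * G := by
  have h := two_smul_mul_eq F G
  rw [hF, sub_self, zero_mul, add_zero, ← two_smul ℝ F, smul_mul_assoc] at h
  exact smul_right_injective _ (two_ne_zero (α := ℝ)) h

theorem SuperFn.mul_eq_of_odd {F : SuperFn U A} (hF : superInvolute F = -F) (G : SuperFn U A) :
    G * F = F * superInvolute G := by
  have h := two_smul_mul_eq F G
  rw [hF, add_neg_cancel, zero_mul, zero_add, sub_neg_eq_add, ← two_smul ℝ F, smul_mul_assoc] at h
  exact smul_right_injective _ (two_ne_zero (α := ℝ)) h

theorem bosonicDeriv_tmul (v : PhaseSpace ι) (f : SmoothFn U) (a : GhostAlgebra A) :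
    bosonicDeriv v (f ⊗ₜ[ℝ] a) = smoothFnDeriv v f ⊗ₜ[ℝ] a := rfl

theorem leftDeriv_tmul (d : Module.Dual ℝ ((A → ℝ) × (A → ℝ))) (f : SmoothFn U)
    (a : GhostAlgebra A) :
    leftDeriv d (f ⊗ₜ[ℝ] a) = f ⊗ₜ[ℝ] CliffordAlgebra.contractLeft d a := rfl

theorem rightDeriv_eq_neg (d : Module.Dual ℝ ((A → ℝ) × (A → ℝ))) (F : SuperFn U A) :
    rightDeriv d F = -leftDeriv d (superInvolute F) := by
  induction F using TensorProduct.induction_on with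
  | zero => simp
  | add x y hx hy => rw [map_add, map_add, map_add, hx, hy, neg_add]
  | tmul f a =>
    rw [superInvolute_tmul, leftDeriv_tmul, ← TensorProduct.tmul_neg,
      ← CliffordAlgebra.contractRight_eq_neg]
    rfl

theorem bosonicDeriv_mul (v : PhaseSpace ι) (F G : SuperFn U A) :
    bosonicDeriv v (F * G) = bosonicDeriv v F * G + F * bosonicDeriv v G := by
  induction F using TensorProduct.induction_on with
  | zero => simp
  | add x y hx hy => rw [add_mul, map_add, hx, hy, map_add]; noncomm_ring
  | tmul f a =>
    induction G using TensorProduct.induction_on with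
    | zero => simp
    | add x y hx hy => rw [mul_add, map_add, hx, hy, map_add]; noncomm_ring
    | tmul g b =>
      simp only [bosonicDeriv_tmul, Algebra.TensorProduct.tmul_mul_tmul, smoothFnDeriv_mul,
        TensorProduct.add_tmul]

theorem leftDeriv_mul (d : Module.Dual ℝ ((A → ℝ) × (A → ℝ))) (F G : SuperFn U A) :
    leftDeriv d (F * G) = leftDeriv d F * G + superInvolute F * leftDeriv d G := by
  induction F using TensorProduct.induction_on with
  | zero => simp
  | add x y hx hy => rw [add_mul, map_add, hx, hy, map_add, map_add]; noncomm_ring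
  | tmul f a =>
    induction G using TensorProduct.induction_on with
    | zero => simp
    | add x y hx hy => rw [mul_add, map_add, hx, hy, map_add]; noncomm_ring
    | tmul g b =>
      simp only [leftDeriv_tmul, superInvolute_tmul, Algebra.TensorProduct.tmul_mul_tmul,
        CliffordAlgebra.contractLeft_mul, TensorProduct.tmul_add]

theorem superInvolute_bosonicDeriv (v : PhaseSpace ι) (F : SuperFn U A) :
    superInvolute (bosonicDeriv v F) = bosonicDeriv v (superInvolute F) := by
  induction F using TensorProduct.induction_on with
  | zero => simp
  | add x y hx hy => simp only [map_add, hx, hy]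
  | tmul f a => rfl

theorem superInvolute_leftDeriv (d : Module.Dual ℝ ((A → ℝ) × (A → ℝ))) (F : SuperFn U A) :
    superInvolute (leftDeriv d F) = -leftDeriv d (superInvolute F) := by
  induction F using TensorProduct.induction_on with
  | zero => simp
  | add x y hx hy => simp only [map_add, hx, hy, neg_add]
  | tmul f a =>
    simp only [superInvolute_tmul, leftDeriv_tmul, CliffordAlgebra.involute_contractLeft,
      TensorProduct.tmul_neg]

theorem bosonicDeriv_comm (v w : PhaseSpace ι) (F : SuperFn U A) :
    bosonicDeriv v (bosonicDeriv w F) = bosonicDeriv w (bosonicDeriv v F) := by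
  induction F using TensorProduct.induction_on with
  | zero => simp
  | add x y hx hy => simp only [map_add, hx, hy]
  | tmul f a => simp only [bosonicDeriv_tmul, smoothFnDeriv_comm v w]

theorem leftDeriv_comm (d d' : Module.Dual ℝ ((A → ℝ) × (A → ℝ))) (F : SuperFn U A) :
    leftDeriv d (leftDeriv d' F) = -leftDeriv d' (leftDeriv d F) := by
  induction F using TensorProduct.induction_on with
  | zero => simp
  | add x y hx hy => simp only [map_add, hx, hy, neg_add]
  | tmul f a =>
    simp only [leftDeriv_tmul, CliffordAlgebra.contractLeft_comm d d', TensorProduct.tmul_neg]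

theorem bosonicDeriv_leftDeriv (v : PhaseSpace ι) (d : Module.Dual ℝ ((A → ℝ) × (A → ℝ)))
    (F : SuperFn U A) : bosonicDeriv v (leftDeriv d F) = leftDeriv d (bosonicDeriv v F) := by
  induction F using TensorProduct.induction_on with
  | zero => simp
  | add x y hx hy => simp only [map_add, hx, hy]
  | tmul f a => rfl

variable [DecidableEq ι]

/-- The derivatives of superfunctions with respect to all coordinates: `q`, `p`, ghosts and ghost
momenta, in this order. -/
noncomputable def superDeriv : (ι ⊕ ι) ⊕ (A ⊕ A) → SuperFn U A →ₗ[ℝ] SuperFn U A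
  | .inl (.inl i) => bosonicDeriv (dirQ i)
  | .inl (.inr i) => bosonicDeriv (dirP i)
  | .inr (.inl a) => leftDeriv (ghostCoord a)
  | .inr (.inr a) => leftDeriv (ghostMomentumCoord a)

/-- The canonically conjugate coordinate. -/
def conj : (ι ⊕ ι) ⊕ (A ⊕ A) ≃ (ι ⊕ ι) ⊕ (A ⊕ A) :=
  Equiv.sumCongr (Equiv.sumComm ι ι) (Equiv.sumComm A A)

/-- The coefficient of the pair `(t, conj t)` in the graded Poisson bracket. -/
def bracketSign : (ι ⊕ ι) ⊕ (A ⊕ A) → ℝ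
  | .inl (.inl _) => 1
  | .inl (.inr _) => -1
  | .inr _ => 1

theorem conj_conj (t : (ι ⊕ ι) ⊕ (A ⊕ A)) : conj (conj t) = t := by
  rcases t with (t | t) | (t | t) <;> rfl

theorem isRight_conj (t : (ι ⊕ ι) ⊕ (A ⊕ A)) : (conj t).isRight = t.isRight := by
  rcases t with (t | t) | (t | t) <;> rfl

theorem bracketSign_conj (t : (ι ⊕ ι) ⊕ (A ⊕ A)) :
    bracketSign (conj t) = if t.isRight then bracketSign t else -bracketSign t := by
  rcases t with (t | t) | (t | t) <;> simp [conj, bracketSign]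

theorem superDeriv_mul (t : (ι ⊕ ι) ⊕ (A ⊕ A)) (F G : SuperFn U A) :
    superDeriv t (F * G) = superDeriv t F * G
      + (if t.isRight then superInvolute F else F) * superDeriv t G := by
  rcases t with (t | t) | (t | t)
  exacts [bosonicDeriv_mul _ _ _, bosonicDeriv_mul _ _ _, leftDeriv_mul _ _ _, leftDeriv_mul _ _ _]

theorem superInvolute_superDeriv (t : (ι ⊕ ι) ⊕ (A ⊕ A)) (F : SuperFn U A) :
    superInvolute (superDeriv t F) = if t.isRight then -superDeriv t (superInvolute F)
      else superDeriv t (superInvolute F) := by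
  rcases t with (t | t) | (t | t)
  exacts [superInvolute_bosonicDeriv _ _, superInvolute_bosonicDeriv _ _,
    superInvolute_leftDeriv _ _, superInvolute_leftDeriv _ _]

theorem superDeriv_comm (t s : (ι ⊕ ι) ⊕ (A ⊕ A)) (F : SuperFn U A) :
    superDeriv t (superDeriv s F) = if t.isRight ∧ s.isRight then -superDeriv s (superDeriv t F)
      else superDeriv s (superDeriv t F) := by
  rcases t with t | t <;> rcases s with s | s <;>
    simp only [Sum.isRight_inl, Sum.isRight_inr, Bool.false_eq_true, and_false, false_and, and_self,
      if_true, if_false]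
  · rcases t with t | t <;> rcases s with s | s <;> exact bosonicDeriv_comm _ _ _
  · rcases t with t | t <;> rcases s with s | s <;> exact bosonicDeriv_leftDeriv _ _ _
  · rcases t with t | t <;> rcases s with s | s <;> exact (bosonicDeriv_leftDeriv _ _ _).symm
  · rcases t with t | t <;> rcases s with s | s <;> exact leftDeriv_comm _ _ _

variable [Fintype A]

/-- With an odd left entry, right and left derivatives agree, so that the bracket is one signed sum
over all conjugate pairs of coordinates. -/
theorem superBracket_eq_of_odd {Ω : SuperFn U A} (hΩ : superInvolute Ω = -Ω) (F : SuperFn U A) :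
    superBracket Ω F = ∑ t, bracketSign t • (superDeriv t Ω * superDeriv (conj t) F) := by
  simp only [superBracket, rightDeriv_eq_neg, hΩ, map_neg, neg_neg, Fintype.sum_sum_type]
  simp [bracketSign, superDeriv, conj, Finset.sum_add_distrib, sub_eq_add_neg]

theorem superInvolute_superDeriv_of_odd {Ω : SuperFn U A} (hΩ : superInvolute Ω = -Ω)
    (t : (ι ⊕ ι) ⊕ (A ⊕ A)) :
    superInvolute (superDeriv t Ω) = if t.isRight then superDeriv t Ω else -superDeriv t Ω := by
  rw [superInvolute_superDeriv, hΩ]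
  split_ifs <;> simp

theorem superInvolute_superBracket_self {Ω : SuperFn U A} (hΩ : superInvolute Ω = -Ω) :
    superInvolute (superBracket Ω Ω) = superBracket Ω Ω := by
  rw [superBracket_eq_of_odd hΩ, map_sum]
  refine Finset.sum_congr rfl fun t _ => ?_
  rw [map_smul, map_mul, superInvolute_superDeriv_of_odd hΩ, superInvolute_superDeriv_of_odd hΩ,
    isRight_conj]
  split_ifs <;> simp

/-- The graded Leibniz rule for `{Ω, Ω}`: graded symmetry makes its two terms equal. -/
theorem superDeriv_superBracket_self {Ω : SuperFn U A} (hΩ : superInvolute Ω = -Ω)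
    (s : (ι ⊕ ι) ⊕ (A ⊕ A)) :
    superDeriv s (superBracket Ω Ω) = (if s.isRight then -2 else 2 : ℝ) •
      ∑ t, bracketSign t • (superDeriv t Ω * superDeriv (conj t) (superDeriv s Ω)) := by
  have hpar := fun t => superInvolute_superDeriv_of_odd hΩ t
  rw [superBracket_eq_of_odd hΩ, map_sum]
  simp only [map_smul, superDeriv_mul, smul_add, Finset.sum_add_distrib]
  rw [← conj.sum_comp (fun t => bracketSign t • (superDeriv s (superDeriv t Ω)
    * superDeriv (conj t) Ω)), ← Finset.sum_add_distrib, Finset.smul_sum]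
  refine Finset.sum_congr rfl fun t _ => ?_
  have h1 : superInvolute (superDeriv (conj t) (superDeriv s Ω))
      = if t.isRight = s.isRight then -superDeriv (conj t) (superDeriv s Ω)
        else superDeriv (conj t) (superDeriv s Ω) := by
    rw [superInvolute_superDeriv, isRight_conj, hpar]
    cases t.isRight <;> cases s.isRight <;> simp
  have h2 := superDeriv_comm s (conj t) Ω
  rw [conj_conj, bracketSign_conj, hpar, h2, isRight_conj]
  cases ht : t.isRight <;> cases hs : s.isRight <;>
    simp only [ht, hs, Bool.false_eq_true, if_true, if_false, and_false, false_and, and_self,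
      reduceCtorEq] at h1 ⊢
  · have h4 := SuperFn.mul_eq_of_odd ((hpar t).trans (by simp [ht]))
      (superDeriv (conj t) (superDeriv s Ω))
    rw [h4, h1, mul_neg]
    module
  · have h4 := SuperFn.mul_comm_of_even h1 (superDeriv t Ω)
    rw [h4, neg_mul, h4]
    module
  · have h4 := SuperFn.mul_comm_of_even h1 (superDeriv t Ω)
    rw [h4]
    module
  · have h3 := SuperFn.mul_comm_of_even ((hpar t).trans (by simp [ht]))
      (superDeriv (conj t) (superDeriv s Ω))
    simp only [neg_mul, mul_neg, h3]
    module

/-- The terms of `{Ω, {Ω, F}}` with two derivatives of `F` cancel in pairs. -/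
theorem sum_superDeriv_superDeriv_eq_zero {Ω : SuperFn U A} (hΩ : superInvolute Ω = -Ω)
    (F : SuperFn U A) : ∑ t, ∑ s, (bracketSign t * bracketSign s) • (superDeriv t Ω
      * ((if t.isRight then superInvolute (superDeriv s Ω) else superDeriv s Ω)
        * superDeriv (conj t) (superDeriv (conj s) F))) = 0 := by
  have hpar := fun t => superInvolute_superDeriv_of_odd hΩ t
  refine SuperFn.eq_zero_of_eq_neg ?_
  conv_lhs => rw [Finset.sum_comm]
  simp only [← Finset.sum_neg_distrib]
  refine Finset.sum_congr rfl fun t _ => Finset.sum_congr rfl fun s _ => ?_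
  rw [mul_comm (bracketSign s), ← smul_neg]
  congr 1
  have h2 := superDeriv_comm (conj s) (conj t) F
  rw [isRight_conj, isRight_conj] at h2
  rw [h2, hpar, hpar]
  cases ht : t.isRight <;> cases hs : s.isRight <;>
    simp only [Bool.false_eq_true, if_true, if_false, and_false, false_and, and_self]
  · have h3 := SuperFn.mul_eq_of_odd ((hpar t).trans (by rw [ht]; rfl)) (superDeriv s Ω)
    rw [hpar, hs, if_neg Bool.false_ne_true] at h3
    rw [← mul_assoc, h3, mul_neg, neg_mul, mul_assoc]
  · have h3 := SuperFn.mul_comm_of_even ((hpar s).trans (by rw [hs]; rfl)) (superDeriv t Ω)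
    rw [neg_mul, mul_neg, ← mul_assoc, ← mul_assoc, h3]
  · have h3 := SuperFn.mul_comm_of_even ((hpar t).trans (by rw [ht]; rfl)) (superDeriv s Ω)
    rw [neg_mul, mul_neg, neg_neg, ← mul_assoc, h3, mul_assoc]
  · have h3 := SuperFn.mul_comm_of_even ((hpar t).trans (by rw [ht]; rfl)) (superDeriv s Ω)
    rw [mul_neg, mul_neg, ← mul_assoc, h3, mul_assoc]

/-- The graded Jacobi identity `{Ω, {Ω, F}} = ½ {{Ω, Ω}, F}` for odd `Ω`, in coordinates. -/
theorem superBracket_superBracket {Ω : SuperFn U A} (hΩ : superInvolute Ω = -Ω) (F : SuperFn U A) :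
    superBracket Ω (superBracket Ω F) = ∑ s, bracketSign s •
      ((if s.isRight then -(1 / 2) else 1 / 2 : ℝ) • superDeriv s (superBracket Ω Ω)
        * superDeriv (conj s) F) := by
  have hpar := fun t => superInvolute_superDeriv_of_odd hΩ t
  have hR : ∀ s : (ι ⊕ ι) ⊕ (A ⊕ A),
      (if s.isRight then -(1 / 2) else 1 / 2 : ℝ) • superDeriv s (superBracket Ω Ω)
      = ∑ t, bracketSign t • (superDeriv t Ω * superDeriv (conj t) (superDeriv s Ω)) := by
    intro s
    have h : (if s.isRight then -(1 / 2) else 1 / 2 : ℝ) * (if s.isRight then -2 else 2 : ℝ)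
        = 1 := by
      split_ifs <;> norm_num
    rw [superDeriv_superBracket_self hΩ, smul_smul, h, one_smul]
  have h0 := sum_superDeriv_superDeriv_eq_zero hΩ F
  rw [superBracket_eq_of_odd hΩ F, superBracket_eq_of_odd hΩ]
  have h1 := sum_deriv_sum_eq bracketSign (fun t => superDeriv t Ω)
    (fun s => superDeriv (conj s) F) (fun t => superDeriv (conj t))
    (fun t x => if t.isRight then superInvolute x else x)
    (fun t x y => by rw [superDeriv_mul, isRight_conj]) h0
  refine h1.trans (Finset.sum_congr rfl fun s _ => ?_)
  rw [hR]

theorem superBracket_superBracket_eq_zero {Ω : SuperFn U A} (hΩ : superInvolute Ω = -Ω)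
    (hR : superBracket Ω Ω = 0) (F : SuperFn U A) : superBracket Ω (superBracket Ω F) = 0 := by
  rw [superBracket_superBracket hΩ, hR]
  simp

/-- The graded Jacobi identity for three copies of an odd superfunction. -/
theorem superBracket_superBracket_self {Ω : SuperFn U A} (hΩ : superInvolute Ω = -Ω) :
    superBracket Ω (superBracket Ω Ω) = 0 := by
  have hpar := fun t => superInvolute_superDeriv_of_odd hΩ t
  have h1 := superBracket_superBracket hΩ Ω
  have h2 : superBracket Ω (superBracket Ω Ω) = ∑ s, bracketSign s •
      ((if s.isRight then 1 else -1 : ℝ) • superDeriv s (superBracket Ω Ω)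
        * superDeriv (conj s) Ω) := by
    rw [superBracket_eq_of_odd hΩ (superBracket Ω Ω), ← conj.sum_comp]
    refine Finset.sum_congr rfl fun s _ => ?_
    rw [conj_conj, bracketSign_conj]
    have h3 : superInvolute (superDeriv s (superBracket Ω Ω))
        = if s.isRight then -superDeriv s (superBracket Ω Ω)
          else superDeriv s (superBracket Ω Ω) := by
      rw [superInvolute_superDeriv, superInvolute_superBracket_self hΩ]
    have h4 := hpar (conj s)
    rw [isRight_conj] at h4
    cases hs : s.isRight <;> simp only [hs, Bool.false_eq_true, if_true, if_false] at h3 h4 ⊢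
    · rw [SuperFn.mul_comm_of_even h3]
      simp only [smul_mul_assoc]
      module
    · rw [SuperFn.mul_comm_of_even h4]
      simp
  -- Both the Jacobi identity and graded symmetry express `{Ω, {Ω, Ω}}` by `{{Ω, Ω}, Ω}`, with
  -- different factors.
  have h3 : (2 : ℝ) • superBracket Ω (superBracket Ω Ω) = -superBracket Ω (superBracket Ω Ω) := by
    conv_lhs => rw [h1]
    conv_rhs => rw [h2]
    rw [Finset.smul_sum, ← Finset.sum_neg_distrib]
    refine Finset.sum_congr rfl fun s _ => ?_
    simp only [smul_mul_assoc]
    split_ifs <;> module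
  have h4 : (3 : ℝ) • superBracket Ω (superBracket Ω Ω) = 0 := by
    have : (3 : ℝ) • superBracket Ω (superBracket Ω Ω)
      = (2 : ℝ) • superBracket Ω (superBracket Ω Ω) + superBracket Ω (superBracket Ω Ω) := by module
    rw [this, h3, neg_add_cancel]
  exact (smul_eq_zero.1 h4).resolve_left (by norm_num)

theorem superBracket_eq_neg_of_odd {Ψ : SuperFn U A} (hΨ : superInvolute Ψ = -Ψ) (F : SuperFn U A) :
    superBracket F Ψ = -superBracket Ψ (superInvolute F) := by
  have hpar := fun t => superInvolute_superDeriv_of_odd hΨ t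
  have h1 : superBracket F Ψ = ∑ t, bracketSign t •
      ((if t.isRight then -superDeriv t (superInvolute F) else superDeriv t F)
        * superDeriv (conj t) Ψ) := by
    simp only [superBracket, rightDeriv_eq_neg, Fintype.sum_sum_type]
    simp [bracketSign, superDeriv, conj, Finset.sum_add_distrib, sub_eq_add_neg]
  rw [h1, superBracket_eq_of_odd hΨ, ← conj.sum_comp, ← Finset.sum_neg_distrib]
  refine Finset.sum_congr rfl fun t _ => ?_
  rw [conj_conj, bracketSign_conj, isRight_conj]
  have h2 := hpar t
  cases ht : t.isRight <;> simp only [ht, Bool.false_eq_true, if_true, if_false] at h2 ⊢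
  · rw [SuperFn.mul_eq_of_odd h2, superInvolute_superDeriv, isRight_conj, ht]
    simp
  · rw [SuperFn.mul_comm_of_even h2]
    simp

theorem superInvolute_superBracket {Ω : SuperFn U A} (hΩ : superInvolute Ω = -Ω) (F : SuperFn U A) :
    superInvolute (superBracket Ω F) = -superBracket Ω (superInvolute F) := by
  rw [superBracket_eq_of_odd hΩ, superBracket_eq_of_odd hΩ, map_sum, ← Finset.sum_neg_distrib]
  refine Finset.sum_congr rfl fun t _ => ?_
  rw [map_smul, map_mul, superInvolute_superDeriv_of_odd hΩ, superInvolute_superDeriv, isRight_conj]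
  split_ifs <;> simp

theorem superBracket_right_superBracket_right_eq_zero {Ψ : SuperFn U A}
    (hΨ : superInvolute Ψ = -Ψ) (hR : superBracket Ψ Ψ = 0) (F : SuperFn U A) :
    superBracket (superBracket F Ψ) Ψ = 0 := by
  rw [superBracket_eq_neg_of_odd hΨ, superBracket_eq_neg_of_odd hΨ, map_neg,
    superInvolute_superBracket hΨ, superInvolute_superInvolute, neg_neg,
    superBracket_superBracket_eq_zero hΨ hR, neg_zero]

theorem ghostSwap_superInvolute (F : SuperFn U A) :
    superInvolute (ghostSwap F) = ghostSwap (superInvolute F) := by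
  induction F using TensorProduct.induction_on with
  | zero => simp
  | add x y hx hy => simp only [map_add, hx, hy]
  | tmul f a =>
    exact congrArg (fun b => f ⊗ₜ[ℝ] b) (ExteriorAlgebra.involute_map _ a)

theorem bosonicDeriv_ghostSwap (v : PhaseSpace ι) (F : SuperFn U A) :
    bosonicDeriv v (ghostSwap F) = ghostSwap (bosonicDeriv v F) := by
  induction F using TensorProduct.induction_on with
  | zero => simp
  | add x y hx hy => simp only [map_add, hx, hy]
  | tmul f a => rfl

theorem leftDeriv_ghostSwap (d : Module.Dual ℝ ((A → ℝ) × (A → ℝ))) (F : SuperFn U A) :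
    leftDeriv d (ghostSwap F) = ghostSwap (leftDeriv
      (d.comp (LinearEquiv.prodComm ℝ (A → ℝ) (A → ℝ)).toLinearMap) F) := by
  induction F using TensorProduct.induction_on with
  | zero => simp
  | add x y hx hy => simp only [map_add, hx, hy]
  | tmul f a =>
    exact congrArg (fun b => f ⊗ₜ[ℝ] b) (ExteriorAlgebra.contractLeft_map _ d a)

/-- Exchanging ghosts and ghost momenta preserves the graded Poisson bracket. -/
theorem superBracket_ghostSwap (F G : SuperFn U A) :
    superBracket (ghostSwap F) (ghostSwap G) = ghostSwap (superBracket F G) := by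
  have h1 : ∀ a : A, (ghostCoord a).comp (LinearEquiv.prodComm ℝ (A → ℝ) (A → ℝ)).toLinearMap
      = ghostMomentumCoord a := fun a => rfl
  have h2 : ∀ a : A, (ghostMomentumCoord a).comp
      (LinearEquiv.prodComm ℝ (A → ℝ) (A → ℝ)).toLinearMap = ghostCoord a := fun a => rfl
  simp only [superBracket, rightDeriv_eq_neg, ghostSwap_superInvolute, bosonicDeriv_ghostSwap,
    leftDeriv_ghostSwap, h1, h2, map_add, map_sum, map_sub, map_mul, map_neg]
  congr 1
  exact Finset.sum_congr rfl fun a _ => add_comm _ _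

end SuperDeriv

/-! ### The bigrading of the ghost algebra -/

section NumberOperators

open CliffordAlgebra

variable {V : Type*} [AddCommGroup V] [Module ℝ V]

/-- The even derivation `v ∂_d` of the exterior algebra. -/
noncomputable def ExteriorAlgebra.euler (v : V) (d : Module.Dual ℝ V) :
    ExteriorAlgebra ℝ V →ₗ[ℝ] ExteriorAlgebra ℝ V :=
  (LinearMap.mulLeft ℝ (ExteriorAlgebra.ι ℝ v)).comp (CliffordAlgebra.contractLeft d)

theorem ExteriorAlgebra.euler_apply (v : V) (d : Module.Dual ℝ V) (a : ExteriorAlgebra ℝ V) :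
    ExteriorAlgebra.euler v d a = ExteriorAlgebra.ι ℝ v * CliffordAlgebra.contractLeft d a := rfl

theorem ExteriorAlgebra.euler_mul (v : V) (d : Module.Dual ℝ V) (a b : ExteriorAlgebra ℝ V) :
    ExteriorAlgebra.euler v d (a * b)
      = ExteriorAlgebra.euler v d a * b + a * ExteriorAlgebra.euler v d b := by
  simp only [ExteriorAlgebra.euler_apply]
  rw [contractLeft_mul, mul_add, ← mul_assoc a, ExteriorAlgebra.mul_ι_eq]
  simp only [mul_assoc]

theorem ExteriorAlgebra.euler_ι (v w : V) (d : Module.Dual ℝ V) :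
    ExteriorAlgebra.euler v d (ExteriorAlgebra.ι ℝ w) = d w • ExteriorAlgebra.ι ℝ v := by
  have h : CliffordAlgebra.contractLeft d (ExteriorAlgebra.ι ℝ w) = algebraMap ℝ _ (d w) :=
    contractLeft_ι (Q := 0) d w
  rw [ExteriorAlgebra.euler_apply, h, Algebra.smul_def, Algebra.commutes]

theorem ExteriorAlgebra.contractLeft_euler (v : V) (d d' : Module.Dual ℝ V)
    (a : ExteriorAlgebra ℝ V) : CliffordAlgebra.contractLeft d' (ExteriorAlgebra.euler v d a)
      = ExteriorAlgebra.euler v d (CliffordAlgebra.contractLeft d' a)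
        + d' v • CliffordAlgebra.contractLeft d a := by
  rw [ExteriorAlgebra.euler_apply, ExteriorAlgebra.euler_apply, contractLeft_comm d d', mul_neg]
  refine (contractLeft_ι_mul (Q := 0) d' v _).trans ?_
  rw [sub_eq_neg_add]

theorem ExteriorAlgebra.moduleFinite (V : Type*) [AddCommGroup V] [Module ℝ V]
    [Module.Finite ℝ V] : Module.Finite ℝ (ExteriorAlgebra ℝ V) :=
  Module.Finite.of_basis (Module.finBasis ℝ V).ExteriorAlgebra

end NumberOperators

section Bigrading

open CliffordAlgebra

variable {A : Type*} [Fintype A] [DecidableEq A]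

/-- The ghost number operator (counting ghosts only). -/
noncomputable def ghostNumber (A : Type*) [Fintype A] [DecidableEq A] :
    GhostAlgebra A →ₗ[ℝ] GhostAlgebra A :=
  ∑ a, ExteriorAlgebra.euler (Pi.single a 1, 0) (ghostCoord a)

/-- The operator counting ghost momenta. -/
noncomputable def momentumNumber (A : Type*) [Fintype A] [DecidableEq A] :
    GhostAlgebra A →ₗ[ℝ] GhostAlgebra A :=
  ∑ a, ExteriorAlgebra.euler (0, Pi.single a 1) (ghostMomentumCoord a)

/-- The elements of ghost degree `k` and ghost momentum degree `l`. Integer degrees avoid truncated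
subtraction; the component is zero when one of the degrees is negative. -/
noncomputable def ghostComponent (A : Type*) [Fintype A] [DecidableEq A] (k l : ℤ) :
    Submodule ℝ (GhostAlgebra A) :=
  Module.End.eigenspace (ghostNumber A) (k : ℝ) ⊓ Module.End.eigenspace (momentumNumber A) (l : ℝ)

theorem mem_ghostComponent {k l : ℤ} {x : GhostAlgebra A} : x ∈ ghostComponent A k l ↔
    ghostNumber A x = (k : ℝ) • x ∧ momentumNumber A x = (l : ℝ) • x := by
  rw [ghostComponent, Submodule.mem_inf, Module.End.mem_eigenspace_iff,
    Module.End.mem_eigenspace_iff]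

theorem mul_mem_ghostComponent {k l k' l' : ℤ} {x y : GhostAlgebra A}
    (hx : x ∈ ghostComponent A k l) (hy : y ∈ ghostComponent A k' l') :
    x * y ∈ ghostComponent A (k + k') (l + l') := by
  rw [mem_ghostComponent] at hx hy ⊢
  have h : ∀ (v : A → (A → ℝ) × (A → ℝ)) (d : A → Module.Dual ℝ ((A → ℝ) × (A → ℝ)))
      (m m' : ℤ), (∑ a, ExteriorAlgebra.euler (v a) (d a)) x = (m : ℝ) • x →
      (∑ a, ExteriorAlgebra.euler (v a) (d a)) y = (m' : ℝ) • y →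
      (∑ a, ExteriorAlgebra.euler (v a) (d a)) (x * y) = ((m + m' : ℤ) : ℝ) • (x * y) := by
    intro v d m m' h1 h2
    rw [LinearMap.sum_apply] at h1 h2 ⊢
    simp only [ExteriorAlgebra.euler_mul, Finset.sum_add_distrib]
    rw [← Finset.sum_mul, ← Finset.mul_sum, h1, h2, smul_mul_assoc, mul_smul_comm, ← add_smul]
    push_cast
    rfl
  exact ⟨h _ _ _ _ hx.1 hy.1, h _ _ _ _ hx.2 hy.2⟩

theorem one_mem_ghostComponent : (1 : GhostAlgebra A) ∈ ghostComponent A 0 0 := by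
  have h : ∀ d : Module.Dual ℝ ((A → ℝ) × (A → ℝ)),
      CliffordAlgebra.contractLeft d (1 : GhostAlgebra A) = 0 :=
    fun d => contractLeft_one (Q := 0) d
  rw [mem_ghostComponent]
  simp [ghostNumber, momentumNumber, ExteriorAlgebra.euler_apply, h]

theorem ghost_mem_ghostComponent (a : A) : ghost a ∈ ghostComponent A 1 0 := by
  rw [mem_ghostComponent, ghostNumber, momentumNumber, LinearMap.sum_apply, LinearMap.sum_apply]
  simp only [ghost, ExteriorAlgebra.euler_ι]
  simp [ghostCoord, ghostMomentumCoord, Pi.single_apply]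

theorem ghostMomentum_mem_ghostComponent (a : A) : ghostMomentum a ∈ ghostComponent A 0 1 := by
  rw [mem_ghostComponent, ghostNumber, momentumNumber, LinearMap.sum_apply, LinearMap.sum_apply]
  simp only [ghostMomentum, ExteriorAlgebra.euler_ι]
  simp [ghostCoord, ghostMomentumCoord, Pi.single_apply]

theorem contractLeft_ghostCoord_mem {k l : ℤ} {x : GhostAlgebra A}
    (hx : x ∈ ghostComponent A k l) (b : A) :
    CliffordAlgebra.contractLeft (ghostCoord b) x ∈ ghostComponent A (k - 1) l := by
  rw [mem_ghostComponent] at hx ⊢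
  have h1 := congrArg (CliffordAlgebra.contractLeft (ghostCoord b)) hx.1
  have h2 := congrArg (CliffordAlgebra.contractLeft (ghostCoord b)) hx.2
  simp only [ghostNumber, momentumNumber, LinearMap.sum_apply, map_sum, map_smul,
    ExteriorAlgebra.contractLeft_euler, Finset.sum_add_distrib] at h1 h2 ⊢
  have h3 : ∑ a, ghostCoord b ((Pi.single a 1 : A → ℝ), (0 : A → ℝ))
      • CliffordAlgebra.contractLeft (ghostCoord a) x
        = CliffordAlgebra.contractLeft (ghostCoord b) x := by
    simp [ghostCoord, Pi.single_apply]
  have h4 : ∑ a, ghostCoord b ((0 : A → ℝ), (Pi.single a 1 : A → ℝ))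
      • CliffordAlgebra.contractLeft (ghostMomentumCoord a) x = 0 := by
    simp [ghostCoord]
  rw [h3] at h1
  rw [h4, add_zero] at h2
  refine ⟨?_, h2⟩
  rw [eq_sub_of_add_eq h1]
  push_cast
  rw [sub_smul, one_smul]

theorem contractLeft_ghostMomentumCoord_mem {k l : ℤ} {x : GhostAlgebra A}
    (hx : x ∈ ghostComponent A k l) (b : A) :
    CliffordAlgebra.contractLeft (ghostMomentumCoord b) x ∈ ghostComponent A k (l - 1) := by
  rw [mem_ghostComponent] at hx ⊢
  have h1 := congrArg (CliffordAlgebra.contractLeft (ghostMomentumCoord b)) hx.1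
  have h2 := congrArg (CliffordAlgebra.contractLeft (ghostMomentumCoord b)) hx.2
  simp only [ghostNumber, momentumNumber, LinearMap.sum_apply, map_sum, map_smul,
    ExteriorAlgebra.contractLeft_euler, Finset.sum_add_distrib] at h1 h2 ⊢
  have h3 : ∑ a, ghostMomentumCoord b ((0 : A → ℝ), (Pi.single a 1 : A → ℝ))
      • CliffordAlgebra.contractLeft (ghostMomentumCoord a) x
        = CliffordAlgebra.contractLeft (ghostMomentumCoord b) x := by
    simp [ghostMomentumCoord, Pi.single_apply]
  have h4 : ∑ a, ghostMomentumCoord b ((Pi.single a 1 : A → ℝ), (0 : A → ℝ))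
      • CliffordAlgebra.contractLeft (ghostCoord a) x = 0 := by
    simp [ghostMomentumCoord]
  rw [h3] at h2
  rw [h4, add_zero] at h1
  refine ⟨h1, ?_⟩
  rw [eq_sub_of_add_eq h2]
  push_cast
  rw [sub_smul, one_smul]

theorem iSupIndep_ghostComponent :
    iSupIndep fun q : ℤ × ℤ => ghostComponent A q.1 q.2 := by
  -- The joint eigenvalues `(k, l)` are told apart by the single number `k + √2 l`.
  set T : Module.End ℝ (GhostAlgebra A) := ghostNumber A + Real.sqrt 2 • momentumNumber A with hT
  have hinj : Function.Injective fun q : ℤ × ℤ => (q.1 : ℝ) + Real.sqrt 2 * q.2 := by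
    rintro ⟨k, l⟩ ⟨k', l'⟩ h
    simp only at h
    have hl : l = l' := by
      by_contra hne
      have h1 : ((l : ℝ) - l') ≠ 0 := sub_ne_zero.2 (by exact_mod_cast hne)
      refine irrational_sqrt_two ⟨((k' - k : ℤ) : ℚ) / ((l - l' : ℤ) : ℚ), ?_⟩
      push_cast
      rw [div_eq_iff h1]
      linarith
    subst hl
    have : (k : ℝ) = k' := by linarith
    rw [Int.cast_injective this]
  refine (T.eigenspaces_iSupIndep.comp hinj).mono fun q x hx => ?_
  rw [mem_ghostComponent] at hx
  rw [Function.comp_apply, Module.End.mem_eigenspace_iff, hT, LinearMap.add_apply,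
    LinearMap.smul_apply, hx.1, hx.2, smul_smul, ← add_smul]

/-- The span of the monomials in `k` ghosts and `l` ghost momenta. -/
noncomputable def monomialSpan (A : Type*) [Fintype A] [DecidableEq A] (k l : ℕ) :
    Submodule ℝ (GhostAlgebra A) :=
  Submodule.span ℝ (Set.range fun q : (Fin k → A) × (Fin l → A) =>
    ghostMonomial q.1 * ghostMomentumMonomial q.2)

theorem ghostMonomial_cons {k : ℕ} (a : A) (α : Fin k → A) :
    ghostMonomial (Fin.cons a α : Fin (k + 1) → A) = ghost a * ghostMonomial α := by
  simp [ghostMonomial, List.ofFn_succ]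

theorem ghostMomentumMonomial_cons {k : ℕ} (a : A) (α : Fin k → A) :
    ghostMomentumMonomial (Fin.cons a α : Fin (k + 1) → A)
      = ghostMomentum a * ghostMomentumMonomial α := by
  simp [ghostMomentumMonomial, List.ofFn_succ]

theorem involute_ghostMonomial {k : ℕ} (α : Fin k → A) :
    involute (ghostMonomial α) = (-1 : ℝ) ^ k • ghostMonomial α := by
  have := involute_prod_map_ι (R := ℝ) (Q := 0)
    (List.ofFn fun j => ((Pi.single (α j) 1 : A → ℝ), (0 : A → ℝ)))
  rw [List.map_ofFn, List.length_ofFn] at this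
  exact this

theorem involute_ghostMomentumMonomial {k : ℕ} (α : Fin k → A) :
    involute (ghostMomentumMonomial α) = (-1 : ℝ) ^ k • ghostMomentumMonomial α := by
  have := involute_prod_map_ι (R := ℝ) (Q := 0)
    (List.ofFn fun j => ((0 : A → ℝ), (Pi.single (α j) 1 : A → ℝ)))
  rw [List.map_ofFn, List.length_ofFn] at this
  exact this

theorem involute_of_mem_monomialSpan {k l : ℕ} {x : GhostAlgebra A} (hx : x ∈ monomialSpan A k l) :
    involute x = (-1 : ℝ) ^ (k + l) • x := by
  induction hx using Submodule.span_induction with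
  | mem x hx =>
    obtain ⟨q, rfl⟩ := hx
    simp only [map_mul, involute_ghostMonomial, involute_ghostMomentumMonomial]
    rw [smul_mul_smul_comm, pow_add]
  | zero => simp
  | add x y _ _ hx hy => rw [map_add, hx, hy, smul_add]
  | smul r x _ hx => rw [map_smul, hx, smul_comm]

theorem ghostMonomial_eq_zero {k : ℕ} (hk : Fintype.card A < k) (α : Fin k → A) :
    ghostMonomial α = 0 := by
  refine AlternatingMap.map_eq_zero_of_not_injective (ExteriorAlgebra.ιMulti ℝ k)
    (fun j => ((Pi.single (α j) 1 : A → ℝ), (0 : A → ℝ))) fun h => ?_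
  have h1 : Function.Injective α := fun i j hij => h (by simp only [hij])
  have := Fintype.card_le_of_injective α h1
  rw [Fintype.card_fin] at this
  omega

theorem monomialSpan_le (k l : ℕ) : monomialSpan A k l ≤ ghostComponent A k l := by
  have h1 : ∀ {k : ℕ} (α : Fin k → A), ghostMonomial α ∈ ghostComponent A k 0 := by
    intro k
    induction k with
    | zero => intro α; exact one_mem_ghostComponent
    | succ k ih =>
      intro α
      rw [← Fin.cons_self_tail α, ghostMonomial_cons]
      have := mul_mem_ghostComponent (ghost_mem_ghostComponent (α 0)) (ih (Fin.tail α))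
      rwa [add_comm (1 : ℤ)] at this
  have h2 : ∀ {k : ℕ} (α : Fin k → A), ghostMomentumMonomial α ∈ ghostComponent A 0 k := by
    intro k
    induction k with
    | zero => intro α; exact one_mem_ghostComponent
    | succ k ih =>
      intro α
      rw [← Fin.cons_self_tail α, ghostMomentumMonomial_cons]
      have := mul_mem_ghostComponent (ghostMomentum_mem_ghostComponent (α 0)) (ih (Fin.tail α))
      rwa [add_comm (1 : ℤ)] at this
  refine Submodule.span_le.2 ?_
  rintro _ ⟨q, rfl⟩
  have := mul_mem_ghostComponent (h1 q.1) (h2 q.2)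
  rwa [zero_add, add_zero] at this

/-- Every element of the ghost algebra is a combination of monomials in normal order. -/
theorem iSup_monomialSpan : ⨆ p : ℕ × ℕ, monomialSpan A p.1 p.2 = ⊤ := by
  set N := ⨆ p : ℕ × ℕ, monomialSpan A p.1 p.2 with hN
  have hmem : ∀ {k l : ℕ} (α : Fin k → A) (β : Fin l → A),
      ghostMonomial α * ghostMomentumMonomial β ∈ N := fun {k l} α β =>
    Submodule.mem_iSup_of_mem (k, l) (Submodule.subset_span ⟨(α, β), rfl⟩)
  have hind : ∀ v : (A → ℝ) × (A → ℝ), (∀ {k l : ℕ} (α : Fin k → A) (β : Fin l → A),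
      ExteriorAlgebra.ι ℝ v * (ghostMonomial α * ghostMomentumMonomial β) ∈ N) →
      ∀ x ∈ N, ExteriorAlgebra.ι ℝ v * x ∈ N := by
    intro v hv x hx
    have : N ≤ N.comap (LinearMap.mulLeft ℝ (ExteriorAlgebra.ι ℝ v)) := by
      conv_lhs => rw [hN]
      refine iSup_le fun p => Submodule.span_le.2 ?_
      rintro _ ⟨q, rfl⟩
      exact hv q.1 q.2
    exact this hx
  have hg : ∀ (a : A), ∀ x ∈ N, ghost a * x ∈ N := fun a => hind _ fun α β => by
    have := hmem (Fin.cons a α) β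
    rwa [ghostMonomial_cons, mul_assoc] at this
  have hp : ∀ (a : A), ∀ x ∈ N, ghostMomentum a * x ∈ N := fun a => hind _ fun {k l} α β => by
    have h1 := ExteriorAlgebra.mul_ι_eq (involute (ghostMonomial α)) ((0 : A → ℝ), Pi.single a 1)
    rw [involute_involute, involute_ghostMonomial] at h1
    have h2 := hmem α (Fin.cons a β)
    rw [ghostMomentumMonomial_cons] at h2
    rw [← mul_assoc, ← h1, smul_mul_assoc, smul_mul_assoc, mul_assoc]
    exact N.smul_mem _ h2
  refine eq_top_iff.2 fun x _ => ?_
  induction x using CliffordAlgebra.left_induction with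
  | algebraMap r =>
    rw [Algebra.algebraMap_eq_smul_one]
    refine N.smul_mem _ ?_
    have := hmem (Fin.elim0 : Fin 0 → A) (Fin.elim0 : Fin 0 → A)
    rwa [ghostMonomial, ghostMomentumMonomial, List.ofFn_zero, List.ofFn_zero, List.prod_nil,
      mul_one] at this
  | add x y hx hy => exact N.add_mem (hx trivial) (hy trivial)
  | ι_mul x v hx =>
    have hv : ExteriorAlgebra.ι ℝ v = ∑ a, v.1 a • ghost a + ∑ a, v.2 a • ghostMomentum a := by
      have h1 : ∀ a : A → ℝ, ∑ c, a c • (Pi.single c 1 : A → ℝ) = a := fun a =>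
        (pi_eq_sum_univ' a).symm
      have h2 : v = ∑ a, v.1 a • ((Pi.single a 1 : A → ℝ), (0 : A → ℝ))
          + ∑ a, v.2 a • ((0 : A → ℝ), (Pi.single a 1 : A → ℝ)) := by
        refine Prod.ext ?_ ?_ <;> simp [Prod.fst_sum, Prod.snd_sum, h1]
      conv_lhs => rw [h2]
      simp only [map_add, map_sum, map_smul, ghost, ghostMomentum]
    have h3 : ExteriorAlgebra.ι ℝ v * x ∈ N := by
      rw [hv, add_mul, Finset.sum_mul, Finset.sum_mul]
      refine N.add_mem (Submodule.sum_mem _ fun a _ => ?_) (Submodule.sum_mem _ fun a _ => ?_) <;>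
        rw [smul_mul_assoc]
      exacts [N.smul_mem _ (hg a x (hx trivial)), N.smul_mem _ (hp a x (hx trivial))]
    exact h3

/-- An element of bidegree `(k, l)` is a combination of monomials of that bidegree. -/
theorem ghostComponent_le (k l : ℤ) : ghostComponent A k l
    ≤ ⨆ p : {p : ℕ × ℕ // (p.1 : ℤ) = k ∧ (p.2 : ℤ) = l}, monomialSpan A p.1.1 p.1.2 := by
  intro x hx
  have h1 : (⊤ : Submodule ℝ (GhostAlgebra A))
      ≤ (⨆ p : {p : ℕ × ℕ // (p.1 : ℤ) = k ∧ (p.2 : ℤ) = l}, monomialSpan A p.1.1 p.1.2)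
        ⊔ ⨆ (q : ℤ × ℤ) (_ : q ≠ (k, l)), ghostComponent A q.1 q.2 := by
    rw [← iSup_monomialSpan]
    refine iSup_le fun p => ?_
    by_cases hp : (p.1 : ℤ) = k ∧ (p.2 : ℤ) = l
    · exact le_sup_of_le_left (le_iSup (fun p : {p : ℕ × ℕ // (p.1 : ℤ) = k ∧ (p.2 : ℤ) = l} =>
        monomialSpan A p.1.1 p.1.2) ⟨p, hp⟩)
    · refine le_sup_of_le_right ((monomialSpan_le p.1 p.2).trans ?_)
      exact le_iSup₂_of_le ((p.1 : ℤ), (p.2 : ℤ)) (fun h => hp ⟨congrArg Prod.fst h,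
        congrArg Prod.snd h⟩) le_rfl
  obtain ⟨y, hy, z, hz, hyz⟩ := Submodule.mem_sup.1 (h1 (Submodule.mem_top (x := x)))
  have hy' : y ∈ ghostComponent A k l := by
    have : ⨆ p : {p : ℕ × ℕ // (p.1 : ℤ) = k ∧ (p.2 : ℤ) = l}, monomialSpan A p.1.1 p.1.2
        ≤ ghostComponent A k l := iSup_le fun p => by
      have := monomialSpan_le (A := A) p.1.1 p.1.2
      rwa [p.2.1, p.2.2] at this
    exact this hy
  have hz' : z ∈ ghostComponent A k l := by
    rw [← add_sub_cancel_left y z, hyz]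
    exact Submodule.sub_mem _ hx hy'
  have hz0 : z = 0 := Submodule.disjoint_def.1 (iSupIndep_ghostComponent (k, l)) z hz' hz
  rw [← hyz, hz0, add_zero]
  exact hy

theorem ghostComponent_natCast_le (k l : ℕ) : ghostComponent A k l ≤ monomialSpan A k l := by
  refine (ghostComponent_le _ _).trans (iSup_le ?_)
  rintro ⟨⟨k', l'⟩, h1, h2⟩
  simp only [Nat.cast_inj] at h1 h2
  subst h1 h2
  exact le_rfl

theorem ghostComponent_eq_bot_of_neg (k : ℤ) {l : ℤ} (hl : l < 0) : ghostComponent A k l = ⊥ := by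
  refine eq_bot_iff.2 ((ghostComponent_le _ _).trans (iSup_le ?_))
  rintro ⟨p, h1, h2⟩
  omega

theorem ghostComponent_eq_bot_of_card_lt {k : ℤ} (hk : Fintype.card A < k) (l : ℤ) :
    ghostComponent A k l = ⊥ := by
  refine eq_bot_iff.2 ((ghostComponent_le _ _).trans (iSup_le ?_))
  rintro ⟨p, h1, h2⟩
  refine Submodule.span_le.2 ?_
  rintro _ ⟨q, rfl⟩
  have : Fintype.card A < p.1 := by omega
  simp [ghostMonomial_eq_zero this]

/-- The elements of ghost number (ghosts minus ghost momenta) `g` with at least `n` ghost momenta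
in each term. -/
noncomputable def ghostFiltration (A : Type*) [Fintype A] [DecidableEq A] (g n : ℤ) :
    Submodule ℝ (GhostAlgebra A) :=
  ⨆ l : {l : ℤ // n ≤ l}, ghostComponent A (l + g) l

theorem ghostComponent_le_ghostFiltration {g n l : ℤ} (h : n ≤ l) {k : ℤ} (hk : k = l + g) :
    ghostComponent A k l ≤ ghostFiltration A g n := by
  subst hk
  exact le_iSup (fun l : {l : ℤ // n ≤ l} => ghostComponent A (l + g) l) ⟨l, h⟩

theorem ghostFiltration_induction {g n : ℤ} {N : Submodule ℝ (GhostAlgebra A)}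
    {f : GhostAlgebra A →ₗ[ℝ] GhostAlgebra A}
    (h : ∀ l, n ≤ l → ∀ x ∈ ghostComponent A (l + g) l, f x ∈ N) :
    ∀ x ∈ ghostFiltration A g n, f x ∈ N := by
  have : ghostFiltration A g n ≤ N.comap f := iSup_le fun l x hx => h l.1 l.2 x hx
  exact this

theorem ghostFiltration_anti {g m n : ℤ} (h : m ≤ n) :
    ghostFiltration A g n ≤ ghostFiltration A g m :=
  iSup_le fun l => ghostComponent_le_ghostFiltration (h.trans l.2) rfl

theorem mul_mem_ghostFiltration {g n g' n' : ℤ} {x y : GhostAlgebra A}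
    (hx : x ∈ ghostFiltration A g n) (hy : y ∈ ghostFiltration A g' n') :
    x * y ∈ ghostFiltration A (g + g') (n + n') := by
  refine ghostFiltration_induction (f := LinearMap.mulLeft ℝ x) (fun l hl y hy => ?_) y hy
  refine ghostFiltration_induction (f := LinearMap.mulRight ℝ y) (fun l' hl' x hx => ?_) x hx
  exact ghostComponent_le_ghostFiltration (by omega) (by omega) (mul_mem_ghostComponent hx hy)

theorem contractLeft_ghostCoord_mem_ghostFiltration {g n : ℤ} {x : GhostAlgebra A}
    (hx : x ∈ ghostFiltration A g n) (b : A) :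
    CliffordAlgebra.contractLeft (ghostCoord b) x ∈ ghostFiltration A (g - 1) n :=
  ghostFiltration_induction (f := CliffordAlgebra.contractLeft (ghostCoord b)) (fun l hl x hx =>
    ghostComponent_le_ghostFiltration hl (by omega) (contractLeft_ghostCoord_mem hx b)) x hx

theorem contractLeft_ghostMomentumCoord_mem_ghostFiltration {g n : ℤ} {x : GhostAlgebra A}
    (hx : x ∈ ghostFiltration A g n) (b : A) :
    CliffordAlgebra.contractLeft (ghostMomentumCoord b) x ∈ ghostFiltration A (g + 1) (n - 1) :=
  ghostFiltration_induction (f := CliffordAlgebra.contractLeft (ghostMomentumCoord b))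
    (fun l hl x hx => ghostComponent_le_ghostFiltration (by omega) (by omega)
      (contractLeft_ghostMomentumCoord_mem hx b)) x hx

theorem ghostFiltration_eq_bot {g n : ℤ} (h : Fintype.card A < n + g) :
    ghostFiltration A g n = ⊥ := by
  refine eq_bot_iff.2 (iSup_le fun l => ?_)
  rw [ghostComponent_eq_bot_of_card_lt (by have := l.2; omega)]

theorem disjoint_ghostComponent_ghostFiltration (g n : ℤ) :
    Disjoint (ghostComponent A (n + g) n) (ghostFiltration A g (n + 1)) := by
  refine (iSupIndep_ghostComponent (A := A) (n + g, n)).mono_right (iSup_le fun l => ?_)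
  refine le_iSup₂_of_le ((l + g, l) : ℤ × ℤ) (fun h => ?_) le_rfl
  have h1 := l.2
  have h2 := congrArg Prod.snd h
  simp only at h2
  omega

/-- The part of lowest ghost momentum degree can be extracted by one linear map. -/
theorem exists_projection_ghostComponent (g n : ℤ) :
    ∃ π : GhostAlgebra A →ₗ[ℝ] GhostAlgebra A, ∀ x ∈ ghostFiltration A g n,
      π x ∈ ghostComponent A (n + g) n ∧ x - π x ∈ ghostFiltration A g (n + 1) := by
  obtain ⟨q, hq1, hq2⟩ := (disjoint_ghostComponent_ghostFiltration (A := A) g n).symm.exists_isCompl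
  have hle : ghostFiltration A g n
      ≤ ghostComponent A (n + g) n ⊔ ghostFiltration A g (n + 1) := by
    refine iSup_le fun l => ?_
    rcases l.2.eq_or_lt with h | h
    · rw [← h]
      exact le_sup_left
    · exact le_sup_of_le_right (ghostComponent_le_ghostFiltration (by omega) rfl)
  refine ⟨(ghostComponent A (n + g) n).projection q hq2.symm, fun x hx => ?_⟩
  obtain ⟨y, hy, z, hz, rfl⟩ := Submodule.mem_sup.1 (hle hx)
  rw [map_add, Submodule.projection_apply_of_mem_left _ hy,
    (Submodule.projection_apply_eq_zero_iff _).2 (hq1 hz), add_zero, add_sub_cancel_left]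
  exact ⟨hy, hz⟩

end Bigrading

/-! ### Pointwise evaluation of superfunctions -/

section Evaluation

open CliffordAlgebra

variable {ι A : Type*} [Fintype ι] {U : Opens (PhaseSpace ι)}

/-- The value of a superfunction at a point of the body, an element of the ghost algebra. -/
noncomputable def superEval (x : U) : SuperFn U A →ₐ[ℝ] GhostAlgebra A :=
  Algebra.TensorProduct.lift
    ((Algebra.ofId ℝ (GhostAlgebra A)).comp ((Pi.evalAlgHom ℝ (fun _ : U => ℝ) x).comp
      (SmoothFn U).val)) (AlgHom.id ℝ (GhostAlgebra A)) fun f a =>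
      show Commute (algebraMap ℝ (GhostAlgebra A) (f.1 x)) a from Algebra.commutes _ _

theorem superEval_tmul (x : U) (f : SmoothFn U) (a : GhostAlgebra A) :
    superEval x (f ⊗ₜ[ℝ] a) = f.1 x • a :=
  (Algebra.TensorProduct.lift_tmul _ _ _ f a).trans
    (Algebra.smul_def (A := GhostAlgebra A) (f.1 x) a).symm

/-- The coefficient function of a superfunction selected by a linear form on the ghost algebra. -/
noncomputable def superCoeff (φ : GhostAlgebra A →ₗ[ℝ] ℝ) : SuperFn U A →ₗ[ℝ] SmoothFn U :=
  (TensorProduct.rid ℝ (SmoothFn U)).toLinearMap.comp (LinearMap.lTensor (SmoothFn U) φ)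

theorem superCoeff_tmul (φ : GhostAlgebra A →ₗ[ℝ] ℝ) (f : SmoothFn U) (a : GhostAlgebra A) :
    superCoeff φ (f ⊗ₜ[ℝ] a) = φ a • f := rfl

theorem superCoeff_apply (φ : GhostAlgebra A →ₗ[ℝ] ℝ) (F : SuperFn U A) (x : U) :
    (superCoeff φ F).1 x = φ (superEval x F) := by
  induction F using TensorProduct.induction_on with
  | zero => rw [map_zero, map_zero, map_zero]; rfl
  | add F G hF hG => rw [map_add, map_add, map_add, ← hF, ← hG]; rfl
  | tmul f a =>
    rw [superCoeff_tmul, superEval_tmul, map_smul, smul_eq_mul, mul_comm]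
    rfl

theorem superCoeff_bosonicDeriv (φ : GhostAlgebra A →ₗ[ℝ] ℝ) (v : PhaseSpace ι)
    (F : SuperFn U A) : superCoeff φ (bosonicDeriv v F) = smoothFnDeriv v (superCoeff φ F) := by
  induction F using TensorProduct.induction_on with
  | zero => rw [map_zero, map_zero, map_zero]
  | add F G hF hG => rw [map_add, map_add, map_add, map_add, hF, hG]
  | tmul f a => rw [bosonicDeriv_tmul, superCoeff_tmul, superCoeff_tmul, map_smul]

theorem superEval_leftDeriv (x : U) (d : Module.Dual ℝ ((A → ℝ) × (A → ℝ))) (F : SuperFn U A) :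
    superEval x (leftDeriv d F) = CliffordAlgebra.contractLeft d (superEval x F) := by
  induction F using TensorProduct.induction_on with
  | zero => rw [map_zero, map_zero, map_zero]
  | add F G hF hG => rw [map_add, map_add, map_add, map_add, hF, hG]
  | tmul f a => rw [leftDeriv_tmul, superEval_tmul, superEval_tmul, map_smul]

theorem superEval_superInvolute (x : U) (F : SuperFn U A) :
    superEval x (superInvolute F) = involute (superEval x F) := by
  induction F using TensorProduct.induction_on with
  | zero => rw [map_zero, map_zero, map_zero]
  | add F G hF hG => rw [map_add, map_add, map_add, map_add, hF, hG]
  | tmul f a => rw [superInvolute_tmul, superEval_tmul, superEval_tmul, map_smul]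

theorem superEval_lTensor (x : U) (π : GhostAlgebra A →ₗ[ℝ] GhostAlgebra A) (F : SuperFn U A) :
    superEval x (LinearMap.lTensor (SmoothFn U) π F) = π (superEval x F) := by
  induction F using TensorProduct.induction_on with
  | zero => rw [map_zero, map_zero, map_zero]
  | add F G hF hG => rw [map_add, map_add, map_add, map_add, hF, hG]
  | tmul f a => rw [LinearMap.lTensor_tmul, superEval_tmul, superEval_tmul, map_smul]

/-- Differentiation along the body preserves every condition that confines the values of a
superfunction to a fixed subspace of the ghost algebra. -/
theorem superEval_bosonicDeriv_mem {W : Submodule ℝ (GhostAlgebra A)} {F : SuperFn U A}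
    (hF : ∀ x, superEval x F ∈ W) (v : PhaseSpace ι) (x : U) :
    superEval x (bosonicDeriv v F) ∈ W := by
  by_contra hv
  obtain ⟨φ, hne, hφ⟩ := W.exists_le_ker_of_notMem hv
  refine hne ?_
  have h0 : superCoeff φ F = 0 := Subtype.ext (funext fun y =>
    (superCoeff_apply φ F y).trans (hφ (hF y)))
  rw [← superCoeff_apply, superCoeff_bosonicDeriv, h0, map_zero]
  rfl

variable [Fintype A]

/-- Superfunctions are determined by their values. -/
theorem SuperFn.ext_superEval {F G : SuperFn U A} (h : ∀ x, superEval x F = superEval x G) :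
    F = G := by
  have := ExteriorAlgebra.moduleFinite ((A → ℝ) × (A → ℝ))
  set b := Module.finBasis ℝ (GhostAlgebra A) with hb
  have hexp : ∀ F : SuperFn U A, F = ∑ k, superCoeff (b.coord k) F ⊗ₜ[ℝ] b k := by
    intro F
    induction F using TensorProduct.induction_on with
    | zero =>
      rw [Finset.sum_eq_zero]
      intro k _
      rw [map_zero, TensorProduct.zero_tmul]
    | add F G hF hG =>
      refine (congrArg₂ (· + ·) hF hG).trans ?_
      rw [← Finset.sum_add_distrib]
      refine Finset.sum_congr rfl fun k _ => ?_
      rw [map_add, TensorProduct.add_tmul]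
    | tmul f a =>
      conv_lhs => rw [← b.sum_repr a, TensorProduct.tmul_sum]
      refine Finset.sum_congr rfl fun k _ => ?_
      rw [superCoeff_tmul, TensorProduct.smul_tmul]
      rfl
  rw [hexp F, hexp G]
  refine Finset.sum_congr rfl fun k _ => ?_
  congr 1
  refine Subtype.ext (funext fun x => ?_)
  rw [superCoeff_apply, superCoeff_apply, h x]

variable [DecidableEq A]

/-- The Koszul complex of a regular family `c`, with the ghost momenta as its generators, is exact
in positive degrees, and in degree zero its homology consists of functions on the surface. -/
theorem exists_superFn_koszul_primitive {c : A → PhaseSpace ι → ℝ}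
    (hc : ∀ a, ContDiffOn ℝ ∞ (c a) U)
    (hreg : ∀ x ∈ U, (∀ a, c a x = 0) → LinearIndependent ℝ fun a => fderiv ℝ (c a) x)
    {k : ℤ} {j : ℕ} {z : SuperFn U A} (hz : ∀ x, superEval x z ∈ ghostComponent A k j)
    (hδ : ∀ x : U,
      ∑ a, c a x.1 • CliffordAlgebra.contractLeft (ghostMomentumCoord a) (superEval x z) = 0)
    (hj₀ : j = 0 → ∀ x : U, (∀ a, c a x.1 = 0) → superEval x z = 0) :
    ∃ w : SuperFn U A, ∀ x : U, superEval x w ∈ ghostComponent A k (j + 1) ∧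
      ∑ a, c a x.1 • CliffordAlgebra.contractLeft (ghostMomentumCoord a) (superEval x w)
        = superEval x z := by
  have := ExteriorAlgebra.moduleFinite ((A → ℝ) × (A → ℝ))
  set b := Module.finBasis ℝ (GhostAlgebra A) with hb
  set e := b.equivFun with he
  -- Superfunctions as vector-valued functions, through a basis of the ghost algebra.
  have htr : ∀ f : GhostAlgebra A →ₗ[ℝ] GhostAlgebra A, ∃ g : (Fin _ → ℝ) →L[ℝ] (Fin _ → ℝ),
      ∀ v, g v = e (f (e.symm v)) := fun f =>
    ⟨LinearMap.toContinuousLinearMap (e.toLinearMap ∘ₗ f ∘ₗ e.symm.toLinearMap), fun v => rfl⟩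
  choose p hp using fun a : A => htr (LinearMap.mulLeft ℝ (ghostMomentum a))
  choose d hd using fun a : A => htr (CliffordAlgebra.contractLeft (ghostMomentumCoord a))
  set Z : PhaseSpace ι → Fin _ → ℝ := fun y k => zeroExt U (superCoeff (b.coord k) z).1 y with hZ
  have hZe : ∀ x : U, Z x.1 = e (superEval x z) := fun x => funext fun k => by
    rw [hZ]
    simp only
    rw [zeroExt_apply _ x.2, superCoeff_apply]
    rfl
  have key := exists_koszul_primitive U hc hreg p d
    (S := (ghostComponent A k j).map e.toLinearMap)
    (T := (ghostComponent A k (j + 1)).map e.toLinearMap) (j := j) (z := Z) ?_ ?_ ?_ ?_ ?_ ?_ ?_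
  · obtain ⟨w, hw, hwz⟩ := key
    have hws : ∀ k, ContDiffOn ℝ ∞ (zeroExt U fun x : U => w x.1 k) U := fun k =>
      (contDiffOn_pi.1 hw k).congr fun x hx => zeroExt_apply _ hx
    refine ⟨∑ k, (⟨fun x : U => w x.1 k, hws k⟩ : SmoothFn U) ⊗ₜ[ℝ] b k, fun x => ?_⟩
    have hev : superEval x (∑ k, (⟨fun x : U => w x.1 k, hws k⟩ : SmoothFn U) ⊗ₜ[ℝ] b k)
        = e.symm (w x.1) := by
      rw [map_sum, he, Module.Basis.equivFun_symm_apply]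
      exact Finset.sum_congr rfl fun k _ => superEval_tmul _ _ _
    obtain ⟨h1, h2⟩ := hwz x.1 x.2
    rw [hev]
    refine ⟨?_, e.injective ?_⟩
    · obtain ⟨y, hy, hyw⟩ := h1
      rw [← hyw]
      change e.symm (e y) ∈ _
      rwa [e.symm_apply_apply]
    · rw [← hZe, ← h2, map_sum]
      refine Finset.sum_congr rfl fun a _ => ?_
      rw [map_smul, hd]
  · intro a a' v
    rw [hd, hp, hd, hp, e.symm_apply_apply, e.symm_apply_apply]
    have h1 := contractLeft_ι_mul (Q := 0) (ghostMomentumCoord a')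
      ((0 : A → ℝ), (Pi.single a 1 : A → ℝ)) (e.symm v)
    have h2 : ghostMomentumCoord a' ((0 : A → ℝ), (Pi.single a 1 : A → ℝ))
        = if a = a' then 1 else 0 := by
      simp [ghostMomentumCoord, Pi.single_apply, eq_comm]
    rw [h2] at h1
    refine (congrArg e h1).trans ?_
    rw [map_sub, map_smul, e.apply_symm_apply, ite_smul, one_smul, zero_smul]
    rfl
  · rintro a _ ⟨y, hy, rfl⟩
    refine ⟨ghostMomentum a * y, ?_, ?_⟩
    · have := mul_mem_ghostComponent (ghostMomentum_mem_ghostComponent a) hy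
      rwa [zero_add, add_comm (1 : ℤ)] at this
    · rw [hp]
      change _ = e (ghostMomentum a * e.symm (e y))
      rw [e.symm_apply_apply]
      rfl
  · exact contDiffOn_pi.2 fun k => (superCoeff (b.coord k) z).2
  · intro x hx
    exact ⟨_, hz ⟨x, hx⟩, (hZe ⟨x, hx⟩).symm⟩
  · intro x hx
    have h1 := (mem_ghostComponent.1 (hz ⟨x, hx⟩)).2
    rw [momentumNumber, LinearMap.sum_apply] at h1
    rw [show Z x = _ from hZe ⟨x, hx⟩]
    have h2 := congrArg e h1
    rw [map_sum, map_smul] at h2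
    refine Eq.trans (Finset.sum_congr rfl fun a _ => ?_) (h2.trans ?_)
    · rw [hp, hd, e.symm_apply_apply, e.symm_apply_apply]
      rfl
    · rw [Int.cast_natCast]
  · intro x hx
    have h1 := congrArg e (hδ ⟨x, hx⟩)
    rw [map_sum, map_zero] at h1
    refine Eq.trans (Finset.sum_congr rfl fun a _ => ?_) h1
    rw [show Z x = _ from hZe ⟨x, hx⟩, hd, e.symm_apply_apply, map_smul]
  · intro hj x hx
    rw [show Z x = _ from hZe ⟨x, hx⟩]
    refine ⟨fun a => ?_, fun h => ?_⟩
    · have h1 := contractLeft_ghostMomentumCoord_mem (hz ⟨x, hx⟩) a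
      rw [ghostComponent_eq_bot_of_neg _ (by omega), Submodule.mem_bot] at h1
      rw [hd, e.symm_apply_apply, h1, map_zero]
    · rw [hj₀ hj ⟨x, hx⟩ h, map_zero]

/-- A superfunction whose values are of bidegree `(k, l)` is a combination of monomials. -/
theorem exists_eq_sum_monomial {k l : ℕ} {F : SuperFn U A}
    (hF : ∀ x, superEval x F ∈ ghostComponent A k l) :
    ∃ u : (Fin k → A) → (Fin l → A) → SmoothFn U,
      F = ∑ α, ∑ β, u α β ⊗ₜ[ℝ] (ghostMonomial α * ghostMomentumMonomial β) := by
  set m : (Fin k → A) × (Fin l → A) → GhostAlgebra A := fun q =>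
    ghostMonomial q.1 * ghostMomentumMonomial q.2 with hm
  set L := Fintype.linearCombination ℝ m with hL
  obtain ⟨g, hg⟩ := L.rangeRestrict.exists_rightInverse_of_surjective L.range_rangeRestrict
  obtain ⟨s, hs⟩ := LinearMap.exists_extend g
  have hsL : ∀ y ∈ ghostComponent A k l, L (s y) = y := by
    intro y hy
    have hy' : y ∈ LinearMap.range L := by
      rw [hL, Fintype.range_linearCombination]
      exact ghostComponent_natCast_le k l hy
    have h1 : s y = g ⟨y, hy'⟩ := LinearMap.congr_fun hs ⟨y, hy'⟩
    rw [h1]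
    exact congrArg Subtype.val (LinearMap.congr_fun hg ⟨y, hy'⟩)
  refine ⟨fun α β => superCoeff (LinearMap.proj (α, β) ∘ₗ s) F, SuperFn.ext_superEval fun x => ?_⟩
  rw [← Fintype.sum_prod_type' (f := fun α β => superCoeff (LinearMap.proj (α, β) ∘ₗ s) F ⊗ₜ[ℝ]
    (ghostMonomial α * ghostMomentumMonomial β)), map_sum]
  conv_lhs => rw [← hsL _ (hF x), hL, Fintype.linearCombination_apply]
  refine Finset.sum_congr rfl fun q _ => ?_
  rw [superEval_tmul, superCoeff_apply]
  rfl

end Evaluation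

/-! ### Existence of BRST charges -/

section BRSTCharge

open CliffordAlgebra

variable {ι A : Type*} [Fintype ι] [DecidableEq ι] [Fintype A] [DecidableEq A]
  {U : Opens (PhaseSpace ι)}

theorem superBracket_add_right {Ω : SuperFn U A} (hΩ : superInvolute Ω = -Ω) (F G : SuperFn U A) :
    superBracket Ω (F + G) = superBracket Ω F + superBracket Ω G := by
  rw [superBracket_eq_of_odd hΩ, superBracket_eq_of_odd hΩ, superBracket_eq_of_odd hΩ,
    ← Finset.sum_add_distrib]
  refine Finset.sum_congr rfl fun t _ => ?_
  rw [map_add, mul_add, smul_add]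

theorem superBracket_comm_of_odd {Ω Ψ : SuperFn U A} (hΩ : superInvolute Ω = -Ω)
    (hΨ : superInvolute Ψ = -Ψ) : superBracket Ω Ψ = superBracket Ψ Ω := by
  have h1 : superBracket Ψ (-Ω) = -superBracket Ψ Ω := by
    rw [superBracket_eq_of_odd hΨ, superBracket_eq_of_odd hΨ, ← Finset.sum_neg_distrib]
    refine Finset.sum_congr rfl fun t _ => ?_
    rw [map_neg, mul_neg, smul_neg]
  rw [superBracket_eq_neg_of_odd hΨ, hΩ, h1, neg_neg]

theorem superInvolute_add_of_odd {F G : SuperFn U A} (hF : superInvolute F = -F)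
    (hG : superInvolute G = -G) : superInvolute (F + G) = -(F + G) := by
  rw [map_add, hF, hG, neg_add]

theorem superBracket_add_self {Ω v : SuperFn U A} (hΩ : superInvolute Ω = -Ω)
    (hv : superInvolute v = -v) : superBracket (Ω + v) (Ω + v)
      = superBracket Ω Ω + (2 : ℝ) • superBracket Ω v + superBracket v v := by
  have h := superInvolute_add_of_odd hΩ hv
  rw [superBracket_add_right h, superBracket_comm_of_odd h hΩ, superBracket_comm_of_odd h hv,
    superBracket_add_right hΩ, superBracket_add_right hv, superBracket_comm_of_odd hv hΩ, two_smul]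
  abel

/-- Bosonic derivatives preserve the filtration, a ghost derivative lowers the ghost number, and a
ghost momentum derivative raises it at the expense of one ghost momentum. -/
theorem superEval_superDeriv_mem {g n : ℤ} {F : SuperFn U A}
    (hF : ∀ x, superEval x F ∈ ghostFiltration A g n) (x : U) :
    (∀ i, superEval x (superDeriv (.inl i) F) ∈ ghostFiltration A g n) ∧
    (∀ a, superEval x (superDeriv (.inr (.inl a)) F) ∈ ghostFiltration A (g - 1) n) ∧
    ∀ a, superEval x (superDeriv (.inr (.inr a)) F) ∈ ghostFiltration A (g + 1) (n - 1) := by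
  refine ⟨?_, fun a => ?_, fun a => ?_⟩
  · rintro (i | i)
    exacts [superEval_bosonicDeriv_mem hF _ x, superEval_bosonicDeriv_mem hF _ x]
  · change superEval x (leftDeriv (ghostCoord a) F) ∈ _
    rw [superEval_leftDeriv]
    exact contractLeft_ghostCoord_mem_ghostFiltration (hF x) a
  · change superEval x (leftDeriv (ghostMomentumCoord a) F) ∈ _
    rw [superEval_leftDeriv]
    exact contractLeft_ghostMomentumCoord_mem_ghostFiltration (hF x) a

theorem superEval_superBracket {Ω : SuperFn U A} (hΩ : superInvolute Ω = -Ω) (F : SuperFn U A)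
    (x : U) : superEval x (superBracket Ω F) =
      ∑ i, bracketSign (.inl i : (ι ⊕ ι) ⊕ (A ⊕ A)) • (superEval x (superDeriv (.inl i) Ω)
          * superEval x (superDeriv (conj (.inl i)) F))
      + (∑ a, superEval x (superDeriv (.inr (.inl a)) Ω)
          * superEval x (superDeriv (.inr (.inr a)) F)
        + ∑ a, superEval x (superDeriv (.inr (.inr a)) Ω)
          * superEval x (superDeriv (.inr (.inl a)) F)) := by
  rw [superBracket_eq_of_odd hΩ, Fintype.sum_sum_type, map_add, map_sum, map_sum]
  congr 1
  · refine Finset.sum_congr rfl fun i _ => ?_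
    rw [map_smul, map_mul]
  · rw [Fintype.sum_sum_type]
    congr 1
    all_goals
      refine Finset.sum_congr rfl fun a _ => ?_
      rw [map_smul, map_mul]
      exact one_smul ℝ _

theorem ghostFiltration_cast {g n g' n' : ℤ} {x : GhostAlgebra A} (hx : x ∈ ghostFiltration A g n)
    (hg : g = g') (hn : n' ≤ n) : x ∈ ghostFiltration A g' n' :=
  ghostFiltration_anti hn (hg ▸ hx)

/-- The bracket with an odd superfunction `v` of ghost number one all of whose terms contain a ghost
momentum does not lower the number of ghost momenta. -/
theorem superEval_superBracket_mem {v : SuperFn U A} (hv : superInvolute v = -v)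
    (hv1 : ∀ x, superEval x v ∈ ghostFiltration A 1 1) {F : SuperFn U A} {g n : ℤ}
    (hF : ∀ x, superEval x F ∈ ghostFiltration A g n) (x : U) :
    superEval x (superBracket v F) ∈ ghostFiltration A (g + 1) n := by
  obtain ⟨a1, a2, a3⟩ := superEval_superDeriv_mem hv1 x
  obtain ⟨b1, b2, b3⟩ := superEval_superDeriv_mem hF x
  rw [superEval_superBracket hv]
  refine Submodule.add_mem _ (Submodule.sum_mem _ fun i _ => Submodule.smul_mem _ _ ?_)
    (Submodule.add_mem _ (Submodule.sum_mem _ fun a _ => ?_) (Submodule.sum_mem _ fun a _ => ?_))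
  · exact ghostFiltration_cast (mul_mem_ghostFiltration (a1 i) (b1 (i.swap))) (by ring) (by omega)
  · exact ghostFiltration_cast (mul_mem_ghostFiltration (a2 a) (b3 a)) (by ring) (by omega)
  · exact ghostFiltration_cast (mul_mem_ghostFiltration (a3 a) (b2 a)) (by ring) (by omega)

/-- To lowest order in the ghost momenta, the bracket with a charge is the Koszul differential. -/
theorem superEval_superBracket_sub_mem {c : A → PhaseSpace ι → ℝ} {Ω : SuperFn U A}
    (hΩ : superInvolute Ω = -Ω)
    (hΩ1 : ∀ x : U, superEval x Ω - ∑ a, c a x.1 • ghost a ∈ ghostFiltration A 1 1)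
    {F : SuperFn U A} {g n : ℤ} (hF : ∀ x, superEval x F ∈ ghostFiltration A g n) (x : U) :
    superEval x (superBracket Ω F)
      - ∑ a, c a x.1 • CliffordAlgebra.contractLeft (ghostMomentumCoord a) (superEval x F)
        ∈ ghostFiltration A (g + 1) n := by
  have hgh : ∀ x : U, ∑ a, c a x.1 • ghost a ∈ ghostFiltration A 1 0 := fun x =>
    Submodule.sum_mem _ fun a _ => Submodule.smul_mem _ _
      (ghostComponent_le_ghostFiltration le_rfl (by norm_num) (ghost_mem_ghostComponent a))
  have hΩ0 : ∀ x, superEval x Ω ∈ ghostFiltration A 1 0 := fun x => by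
    rw [← sub_add_cancel (superEval x Ω) (∑ a, c a x.1 • ghost a)]
    exact Submodule.add_mem _ (ghostFiltration_anti (by norm_num) (hΩ1 x)) (hgh x)
  obtain ⟨a1, -, -⟩ := superEval_superDeriv_mem hΩ0 x
  obtain ⟨b1, b2, b3⟩ := superEval_superDeriv_mem hF x
  have hι : ∀ (d : Module.Dual ℝ ((A → ℝ) × (A → ℝ))) (v : (A → ℝ) × (A → ℝ)),
      CliffordAlgebra.contractLeft d (ExteriorAlgebra.ι ℝ v)
        = algebraMap ℝ (GhostAlgebra A) (d v) :=
    fun d v => contractLeft_ι (Q := 0) d v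
  have h2 : ∀ a, superEval x (superDeriv (.inr (.inl a)) Ω)
      - algebraMap ℝ (GhostAlgebra A) (c a x.1) ∈ ghostFiltration A 0 1 := by
    intro a
    have h3 := contractLeft_ghostCoord_mem_ghostFiltration (hΩ1 x) a
    have h4 : CliffordAlgebra.contractLeft (ghostCoord a) (∑ b, c b x.1 • ghost b)
        = algebraMap ℝ (GhostAlgebra A) (c a x.1) := by
      rw [map_sum, Finset.sum_eq_single a]
      · rw [map_smul, ghost, hι, Algebra.smul_def, ← map_mul]
        simp [ghostCoord]
      · intro b _ hb
        rw [map_smul, ghost, hι]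
        simp [ghostCoord, hb.symm]
      · simp
    rw [map_sub, h4] at h3
    change superEval x (leftDeriv (ghostCoord a) Ω) - _ ∈ _
    rw [superEval_leftDeriv]
    exact h3
  have h3 : ∀ a, superEval x (superDeriv (.inr (.inr a)) Ω) ∈ ghostFiltration A 2 0 := by
    intro a
    have h3 := contractLeft_ghostMomentumCoord_mem_ghostFiltration (hΩ1 x) a
    have h4 : CliffordAlgebra.contractLeft (ghostMomentumCoord a) (∑ b, c b x.1 • ghost b) = 0 := by
      rw [map_sum]
      refine Finset.sum_eq_zero fun b _ => ?_
      rw [map_smul, ghost, hι]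
      simp [ghostMomentumCoord]
    rw [map_sub, h4, sub_zero] at h3
    change superEval x (leftDeriv (ghostMomentumCoord a) Ω) ∈ _
    rw [superEval_leftDeriv]
    exact ghostFiltration_cast h3 (by norm_num) (by norm_num)
  have h5 : ∀ a, superEval x (superDeriv (.inr (.inr a)) F)
      = CliffordAlgebra.contractLeft (ghostMomentumCoord a) (superEval x F) :=
    fun a => superEval_leftDeriv x _ F
  have h6 : ∑ a, superEval x (superDeriv (.inr (.inl a)) Ω)
        * superEval x (superDeriv (.inr (.inr a)) F)
      - ∑ a, c a x.1 • CliffordAlgebra.contractLeft (ghostMomentumCoord a) (superEval x F)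
      ∈ ghostFiltration A (g + 1) n := by
    rw [← Finset.sum_sub_distrib]
    refine Submodule.sum_mem _ fun a _ => ?_
    rw [← h5 a, Algebra.smul_def, ← sub_mul]
    exact ghostFiltration_cast (mul_mem_ghostFiltration (h2 a) (b3 a)) (by ring) (by omega)
  rw [superEval_superBracket hΩ, add_sub_assoc, add_sub_right_comm]
  refine Submodule.add_mem _ (Submodule.sum_mem _ fun i _ => Submodule.smul_mem _ _ ?_)
    (Submodule.add_mem _ h6 (Submodule.sum_mem _ fun a _ => ?_))
  · exact ghostFiltration_cast (mul_mem_ghostFiltration (a1 i) (b1 (i.swap))) (by ring) (by omega)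
  · exact ghostFiltration_cast (mul_mem_ghostFiltration (h3 a) (b2 a)) (by ring) (by omega)

theorem superInvolute_of_superEval_mem {k l : ℕ} (hkl : Odd (k + l)) {F : SuperFn U A}
    (hF : ∀ x, superEval x F ∈ ghostComponent A k l) : superInvolute F = -F := by
  refine SuperFn.ext_superEval fun x => ?_
  rw [superEval_superInvolute, map_neg,
    involute_of_mem_monomialSpan (ghostComponent_natCast_le k l (hF x)), hkl.neg_one_pow, neg_smul,
    one_smul]

/-- The lowest order `∑ a, c_a η^a` of a BRST charge. -/
noncomputable def minimalCharge (s : A → SmoothFn U) : SuperFn U A :=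
  ∑ a, s a ⊗ₜ[ℝ] ghost a

theorem superEval_minimalCharge (s : A → SmoothFn U) (x : U) :
    superEval x (minimalCharge s) = ∑ a, (s a).1 x • ghost a := by
  rw [minimalCharge, map_sum]
  exact Finset.sum_congr rfl fun a _ => superEval_tmul _ _ _

theorem superEval_minimalCharge_mem (s : A → SmoothFn U) (x : U) :
    superEval x (minimalCharge s) ∈ ghostComponent A 1 0 := by
  rw [superEval_minimalCharge]
  exact Submodule.sum_mem _ fun a _ => Submodule.smul_mem _ _ (ghost_mem_ghostComponent a)

theorem superInvolute_minimalCharge (s : A → SmoothFn U) :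
    superInvolute (minimalCharge s) = -minimalCharge s :=
  superInvolute_of_superEval_mem (k := 1) (l := 0) odd_one fun x => by
    exact_mod_cast superEval_minimalCharge_mem s x

/-- `{Ω₀, Ω₀} = ∑ a b, {c_a, c_b} η^a η^b` vanishes where the brackets of the constraints do. -/
theorem superEval_superBracket_minimalCharge {c : A → PhaseSpace ι → ℝ} {s : A → SmoothFn U}
    (hs : ∀ a, ∀ x : U, (s a).1 x = c a x.1) {x : U}
    (hx : ∀ a b, poissonBracket (c a) (c b) x.1 = 0) :
    superEval x (superBracket (minimalCharge s) (minimalCharge s)) = 0 := by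
  have hB : ∀ v, superEval x (bosonicDeriv v (minimalCharge s))
      = ∑ a, fderiv ℝ (c a) x.1 v • ghost a := by
    intro v
    rw [minimalCharge, map_sum, map_sum]
    refine Finset.sum_congr rfl fun a _ => ?_
    rw [bosonicDeriv_tmul, superEval_tmul, smoothFnDeriv_apply,
      (zeroExt_eventuallyEq (fun y => hs a y) x).fderiv_eq]
  have hP : ∀ a, superEval x (superDeriv (.inr (.inr a)) (minimalCharge s)) = 0 := by
    intro a
    have h1 := contractLeft_ghostMomentumCoord_mem (superEval_minimalCharge_mem s x) a
    rw [ghostComponent_eq_bot_of_neg _ (by norm_num), Submodule.mem_bot] at h1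
    exact (superEval_leftDeriv x _ _).trans h1
  rw [superEval_superBracket (superInvolute_minimalCharge s), Fintype.sum_sum_type]
  simp only [hP, mul_zero, zero_mul, Finset.sum_const_zero, add_zero]
  have h1 : ∀ v w : PhaseSpace ι, (∑ a, fderiv ℝ (c a) x.1 v • ghost a)
      * (∑ a, fderiv ℝ (c a) x.1 w • ghost a) = ∑ a, ∑ b, (fderiv ℝ (c a) x.1 v
        * fderiv ℝ (c b) x.1 w) • (ghost a * ghost b) := by
    intro v w
    simp only [Finset.sum_mul_sum, smul_mul_smul_comm]
  have h2 : ∀ i, superEval x (superDeriv (.inl (.inl i)) (minimalCharge s))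
      = ∑ a, fderiv ℝ (c a) x.1 (dirQ i) • ghost a := fun i => hB _
  have h3 : ∀ i, superEval x (superDeriv (.inl (.inr i)) (minimalCharge s))
      = ∑ a, fderiv ℝ (c a) x.1 (dirP i) • ghost a := fun i => hB _
  have h4 : ∀ i : ι, conj (.inl (.inl i) : (ι ⊕ ι) ⊕ (A ⊕ A)) = .inl (.inr i) := fun _ => rfl
  have h5 : ∀ i : ι, conj (.inl (.inr i) : (ι ⊕ ι) ⊕ (A ⊕ A)) = .inl (.inl i) := fun _ => rfl
  simp only [h4, h5, h2, h3, h1, bracketSign, one_smul, neg_smul]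
  rw [← Finset.sum_add_distrib]
  simp only [← sub_eq_add_neg, ← Finset.sum_sub_distrib, ← sub_smul]
  rw [Finset.sum_comm]
  refine Finset.sum_eq_zero fun a _ => ?_
  rw [Finset.sum_comm]
  refine Finset.sum_eq_zero fun b _ => ?_
  rw [← Finset.sum_smul]
  have := hx a b
  rw [poissonBracket] at this
  rw [this, zero_smul]

/-- One step of homological perturbation: the lowest order of `{Ω, Ω}` is closed for the Koszul
differential by the Jacobi identity, hence exact, and is removed by a term of higher order. -/
theorem exists_correction {c : A → PhaseSpace ι → ℝ}
    (hc : IsFirstClassSystem (U : Set (PhaseSpace ι)) c) {Ω : SuperFn U A}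
    (hΩ : superInvolute Ω = -Ω)
    (hΩ1 : ∀ x : U, superEval x Ω - ∑ a, c a x.1 • ghost a ∈ ghostFiltration A 1 1) {n : ℕ}
    (hR : ∀ x, superEval x (superBracket Ω Ω) ∈ ghostFiltration A 2 n)
    (h0 : n = 0 → ∀ x : U, (∀ a, c a x.1 = 0) → superEval x (superBracket Ω Ω) = 0) :
    ∃ v : SuperFn U A, (∀ x, superEval x v ∈ ghostComponent A (n + 2 : ℕ) (n + 1 : ℕ)) ∧
      ∀ x, superEval x (superBracket (Ω + v) (Ω + v)) ∈ ghostFiltration A 2 (n + 1 : ℕ) := by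
  obtain ⟨π, hπ⟩ := exists_projection_ghostComponent (A := A) 2 n
  set R := superBracket Ω Ω with hRdef
  set z : SuperFn U A := LinearMap.lTensor (SmoothFn U) π R with hz
  have hze : ∀ x, superEval x z = π (superEval x R) := fun x => superEval_lTensor x π R
  have hzm : ∀ x, superEval x z ∈ ghostComponent A (n + 2) n := fun x => by
    rw [hze]
    exact (hπ _ (hR x)).1
  have hzR : ∀ x, superEval x R - superEval x z ∈ ghostFiltration A 2 (n + 1) := fun x => by
    rw [hze]
    exact (hπ _ (hR x)).2
  -- `{Ω, {Ω, Ω}} = 0` puts `δz` in the filtration step above its own degree, so `δz = 0`.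
  have hδ : ∀ x : U,
      ∑ a, c a x.1 • CliffordAlgebra.contractLeft (ghostMomentumCoord a) (superEval x z) = 0 := by
    intro x
    have h1 := superEval_superBracket_sub_mem hΩ hΩ1 hR x
    rw [hRdef, superBracket_superBracket_self hΩ, map_zero, zero_sub, Submodule.neg_mem_iff,
      ← hRdef] at h1
    have h2 : ∑ a, c a x.1 •
        CliffordAlgebra.contractLeft (ghostMomentumCoord a) (superEval x R - superEval x z)
        ∈ ghostFiltration A 3 n := Submodule.sum_mem _ fun a _ => Submodule.smul_mem _ _
      (ghostFiltration_cast (contractLeft_ghostMomentumCoord_mem_ghostFiltration (hzR x) a)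
        (by norm_num) (by omega))
    have h3 : ∑ a, c a x.1 • CliffordAlgebra.contractLeft (ghostMomentumCoord a) (superEval x z)
        ∈ ghostFiltration A 3 n := by
      have h4 := Submodule.sub_mem _ (ghostFiltration_cast h1 (by norm_num) le_rfl) h2
      rw [← Finset.sum_sub_distrib] at h4
      convert h4 using 2 with a
      rw [← smul_sub, map_sub, sub_sub_cancel]
    have h5 : ∑ a, c a x.1 • CliffordAlgebra.contractLeft (ghostMomentumCoord a) (superEval x z)
        ∈ ghostComponent A (n + 2) (n - 1) := Submodule.sum_mem _ fun a _ =>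
      Submodule.smul_mem _ _ (contractLeft_ghostMomentumCoord_mem (hzm x) a)
    have h6 := disjoint_ghostComponent_ghostFiltration (A := A) 3 (n - 1)
    rw [sub_add_cancel, show (n : ℤ) - 1 + 3 = n + 2 by ring] at h6
    exact Submodule.disjoint_def.1 h6 _ h5 h3
  obtain ⟨w, hw⟩ := exists_superFn_koszul_primitive hc.smooth
    (fun x hx h => hc.regular_irreducible x ⟨hx, h⟩) hzm hδ fun hn x hx => by
      rw [hze, h0 hn x hx, map_zero]
  -- `{Ω + v, Ω + v}` equals `{Ω, Ω} + 2 δv` to this order, hence the factor.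
  set v : SuperFn U A := (-(1 / 2) : ℝ) • w with hv
  have hve : ∀ x, superEval x v = (-(1 / 2) : ℝ) • superEval x w := fun x => map_smul _ _ _
  have hvm : ∀ x, superEval x v ∈ ghostComponent A (n + 2 : ℕ) (n + 1 : ℕ) := fun x => by
    rw [hve]
    push_cast
    exact Submodule.smul_mem _ _ (hw x).1
  have hvF : ∀ x, superEval x v ∈ ghostFiltration A 1 (n + 1 : ℕ) := fun x =>
    ghostComponent_le_ghostFiltration le_rfl (by push_cast; ring) (hvm x)
  have hvodd : superInvolute v = -v := superInvolute_of_superEval_mem ⟨n + 1, by ring⟩ hvm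
  refine ⟨v, hvm, fun x => ?_⟩
  have h1 := superEval_superBracket_sub_mem hΩ hΩ1 hvF x
  have h2 := superEval_superBracket_mem hvodd
    (fun x => ghostFiltration_anti (by omega) (hvF x)) hvF x
  have h3 : (2 : ℝ) • ∑ a, c a x.1 •
      CliffordAlgebra.contractLeft (ghostMomentumCoord a) (superEval x v)
      = -superEval x z := by
    rw [← (hw x).2, ← Finset.sum_neg_distrib, Finset.smul_sum]
    refine Finset.sum_congr rfl fun a _ => ?_
    rw [hve, map_smul, smul_smul, smul_smul, ← neg_smul]
    congr 1
    ring
  have h4 : superEval x (superBracket (Ω + v) (Ω + v)) = (superEval x R - superEval x z)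
      + (2 : ℝ) • (superEval x (superBracket Ω v)
        - ∑ a, c a x.1 • CliffordAlgebra.contractLeft (ghostMomentumCoord a) (superEval x v))
      + superEval x (superBracket v v) := by
    rw [superBracket_add_self hΩ hvodd, map_add, map_add, map_smul, smul_sub, h3]
    abel
  rw [h4]
  refine Submodule.add_mem _ (Submodule.add_mem _ ?_ (Submodule.smul_mem _ _ ?_)) ?_
  · exact_mod_cast hzR x
  · exact ghostFiltration_cast h1 (by norm_num) le_rfl
  · exact ghostFiltration_cast h2 (by norm_num) le_rfl

end BRSTCharge

/-! ### Symmetry doubling -/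

section Doubling

open CliffordAlgebra

variable {ι A : Type*} [Fintype ι] [DecidableEq ι] [Fintype A] [DecidableEq A]
  {U : Opens (PhaseSpace ι)}

/-- The BRST charge can be built up to any order in the ghost momenta. -/
theorem exists_partial_charge {c : A → PhaseSpace ι → ℝ}
    (hc : IsFirstClassSystem (U : Set (PhaseSpace ι)) c) {s : A → SmoothFn U}
    (hs : ∀ a, ∀ x : U, (s a).1 x = c a x.1) (n : ℕ) :
    ∃ w : ℕ → SuperFn U A, w 0 = minimalCharge s ∧
      (∀ k x, superEval x (w k) ∈ ghostComponent A (k + 1 : ℕ) (k : ℕ)) ∧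
      ∀ x, superEval x (superBracket (∑ k ∈ Finset.range (n + 1), w k)
        (∑ k ∈ Finset.range (n + 1), w k)) ∈ ghostFiltration A 2 n := by
  have hmin : ∀ x : U, superEval x (minimalCharge s) - ∑ a, c a x.1 • ghost a
      ∈ ghostFiltration A 1 1 := fun x => by
    have h : ∑ a, c a x.1 • ghost a = superEval x (minimalCharge s) := by
      rw [superEval_minimalCharge]
      exact Finset.sum_congr rfl fun a _ => by rw [hs]
    rw [h, sub_self]
    exact Submodule.zero_mem _
  induction n with
  | zero =>
    refine ⟨Function.update 0 0 (minimalCharge s), Function.update_self _ _ _,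
      fun k x => ?_, fun x => ?_⟩
    · rcases eq_or_ne k 0 with rfl | hk
      · rw [Function.update_self]
        exact_mod_cast superEval_minimalCharge_mem s x
      · rw [Function.update_of_ne hk, Pi.zero_apply, map_zero]
        exact Submodule.zero_mem _
    · rw [zero_add, Finset.sum_range_one, Function.update_self]
      have h1 := superEval_superBracket_sub_mem (superInvolute_minimalCharge s) hmin
        (fun x => ghostComponent_le_ghostFiltration (g := 1) le_rfl (by norm_num)
          (superEval_minimalCharge_mem s x)) x
      have h2 : ∀ a,
          CliffordAlgebra.contractLeft (ghostMomentumCoord a)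
            (superEval x (minimalCharge s)) = 0 := by
        intro a
        have h1 := contractLeft_ghostMomentumCoord_mem (superEval_minimalCharge_mem s x) a
        rwa [ghostComponent_eq_bot_of_neg _ (by norm_num), Submodule.mem_bot] at h1
      rw [Finset.sum_eq_zero fun a _ => by rw [h2, smul_zero], sub_zero] at h1
      exact h1
  | succ n ih =>
    obtain ⟨w, hw0, hw, hR⟩ := ih
    set Ω := ∑ k ∈ Finset.range (n + 1), w k with hΩdef
    have hΩ : superInvolute Ω = -Ω := by
      rw [hΩdef, map_sum, ← Finset.sum_neg_distrib]
      exact Finset.sum_congr rfl fun k _ =>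
        superInvolute_of_superEval_mem ⟨k, by ring⟩ (hw k)
    have hΩ1 : ∀ x : U, superEval x Ω - ∑ a, c a x.1 • ghost a ∈ ghostFiltration A 1 1 := by
      intro x
      rw [hΩdef, Finset.sum_range_succ', hw0, map_add, add_sub_assoc, map_sum]
      refine Submodule.add_mem _ (Submodule.sum_mem _ fun k _ => ?_) (hmin x)
      exact ghostComponent_le_ghostFiltration (by omega) (by push_cast; ring) (hw (k + 1) x)
    obtain ⟨v, hv, hv2⟩ := exists_correction hc hΩ hΩ1 hR (by
      rintro rfl x hx
      rw [hΩdef, zero_add, Finset.sum_range_one, hw0]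
      exact superEval_superBracket_minimalCharge hs fun a b => hc.first_class x.1 ⟨x.2, hx⟩ a b)
    have hsum : ∑ k ∈ Finset.range (n + 1 + 1), Function.update w (n + 1) v k = Ω + v := by
      rw [Finset.sum_range_succ, Function.update_self, hΩdef]
      congr 1
      refine Finset.sum_congr rfl fun k hk => Function.update_of_ne ?_ _ _
      exact (Finset.mem_range.1 hk).ne
    refine ⟨Function.update w (n + 1) v, ?_, fun k x => ?_, fun x => ?_⟩
    · rw [Function.update_of_ne (by omega), hw0]
    · rcases eq_or_ne k (n + 1) with rfl | hk
      · rw [Function.update_self]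
        exact hv x
      · rw [Function.update_of_ne hk]
        exact hw k x
    · rw [hsum]
      exact hv2 x

theorem minimalCharge_eq_sum (s : A → SmoothFn U) : minimalCharge s =
    ∑ α : Fin (0 + 1) → A, ∑ β : Fin 0 → A,
      s (α 0) ⊗ₜ[ℝ] (ghostMonomial α * ghostMomentumMonomial β) := by
  rw [minimalCharge]
  refine (Fintype.sum_equiv (Equiv.funUnique (Fin 1) A) _ _ fun α => ?_).symm
  rw [Fintype.sum_unique]
  have h1 : ghostMonomial α = ghost (α 0) := by
    rw [ghostMonomial, List.ofFn_succ, List.ofFn_zero, List.prod_singleton]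
  have h2 : ghostMomentumMonomial (default : Fin 0 → A) = 1 := by
    rw [ghostMomentumMonomial, List.ofFn_zero, List.prod_nil]
  rw [h1, h2, mul_one]
  rfl

theorem exists_isBRSTCharge {c : A → PhaseSpace ι → ℝ}
    (hc : IsFirstClassSystem (U : Set (PhaseSpace ι)) c) : ∃ Ω, IsBRSTCharge U c Ω := by
  set s : A → SmoothFn U := fun a => ⟨fun x => c a x.1, (hc.smooth a).congr fun x hx =>
    zeroExt_apply _ hx⟩ with hs
  obtain ⟨w, hw0, hw, hR⟩ := exists_partial_charge hc (s := s) (fun a x => rfl) (Fintype.card A)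
  choose u hu using fun k => exists_eq_sum_monomial (hw k)
  -- The coefficients of lowest order are prescribed; the others come from any expansion.
  refine ⟨∑ k ∈ Finset.range (Fintype.card A + 1), w k,
    ⟨Function.update u 0 fun α _ => s (α 0), fun α β x => by rw [Function.update_self], ?_⟩, ?_⟩
  · refine Finset.sum_congr rfl fun k _ => ?_
    rcases eq_or_ne k 0 with rfl | hk
    · rw [hw0, Function.update_self, minimalCharge_eq_sum]
    · rw [Function.update_of_ne hk]
      exact hu k
  · refine SuperFn.ext_superEval fun x => ?_
    have h := hR x
    rwa [ghostFiltration_eq_bot (by omega), Submodule.mem_bot, ← map_zero (superEval x)] at h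

theorem IsBRSTCharge.superInvolute_eq {c : A → PhaseSpace ι → ℝ} {Ω : SuperFn U A}
    (h : IsBRSTCharge U c Ω) : superInvolute Ω = -Ω := by
  obtain ⟨⟨u, -, rfl⟩, -⟩ := h
  rw [map_sum, ← Finset.sum_neg_distrib]
  refine Finset.sum_congr rfl fun n _ => ?_
  rw [map_sum, ← Finset.sum_neg_distrib]
  refine Finset.sum_congr rfl fun α _ => ?_
  rw [map_sum, ← Finset.sum_neg_distrib]
  refine Finset.sum_congr rfl fun β _ => ?_
  have h1 : (-1 : ℝ) ^ (n + 1 + n) = -1 := Odd.neg_one_pow ⟨n, by ring⟩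
  rw [superInvolute_tmul, map_mul, involute_ghostMonomial, involute_ghostMomentumMonomial,
    smul_mul_smul_comm, ← pow_add, h1, neg_smul, one_smul, TensorProduct.tmul_neg]

theorem ghostSwap_tmul_monomial {k l : ℕ} (f : SmoothFn U) (α : Fin k → A) (β : Fin l → A) :
    ghostSwap (f ⊗ₜ[ℝ] (ghostMonomial α * ghostMomentumMonomial β))
      = f ⊗ₜ[ℝ] (ghostMomentumMonomial α * ghostMonomial β) := by
  set m := ExteriorAlgebra.map (LinearEquiv.prodComm ℝ (A → ℝ) (A → ℝ)).toLinearMap with hm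
  have h1 : m (ghostMonomial α) = ghostMomentumMonomial α := by
    rw [ghostMonomial, map_list_prod, List.map_ofFn, ghostMomentumMonomial]
    congr 2
    funext i
    exact ExteriorAlgebra.map_apply_ι _ _
  have h2 : m (ghostMomentumMonomial β) = ghostMonomial β := by
    rw [ghostMonomial, ghostMomentumMonomial, map_list_prod, List.map_ofFn]
    congr 2
    funext i
    exact ExteriorAlgebra.map_apply_ι _ _
  refine (Algebra.TensorProduct.map_tmul (AlgHom.id ℝ (SmoothFn U)) m f _).trans ?_
  rw [map_mul, h1, h2]
  rfl

theorem IsBRSTCharge.ghostSwap {d : A → PhaseSpace ι → ℝ} {Ω : SuperFn U A}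
    (h : IsBRSTCharge U d Ω) : IsNilpotentGaugeFixingFermion U d (ghostSwap Ω) := by
  obtain ⟨⟨u, hu, hΩ⟩, hR⟩ := h
  refine ⟨⟨u, hu, ?_⟩, by rw [superBracket_ghostSwap, hR, map_zero]⟩
  conv_lhs => rw [hΩ]
  rw [map_sum]
  refine Finset.sum_congr rfl fun n _ => ?_
  rw [map_sum]
  refine Finset.sum_congr rfl fun α _ => ?_
  rw [map_sum]
  exact Finset.sum_congr rfl fun β _ => ghostSwap_tmul_monomial _ _ _

theorem symmetryDoubling {c d : A → PhaseSpace ι → ℝ}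
    (hc : IsFirstClassSystem (U : Set (PhaseSpace ι)) c)
    (hd : IsFirstClassSystem (U : Set (PhaseSpace ι)) d) : SymmetryDoubling U c d := by
  have hodd : ∀ Ω' : SuperFn U A, IsBRSTCharge U d Ω' →
      superInvolute (ghostSwap Ω') = -ghostSwap Ω' := fun Ω' h => by
    rw [ghostSwap_superInvolute, h.superInvolute_eq, map_neg]
  exact
    { exists_charge := exists_isBRSTCharge hc
      exists_dual_charge := exists_isBRSTCharge hd
      fermion := fun Ω' h => h.ghostSwap
      nilpotent_s₁ := fun Ω h => superBracket_superBracket_eq_zero h.superInvolute_eq h.2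
      nilpotent_s₂ := fun Ω' h =>
        superBracket_right_superBracket_right_eq_zero (hodd Ω' h) h.ghostSwap.2
      invariant_s₁ := fun Ω Ω' h _ => superBracket_superBracket_eq_zero h.superInvolute_eq h.2 _
      invariant_s₂ := fun Ω Ω' _ h =>
        superBracket_right_superBracket_right_eq_zero (hodd Ω' h) h.ghostSwap.2 Ω }

end Doubling

theorem mainTheorem1 {ι A I : Type*} [Fintype ι] [DecidableEq ι] [Fintype A] [DecidableEq A]
    [Fintype I] [DecidableEq I] (U : Opens (PhaseSpace ι))
    (χ σ : A → PhaseSpace ι → ℝ) (η : I → PhaseSpace ι → ℝ)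
    (hχ : IsFirstClassSystem (U : Set (PhaseSpace ι)) χ)
    (hσ : IsFirstClassSystem (U : Set (PhaseSpace ι)) σ)
    (hχη : IsFirstClassSystem (U : Set (PhaseSpace ι)) (Sum.elim χ η))
    (hση : IsFirstClassSystem (U : Set (PhaseSpace ι)) (Sum.elim σ η))
    (hχσ : IsMaximallySymplectic (U : Set (PhaseSpace ι)) χ σ) :
    SymmetryTrading (U : Set (PhaseSpace ι)) χ σ η ∧
      SymmetryDoubling U χ σ ∧
      SymmetryDoubling U (Sum.elim χ η) (Sum.elim σ η) :=
  ⟨symmetryTrading U.2 hχ hσ hχη hση hχσ, symmetryDoubling hχ hσ, symmetryDoubling hχη hση⟩
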